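/- **Setting.** Let $M>0$ and consider the Schwarzschild exterior $\mathbb{R}\times(2M,\infty)\times S^2$ with metric $$g=(1-2M/r)\,dt^2-(1-2M/r)^{-1}dr^2-r^2(d\theta^2+\sin^2\theta\,d\phi^2),$$ with $\partial_t$ future pointing and with either choice of orientation. Let $*$ be the Hodge dual on two-forms, ${*}F_{ab}=\tfrac12 e_{abcd}F^{cd}$ with $e$ the volume form, and put $\xi^a=(\partial_t)^a$, $U_a=-r^{-1}\nabla_a r$, $Y_{ab}=-2r^3\sin\theta\,d\theta_{[a}d\phi_{b]}$. Let $F_{ab}$ be a smooth real two-form on the exterior which solves the Maxwell equations $\nabla^aF_{ab}=0$, $\nabla_{[a}F_{bc]}=0$, and define $$Z_{ab}=-\tfrac43\,{*}F_{[a}{}^{c}Y_{b]c},\qquad \beta_a=-\tfrac12U^bZ_{ab}-\tfrac12 i\,U^b{*}Z_{ab}-\tfrac12\nabla_bZ_a{}^b-\tfrac12 i\,\nabla_b{*}Z_a{}^b,$$ $$\mathbf H_{ab}=\beta_{(a}\bar\beta_{b)}-\tfrac12 g_{ab}\beta^c\bar\beta_c .$$ With $$A^a=\frac{(r-3M)(r-2M)}{2r^2}(\partial_r)^a,\qquad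 q=\frac{9M^2(r-2M)(2r-3M)}{4r^5},$$ define the real current $$\mathbf P_a=\mathbf H_{ab}A^b+\tfrac14q\beta^bZ_{ab}+\tfrac14q\bar\beta^bZ_{ab}-\tfrac14 i\,q\beta^b{*}Z_{ab}+\tfrac14 i\,q\bar\beta^b{*}Z_{ab}+\tfrac1{16}Z_{bc}Z^{bc}\nabla_aq-\tfrac14Z_a{}^cZ_{bc}\nabla^bq .$$ A *spherically symmetric slice* $\Sigma$ is a smooth spacelike hypersurface of the exterior given as the image of a smooth injective map $\Phi:D\to\{r>2M\}$, where $D\subseteq\mathbb{R}^3$ is open and invariant under rotations, $\Phi$ commutes with the action of $SO(3)$, and $-\Phi^*g$ is positive definite. **Theorem.** For every real constant $c_1$ with $|c_1|\le 10/9$ and every spherically symmetric slice $\Sigma$ with future pointing timelike normal $N^a$, $N^aN_a=1$, and induced volume element $d\mu_\Sigma$, $$\int_\Sigma N^a\bigl(\mathbf H_{ab}\xi^b+c_1\mathbf P_a\bigr)\,d\mu_\Sigma\ \ge\ 0 .$$ If the integrand is not assumed to be integrable, this means that the integral of its negative part is at most the integral of its positive part, as elements of $[0,\infty]$. -/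

import Mathlib

open MeasureTheory Set
open scoped ContDiff

noncomputable section

namespace Schwarzschild

/-- Coordinates `(t, x¹, x², x³)` on the Schwarzschild exterior, where `(x¹, x², x³)` are the
Cartesian coordinates belonging to the Schwarzschild spherical coordinates:
`x¹ = r sin θ cos φ`, `x² = r sin θ sin φ`, `x³ = r cos θ`.  They cover the whole exterior,
poles included, by one smooth chart. -/
abbrev Spacetime := Fin 4 → ℝ

/-- Euclidean three-space. -/
abbrev E3 := EuclideanSpace ℝ (Fin 3)

/-- The area radius `r`. -/
def rad (p : Spacetime) : ℝ := √(p 1 ^ 2 + p 2 ^ 2 + p 3 ^ 2)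

/-- The exterior region `r > 2M`. -/
def exterior (M : ℝ) : Set Spacetime := {p | 2 * M < rad p}

/-- The coordinate partial derivative `∂_a f`. -/
def pd (a : Fin 4) (f : Spacetime → ℝ) (p : Spacetime) : ℝ :=
  fderiv ℝ f p (Pi.single a 1)

/-- The components of `dt`. -/
def dt (a : Fin 4) : ℝ := if a = 0 then 1 else 0

/-- The components of `dr = (x¹ dx¹ + x² dx² + x³ dx³) / r`. -/
def dr (p : Spacetime) (a : Fin 4) : ℝ := if a = 0 then 0 else p a / rad p

/-- The components of the flat spatial metric `(dx¹)² + (dx²)² + (dx³)²`. -/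
def flat (a b : Fin 4) : ℝ := if a = b ∧ a ≠ 0 then 1 else 0

/-- The Schwarzschild metric
`g = (1 - 2M/r) dt² - (1 - 2M/r)⁻¹ dr² - r² (dθ² + sin² θ dφ²)`, where
`r² (dθ² + sin² θ dφ²) = (dx¹)² + (dx²)² + (dx³)² - dr²`. -/
def metric (M : ℝ) (p : Spacetime) : Matrix (Fin 4) (Fin 4) ℝ :=
  Matrix.of fun a b =>
    (1 - 2 * M / rad p) * (dt a * dt b)
      - (1 - 2 * M / rad p)⁻¹ * (dr p a * dr p b)
      - (flat a b - dr p a * dr p b)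

/-- The inverse metric `g^{ab}`. -/
def invMetric (M : ℝ) (p : Spacetime) : Matrix (Fin 4) (Fin 4) ℝ := (metric M p)⁻¹

/-- The scalar product `g_{ab} v^a w^b`. -/
def inner4 (M : ℝ) (p v w : Spacetime) : ℝ := ∑ a, ∑ b, metric M p a b * v a * w b

/-- The Christoffel symbols `Γ^c_{ab}` of the Levi-Civita connection. -/
def christoffel (M : ℝ) (p : Spacetime) (c a b : Fin 4) : ℝ :=
  (1 / 2) * ∑ d, invMetric M p c d *
    (pd a (fun y => metric M y b d) p + pd b (fun y => metric M y a d) p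
      - pd d (fun y => metric M y a b) p)

/-- Covariant two-tensor fields, by components. -/
abbrev Tensor2 := Spacetime → Fin 4 → Fin 4 → ℝ

/-- The covariant derivative `∇_c T_{ab}`. -/
def cov (M : ℝ) (T : Tensor2) (p : Spacetime) (c a b : Fin 4) : ℝ :=
  pd c (fun y => T y a b) p
    - ∑ d, christoffel M p d c a * T p d b
    - ∑ d, christoffel M p d c b * T p a d

/-- The Levi-Civita symbol, with `leviCivita 0 1 2 3 = 1`. -/
def leviCivita (a b c d : Fin 4) : ℝ :=
  Matrix.det (Matrix.of fun i j : Fin 4 => if ![a, b, c, d] i = j then (1 : ℝ) else 0)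

/-- The volume form `e_{abcd}` of the orientation `o`: positive on `(∂_t, ∂_1, ∂_2, ∂_3)`
if `o = 1`, and negative if `o = -1`. -/
def volForm (M : ℝ) (o : ℤˣ) (p : Spacetime) (a b c d : Fin 4) : ℝ :=
  ((o : ℤ) : ℝ) * √|(metric M p).det| * leviCivita a b c d

/-- The Hodge dual `*T_{ab} = ½ e_{abcd} T^{cd}`. -/
def hodge (M : ℝ) (o : ℤˣ) (T : Tensor2) : Tensor2 := fun p a b =>
  (1 / 2) * ∑ c, ∑ d, ∑ c', ∑ d',
    volForm M o p a b c d * invMetric M p c c' * invMetric M p d d' * T p c' d'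

/-- `F` is a smooth real two-form on the exterior with `∇^a F_{ab} = 0` and
`∇_{[a} F_{bc]} = 0`. -/
structure IsMaxwellField (M : ℝ) (F : Tensor2) : Prop where
  smooth : ContDiffOn ℝ ∞ F (exterior M)
  antisymm : ∀ p ∈ exterior M, ∀ a b, F p a b = - F p b a
  divergence : ∀ p ∈ exterior M, ∀ b, ∑ a, ∑ c, invMetric M p a c * cov M F p c a b = 0
  closed : ∀ p ∈ exterior M, ∀ a b c,
    cov M F p a b c + cov M F p b c a + cov M F p c a b = 0

/-- The Killing-Yano tensor `Y_{ab} = -2 r³ sin θ dθ_{[a} dφ_{b]}`.  As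
`r² sin θ dθ ∧ dφ` is the area form of the sphere of radius `r`, this is
`Y(u, v) = -det(x, u, v)` on the spatial parts of `u`, `v`. -/
def killingYano (p : Spacetime) (a b : Fin 4) : ℝ := - ∑ c, leviCivita 0 c a b * p c

/-- `U_a = -r⁻¹ ∇_a r`. -/
def covU (p : Spacetime) (a : Fin 4) : ℝ := - (rad p)⁻¹ * pd a rad p

/-- `Z_{ab} = -(4/3) *F_{[a}{}^c Y_{b]c}`. -/
def fieldZ (M : ℝ) (o : ℤˣ) (F : Tensor2) : Tensor2 := fun p a b =>
  - (4 / 3) * ((1 / 2) *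
    ∑ c, ∑ d, invMetric M p c d *
      (hodge M o F p a d * killingYano p b c - hodge M o F p b d * killingYano p a c))

/-- `U^b T_{ab}`. -/
def contractU (M : ℝ) (T : Tensor2) (p : Spacetime) (a : Fin 4) : ℝ :=
  ∑ b, ∑ c, invMetric M p b c * covU p c * T p a b

/-- `∇_b T_a{}^b`. -/
def divSecond (M : ℝ) (T : Tensor2) (p : Spacetime) (a : Fin 4) : ℝ :=
  ∑ b, ∑ c, invMetric M p b c * cov M T p c a b

/-- `β_a = -½ U^b Z_{ab} - ½ i U^b *Z_{ab} - ½ ∇_b Z_a{}^b - ½ i ∇_b *Z_a{}^b`. -/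
def beta (M : ℝ) (o : ℤˣ) (F : Tensor2) (p : Spacetime) (a : Fin 4) : ℂ :=
  - (1 / 2) * (contractU M (fieldZ M o F) p a : ℂ)
    - (1 / 2) * Complex.I * (contractU M (hodge M o (fieldZ M o F)) p a : ℂ)
    - (1 / 2) * (divSecond M (fieldZ M o F) p a : ℂ)
    - (1 / 2) * Complex.I * (divSecond M (hodge M o (fieldZ M o F)) p a : ℂ)

/-- `β^a`. -/
def betaUp (M : ℝ) (o : ℤˣ) (F : Tensor2) (p : Spacetime) (a : Fin 4) : ℂ :=
  ∑ b, (invMetric M p a b : ℂ) * beta M o F p b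

/-- The superenergy tensor `H_{ab} = β_{(a} β̄_{b)} - ½ g_{ab} β^c β̄_c` (the expression is
real, so that taking the real part only changes the type). -/
def superH (M : ℝ) (o : ℤˣ) (F : Tensor2) (p : Spacetime) (a b : Fin 4) : ℝ :=
  ((1 / 2) * (beta M o F p a * star (beta M o F p b) + beta M o F p b * star (beta M o F p a))
    - (1 / 2) * (metric M p a b : ℂ) *
        ∑ c, betaUp M o F p c * star (beta M o F p c)).re

/-- The Killing vector field `ξ = ∂_t`. -/
def xi : Spacetime := Pi.single 0 1

/-- `A = ((r - 3M)(r - 2M) / (2 r²)) ∂_r`, where `∂_r = (xⁱ / r) ∂_i`. -/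
def vecA (M : ℝ) (p : Spacetime) : Spacetime := fun a =>
  (rad p - 3 * M) * (rad p - 2 * M) / (2 * rad p ^ 2) * (if a = 0 then 0 else p a / rad p)

/-- `q = 9 M² (r - 2M)(2r - 3M) / (4 r⁵)`. -/
def scalarQ (M : ℝ) (p : Spacetime) : ℝ :=
  9 * M ^ 2 * (rad p - 2 * M) * (2 * rad p - 3 * M) / (4 * rad p ^ 5)

/-- The current
`P_a = H_{ab} A^b + ¼ q β^b Z_{ab} + ¼ q β̄^b Z_{ab} - ¼ i q β^b *Z_{ab} + ¼ i q β̄^b *Z_{ab}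
  + (1/16) Z_{bc} Z^{bc} ∇_a q - ¼ Z_a{}^c Z_{bc} ∇^b q`
(the expression is real, so that taking the real part only changes the type). -/
def currentP (M : ℝ) (o : ℤˣ) (F : Tensor2) (p : Spacetime) (a : Fin 4) : ℝ :=
  let Z := fieldZ M o F
  let W := hodge M o Z
  let q : ℂ := (scalarQ M p : ℂ)
  (∑ b, superH M o F p a b * vecA M p b)
    + (∑ b, ((1 / 4) * q * betaUp M o F p b * (Z p a b : ℂ)
        + (1 / 4) * q * star (betaUp M o F p b) * (Z p a b : ℂ)
        - (1 / 4) * Complex.I * q * betaUp M o F p b * (W p a b : ℂ)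
        + (1 / 4) * Complex.I * q * star (betaUp M o F p b) * (W p a b : ℂ))).re
    + (1 / 16) * (∑ b, ∑ c, ∑ b', ∑ c',
        invMetric M p b b' * invMetric M p c c' * Z p b c * Z p b' c') * pd a (scalarQ M) p
    - (1 / 4) * ∑ b, ∑ c, ∑ b', ∑ c',
        invMetric M p c c' * Z p a c' * Z p b c * (invMetric M p b b' * pd b' (scalarQ M) p)

/-- The action of a rotation on Euclidean three-space. -/
def rot3 (R : Matrix (Fin 3) (Fin 3) ℝ) (x : E3) : E3 := WithLp.toLp 2 (R.mulVec x.ofLp)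

/-- The action of a rotation on spacetime, at fixed `t`. -/
def rot4 (R : Matrix (Fin 3) (Fin 3) ℝ) (p : Spacetime) : Spacetime :=
  Fin.cons (p 0) (R.mulVec (Fin.tail p))

/-- A spherically symmetric spacelike slice `Σ` of the exterior: the image of a rotation
invariant open set `dom ⊆ ℝ³` under a smooth injective map `emb` into the exterior, which
commutes with rotations and for which the pulled back metric is negative definite. -/
structure SphericalSlice (M : ℝ) where
  dom : Set E3
  emb : E3 → Spacetime
  isOpen_dom : IsOpen dom
  smooth : ContDiffOn ℝ ∞ emb dom
  injOn : InjOn emb dom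
  mapsTo : MapsTo emb dom (exterior M)
  spacelike : ∀ x ∈ dom, ∀ v : E3, v ≠ 0 →
    inner4 M (emb x) (fderiv ℝ emb x v) (fderiv ℝ emb x v) < 0
  rot_mem : ∀ R ∈ Matrix.specialOrthogonalGroup (Fin 3) ℝ, ∀ x ∈ dom, rot3 R x ∈ dom
  equivariant : ∀ R ∈ Matrix.specialOrthogonalGroup (Fin 3) ℝ, ∀ x ∈ dom,
    emb (rot3 R x) = rot4 R (emb x)

namespace SphericalSlice

variable {M : ℝ}

/-- The Riemannian metric `-g` induced on the slice, in the coordinates of `dom`. -/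
def induced (S : SphericalSlice M) (x : E3) : Matrix (Fin 3) (Fin 3) ℝ :=
  Matrix.of fun i j => - inner4 M (S.emb x)
    (fderiv ℝ S.emb x (EuclideanSpace.single i 1)) (fderiv ℝ S.emb x (EuclideanSpace.single j 1))

/-- The induced volume measure `μ_Σ`, in the coordinates of `dom`. -/
def vol (S : SphericalSlice M) : Measure E3 :=
  (volume.restrict S.dom).withDensity fun x => ENNReal.ofReal √(S.induced x).det

/-- `N x` is the future pointing unit normal of the slice at the point `S.emb x`. -/
structure IsUnitNormal (S : SphericalSlice M) (N : E3 → Spacetime) : Prop where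
  unit : ∀ x ∈ S.dom, inner4 M (S.emb x) (N x) (N x) = 1
  future : ∀ x ∈ S.dom, 0 < inner4 M (S.emb x) (N x) xi
  orthogonal : ∀ x ∈ S.dom, ∀ v : E3, inner4 M (S.emb x) (N x) (fderiv ℝ S.emb x v) = 0

/-- The energy density `N^a (H_{ab} ξ^b + c₁ P_a)` at the point `S.emb x`. -/
def density (S : SphericalSlice M) (o : ℤˣ) (F : Tensor2) (N : E3 → Spacetime) (c₁ : ℝ)
    (x : E3) : ℝ :=
  ∑ a, N x a * ((∑ b, superH M o F (S.emb x) a b * xi b) + c₁ * currentP M o F (S.emb x) a)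

end SphericalSlice

end Schwarzschild

end

/-!
The contractions of `Z` with the null vectors `∂_t ± (1 - 2M/r) ∂_r` are, up to a factor `2`, two
fields `V` tangential to the spheres, and the real and imaginary parts of the components of `β`
along these null vectors are, up to sign, the divergence and the curl of `V` on the spheres. The
normal of a spherically symmetric slice is a combination of the two null vectors with positive
coefficients which are constant on the orbits of the rotations, so it is enough to bound the null
components of the energy covector `H_{ab} ξ^b + c P_a` from below.

With `A = m (1 - 2M/r) ∂_r` and `σ = ±1`, such a component is
`½ (1 + σ c m) ((div V)² + (curl V)²)` plus a quadratic form in `V` and the tangential part of `β`.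
For `|c| ≤ 10/9` a discriminant estimate bounds this form from below by `-(1 + σ c m) |V|² / r²`, so
the component is at least `½ (1 + σ c m) ((div V)² + (curl V)² - 2 |V|² / r²)`. By the Bochner
identity on the sphere of radius `r`, the last bracket is, up to a divergence, twice the squared
norm of the traceless symmetric gradient of `V`. The weights are constant on the orbits of the
rotations, so the divergence integrates to zero over every compact rotation invariant part of the
slice.
-/

open scoped Matrix Topology

noncomputable section

namespace Schwarzschild

/-- The spatial part of the components of a vector, of a covector, or of a position. -/
def spatial (v : Spacetime) : Fin 3 → ℝ := Fin.tail v

/-- The outward unit vector `x / r` of flat space. -/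
def radialUnit (p : Spacetime) : Fin 3 → ℝ := (rad p)⁻¹ • spatial p

/-- The metric coefficient `1 - 2M/s` at the radius `s`. -/
def lapseSq (M s : ℝ) : ℝ := 1 - 2 * M / s

section Radius

variable {M : ℝ} {p : Spacetime}

theorem isOpen_exterior (M : ℝ) : IsOpen (exterior M) := by
  have : Continuous rad := by unfold rad; fun_prop
  exact isOpen_lt continuous_const this

theorem exterior_mem_nhds (hp : p ∈ exterior M) : exterior M ∈ 𝓝 p :=
  (isOpen_exterior M).mem_nhds hp

theorem rad_sq (p : Spacetime) : rad p ^ 2 = spatial p ⬝ᵥ spatial p := by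
  rw [rad, Real.sq_sqrt (by positivity), Matrix.vec3_dotProduct, ← sq, ← sq, ← sq]
  rfl

theorem rad_pos (hM : 0 ≤ M) (hp : p ∈ exterior M) : 0 < rad p :=
  lt_of_le_of_lt (by positivity) (show 2 * M < rad p from hp)

theorem lapseSq_mul_rad (hr : 0 < rad p) : lapseSq M (rad p) * rad p = rad p - 2 * M := by
  unfold lapseSq
  field_simp

theorem lapseSq_pos (hM : 0 ≤ M) (hp : p ∈ exterior M) : 0 < lapseSq M (rad p) := by
  have h : 0 < lapseSq M (rad p) * rad p := by
    rw [lapseSq_mul_rad (rad_pos hM hp)]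
    exact sub_pos.2 hp
  exact pos_of_mul_pos_left h (rad_pos hM hp).le

theorem radialUnit_dot_self (hr : 0 < rad p) : radialUnit p ⬝ᵥ radialUnit p = 1 := by
  rw [radialUnit, smul_dotProduct, dotProduct_smul, ← rad_sq, smul_eq_mul, smul_eq_mul]
  field_simp

theorem rad_smul_radialUnit (hr : 0 < rad p) : rad p • radialUnit p = spatial p :=
  smul_inv_smul₀ hr.ne' _

theorem contDiffAt_rad (hr : 0 < rad p) {n : WithTop ℕ∞} : ContDiffAt ℝ n rad p := by
  refine ContDiffAt.sqrt (by fun_prop) fun h => hr.ne' ?_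
  rw [rad, h, Real.sqrt_zero]

theorem differentiableAt_rad (hr : 0 < rad p) : DifferentiableAt ℝ rad p :=
  (contDiffAt_rad hr (n := 1)).differentiableAt one_ne_zero

theorem hasDerivAt_lapseSq {s : ℝ} (hs : s ≠ 0) :
    HasDerivAt (lapseSq M) (2 * M / s ^ 2) s := by
  have h := ((hasDerivAt_inv hs).const_mul (2 * M)).const_sub 1
  exact h.congr_deriv (by ring)

end Radius

section PartialDerivatives

variable {f g : Spacetime → ℝ} {p : Spacetime}

theorem pd_congr (h : f =ᶠ[𝓝 p] g) (a : Fin 4) : pd a f p = pd a g p := by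
  rw [pd, h.fderiv_eq, pd]

theorem pd_const (c : ℝ) (a : Fin 4) : pd a (fun _ => c) p = 0 := by
  simp [pd]

theorem pd_neg (a : Fin 4) : pd a (fun y => -f y) p = -pd a f p := by
  simp [pd]

theorem pd_add (hf : DifferentiableAt ℝ f p) (hg : DifferentiableAt ℝ g p) (a : Fin 4) :
    pd a (fun y => f y + g y) p = pd a f p + pd a g p := by
  simp [pd, fderiv_fun_add hf hg]

theorem pd_sub (hf : DifferentiableAt ℝ f p) (hg : DifferentiableAt ℝ g p) (a : Fin 4) :
    pd a (fun y => f y - g y) p = pd a f p - pd a g p := by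
  simp [pd, fderiv_fun_sub hf hg]

theorem pd_mul (hf : DifferentiableAt ℝ f p) (hg : DifferentiableAt ℝ g p) (a : Fin 4) :
    pd a (fun y => f y * g y) p = pd a f p * g p + f p * pd a g p := by
  simp [pd, fderiv_fun_mul hf hg, mul_comm, add_comm]

theorem pd_coord (a b : Fin 4) : pd a (fun y => y b) p = (Pi.single a 1 : Spacetime) b := by
  have h : fderiv ℝ (fun y : Spacetime => y b) p = ContinuousLinearMap.proj b :=
    (ContinuousLinearMap.proj (R := ℝ) (φ := fun _ : Fin 4 => ℝ) b).fderiv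
  rw [pd, h, ContinuousLinearMap.proj_apply]

theorem pd_comp_rad {φ : ℝ → ℝ} {φ' : ℝ} (hr : 0 < rad p) (h : HasDerivAt φ φ' (rad p))
    (a : Fin 4) : pd a (fun y => φ (rad y)) p = φ' * pd a rad p := by
  have hφ := (h.comp_hasFDerivAt p (differentiableAt_rad hr).hasFDerivAt).fderiv
  simp only [Function.comp_def] at hφ
  simp [pd, hφ]

theorem differentiableAt_comp_rad {φ : ℝ → ℝ} {φ' : ℝ} (hr : 0 < rad p)
    (h : HasDerivAt φ φ' (rad p)) : DifferentiableAt ℝ (fun y => φ (rad y)) p :=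
  h.differentiableAt.comp p (differentiableAt_rad hr)

theorem pd_rad (hr : 0 < rad p) (a : Fin 4) : pd a rad p = dr p a := by
  have h : HasFDerivAt rad _ p :=
    HasFDerivAt.sqrt (((hasFDerivAt_apply 1 p).pow 2).add ((hasFDerivAt_apply 2 p).pow 2)
      |>.add ((hasFDerivAt_apply 3 p).pow 2)) (Real.sqrt_ne_zero'.1 hr.ne' |>.ne')
  rw [pd, h.fderiv, dr, rad]
  fin_cases a <;> simp <;> ring

theorem differentiableAt_inv_rad (hr : 0 < rad p) :
    DifferentiableAt ℝ (fun y => (rad y)⁻¹) p :=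
  (differentiableAt_rad hr).inv hr.ne'

theorem differentiableAt_dr (hr : 0 < rad p) (a : Fin 4) :
    DifferentiableAt ℝ (fun y => dr y a) p := by
  simp only [dr, div_eq_mul_inv]
  split_ifs
  · exact differentiableAt_const _
  · exact (differentiableAt_apply a p).mul (differentiableAt_inv_rad hr)

theorem pd_dr (hr : 0 < rad p) (a b : Fin 4) :
    pd a (fun y => dr y b) p = (flat a b - dr p a * dr p b) / rad p := by
  rcases eq_or_ne b 0 with rfl | hb
  · simp [dr, flat, pd_const]
  · have hinv := pd_comp_rad hr (hasDerivAt_inv hr.ne') a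
    have hflat : (Pi.single a 1 : Spacetime) b = flat a b := by
      by_cases hab : a = b <;> simp [flat, hab, hb, Ne.symm]
    have hb' : dr p b = p b * (rad p)⁻¹ := by simp only [dr, if_neg hb, div_eq_mul_inv]
    rw [hb']
    simp only [dr, hb, if_false, div_eq_mul_inv]
    rw [pd_mul (differentiableAt_apply b p) (differentiableAt_inv_rad hr), hinv, pd_coord,
      pd_rad hr, hflat, dr]
    field_simp
    ring

end PartialDerivatives

section Metric

variable {M : ℝ} {p : Spacetime}

theorem dr_zero (p : Spacetime) : dr p 0 = 0 := if_pos rfl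

theorem dr_succ (p : Spacetime) (i : Fin 3) : dr p i.succ = radialUnit p i := by
  rw [dr, if_neg i.succ_ne_zero, div_eq_inv_mul]
  rfl

theorem spatial_dr (p : Spacetime) : spatial (dr p) = radialUnit p := funext (dr_succ p)

theorem dt_zero : dt 0 = 1 := if_pos rfl

theorem dt_succ (i : Fin 3) : dt i.succ = 0 := if_neg i.succ_ne_zero

theorem flat_zero_left (a : Fin 4) : flat 0 a = 0 := if_neg (by grind)

theorem flat_zero_right (a : Fin 4) : flat a 0 = 0 := if_neg (by grind)

theorem flat_succ (i j : Fin 3) : flat i.succ j.succ = (1 : Matrix (Fin 3) (Fin 3) ℝ) i j := by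
  simp [flat, Matrix.one_apply]

theorem flat_comm (a b : Fin 4) : flat a b = flat b a := by
  unfold flat
  grind

theorem sum_mul_eq (v w : Spacetime) : ∑ a, v a * w a = v 0 * w 0 + spatial v ⬝ᵥ spatial w :=
  Fin.sum_univ_succ _

theorem sum_dr_mul (p v : Spacetime) : ∑ a, dr p a * v a = radialUnit p ⬝ᵥ spatial v := by
  rw [sum_mul_eq, dr_zero, zero_mul, zero_add, spatial_dr]

theorem sum_dt_mul (v : Spacetime) : ∑ a, dt a * v a = v 0 := by
  simp [dt]

theorem sum_flat_mul (a : Fin 4) (v : Spacetime) :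
    ∑ b, flat a b * v b = v a - dt a * v 0 := by
  refine Fin.cases ?_ (fun i => ?_) a
  · simp [flat_zero_left, dt_zero]
  · simp [Fin.sum_univ_succ (n := 3), flat_zero_right, flat_succ, dt_succ, Matrix.one_apply]

/-- The components of the rotation invariant tensor `α dt² + β dr² + γ (flat - dr²)`. -/
def sphericalForm (p : Spacetime) (α β γ : ℝ) : Matrix (Fin 4) (Fin 4) ℝ :=
  Matrix.of fun a b =>
    α * (dt a * dt b) + β * (dr p a * dr p b) + γ * (flat a b - dr p a * dr p b)

theorem sum_sphericalForm_mul (α β γ : ℝ) (a : Fin 4) (v : Spacetime) :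
    ∑ b, sphericalForm p α β γ a b * v b = α * v 0 * dt a
      + β * (radialUnit p ⬝ᵥ spatial v) * dr p a
      + γ * (v a - v 0 * dt a - (radialUnit p ⬝ᵥ spatial v) * dr p a) := by
  have h : ∀ b, sphericalForm p α β γ a b * v b = α * dt a * (dt b * v b)
      + β * dr p a * (dr p b * v b) + γ * (flat a b * v b - dr p a * (dr p b * v b)) :=
    fun b => by simp only [sphericalForm, Matrix.of_apply]; ring
  simp only [h, Finset.sum_add_distrib, Finset.sum_sub_distrib, ← Finset.mul_sum, sum_dt_mul,
    sum_dr_mul, sum_flat_mul]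
  ring

theorem sum_sphericalForm_mul_mul (α β γ : ℝ) (v w : Spacetime) :
    ∑ a, ∑ b, sphericalForm p α β γ a b * v a * w b = α * (v 0 * w 0)
      + β * ((radialUnit p ⬝ᵥ spatial v) * (radialUnit p ⬝ᵥ spatial w))
      + γ * (spatial v ⬝ᵥ spatial w
        - (radialUnit p ⬝ᵥ spatial v) * (radialUnit p ⬝ᵥ spatial w)) := by
  have h : ∀ a, ∑ b, sphericalForm p α β γ a b * v a * w b
      = (α - γ) * w 0 * (dt a * v a) + (β - γ) * (radialUnit p ⬝ᵥ spatial w) * (dr p a * v a)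
        + γ * (v a * w a) := fun a => by
    simp only [mul_right_comm _ (v a), ← Finset.sum_mul, sum_sphericalForm_mul]
    ring
  simp only [h, Finset.sum_add_distrib, ← Finset.mul_sum, sum_dt_mul, sum_dr_mul, sum_mul_eq]
  ring

theorem sum_sphericalForm_mul_dt (α β γ : ℝ) (a : Fin 4) :
    ∑ b, sphericalForm p α β γ a b * dt b = α * dt a := by
  have h : spatial dt = 0 := funext dt_succ
  simp only [sum_sphericalForm_mul, dt_zero, h, dotProduct_zero]
  ring

theorem sum_sphericalForm_mul_dr (hr : 0 < rad p) (α β γ : ℝ) (a : Fin 4) :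
    ∑ b, sphericalForm p α β γ a b * dr p b = β * dr p a := by
  simp only [sum_sphericalForm_mul, dr_zero, spatial_dr, radialUnit_dot_self hr]
  ring

theorem sphericalForm_comm (α β γ : ℝ) (a b : Fin 4) :
    sphericalForm p α β γ a b = sphericalForm p α β γ b a := by
  simp only [sphericalForm, Matrix.of_apply, flat_comm a b, mul_comm (dt a), mul_comm (dr p a)]

theorem sphericalForm_mul (hr : 0 < rad p) (α β γ α' β' γ' : ℝ) :
    sphericalForm p α β γ * sphericalForm p α' β' γ'
      = sphericalForm p (α * α') (β * β') (γ * γ') := by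
  ext a b
  have hr' : radialUnit p ⬝ᵥ spatial (sphericalForm p α' β' γ' b) = β' * dr p b := by
    rw [← sum_dr_mul, ← sum_sphericalForm_mul_dr hr α' β' γ']
    simp only [mul_comm]
  have ht : sphericalForm p α' β' γ' b 0 = α' * dt b := by
    simp [sphericalForm, dt_zero, dr_zero, flat_zero_right]
  simp only [Matrix.mul_apply, sphericalForm_comm α' β' γ' _ b, sum_sphericalForm_mul, ht, hr']
  simp only [sphericalForm, Matrix.of_apply, flat_comm b a]
  ring

theorem sphericalForm_one (p : Spacetime) : sphericalForm p 1 1 1 = 1 := by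
  ext a b
  have h : dt a * dt b + flat a b = (1 : Matrix (Fin 4) (Fin 4) ℝ) a b := by
    simp only [dt, flat, Matrix.one_apply]
    grind
  simp only [sphericalForm, Matrix.of_apply, ← h]
  ring

theorem det_sphericalForm (hr : 0 < rad p) (α β γ : ℝ) :
    (sphericalForm p α β γ).det = α * β * γ ^ 2 := by
  have hn := radialUnit_dot_self hr
  rw [Matrix.det_succ_row_zero, Fin.sum_univ_succ (n := 3)]
  simp only [mul_zero, zero_mul, add_zero, Matrix.det_fin_three,
    Matrix.submatrix_apply, Fin.succAbove_zero, sphericalForm, Matrix.of_apply, dt_succ, dr_succ,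
    flat_succ, dt_zero, dr_zero, flat_zero_left]
  simp only [Matrix.one_apply, Matrix.vec3_dotProduct] at hn ⊢
  simp
  linear_combination α * γ ^ 2 * (β - γ) * hn

theorem metric_eq (M : ℝ) (p : Spacetime) :
    metric M p = sphericalForm p (lapseSq M (rad p)) (-(lapseSq M (rad p))⁻¹) (-1) := by
  ext a b
  simp only [metric, sphericalForm, lapseSq, Matrix.of_apply]
  ring

theorem invMetric_eq (hM : 0 ≤ M) (hp : p ∈ exterior M) :
    invMetric M p = sphericalForm p (lapseSq M (rad p))⁻¹ (-lapseSq M (rad p)) (-1) := by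
  have hf := (lapseSq_pos hM hp).ne'
  refine Matrix.inv_eq_right_inv ?_
  rw [metric_eq, sphericalForm_mul (rad_pos hM hp), ← sphericalForm_one p, neg_mul_neg,
    neg_mul_neg, mul_one, mul_inv_cancel₀ hf, inv_mul_cancel₀ hf]

theorem det_metric (hM : 0 ≤ M) (hp : p ∈ exterior M) : (metric M p).det = -1 := by
  have hf := (lapseSq_pos hM hp).ne'
  rw [metric_eq, det_sphericalForm (rad_pos hM hp)]
  field_simp

theorem inner4_eq (M : ℝ) (p v w : Spacetime) :
    inner4 M p v w = lapseSq M (rad p) * (v 0 * w 0) - spatial v ⬝ᵥ spatial w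
      + (1 - (lapseSq M (rad p))⁻¹) *
        ((radialUnit p ⬝ᵥ spatial v) * (radialUnit p ⬝ᵥ spatial w)) := by
  rw [inner4, metric_eq, sum_sphericalForm_mul_mul]
  ring

theorem pd_metric (hM : 0 ≤ M) (hp : p ∈ exterior M) (c a b : Fin 4) :
    pd c (fun y => metric M y a b) p =
      2 * M / rad p ^ 2 * dr p c *
        (dt a * dt b + (lapseSq M (rad p))⁻¹ ^ 2 * (dr p a * dr p b))
      + (1 - (lapseSq M (rad p))⁻¹) / rad p *
        ((flat c a - dr p c * dr p a) * dr p b + dr p a * (flat c b - dr p c * dr p b)) := by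
  have hr := rad_pos hM hp
  have hf := (lapseSq_pos hM hp).ne'
  have hlapse := hasDerivAt_lapseSq (M := M) hr.ne'
  have hcoeff : HasDerivAt (fun s => 1 - (lapseSq M s)⁻¹)
      (2 * M / rad p ^ 2 * (lapseSq M (rad p))⁻¹ ^ 2) (rad p) :=
    ((hlapse.inv hf).const_sub 1).congr_deriv (by ring)
  have hdr := (differentiableAt_dr hr a).fun_mul (differentiableAt_dr hr b)
  have hsplit : (fun y => metric M y a b) = fun y =>
      lapseSq M (rad y) * (dt a * dt b) - flat a b
        + (1 - (lapseSq M (rad y))⁻¹) * (dr y a * dr y b) := by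
    funext y
    simp only [metric, lapseSq, Matrix.of_apply]
    ring
  have hmono := differentiableAt_comp_rad hr hlapse
  rw [hsplit, pd_add ((hmono.mul_const _).sub_const _)
      ((differentiableAt_comp_rad hr hcoeff).fun_mul hdr),
    pd_sub (hmono.mul_const _) (differentiableAt_const _),
    pd_mul hmono (differentiableAt_const _), pd_mul (differentiableAt_comp_rad hr hcoeff) hdr,
    pd_mul (differentiableAt_dr hr a) (differentiableAt_dr hr b), pd_const, pd_const,
    pd_dr hr, pd_dr hr, pd_comp_rad hr hlapse, pd_comp_rad hr hcoeff, pd_rad hr]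
  ring

theorem christoffel_eq (hM : 0 ≤ M) (hp : p ∈ exterior M) (c a b : Fin 4) :
    christoffel M p c a b =
      M / rad p ^ 2 * (lapseSq M (rad p))⁻¹ * (dr p a * dt b + dr p b * dt a) * dt c
      + (M / rad p ^ 2 * (lapseSq M (rad p) * (dt a * dt b)
          - (lapseSq M (rad p))⁻¹ * (dr p a * dr p b))
        + (1 - lapseSq M (rad p)) / rad p * (flat a b - dr p a * dr p b)) * dr p c := by
  have hr := rad_pos hM hp
  have hf := (lapseSq_pos hM hp).ne'
  have hlower : ∀ d, pd a (fun y => metric M y b d) p + pd b (fun y => metric M y a d) p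
      - pd d (fun y => metric M y a b) p =
        2 * (M / rad p ^ 2) * (dr p a * dt b + dr p b * dt a) * dt d
        + 2 * (M / rad p ^ 2 * ((lapseSq M (rad p))⁻¹ ^ 2 * (dr p a * dr p b) - dt a * dt b)
          + (1 - (lapseSq M (rad p))⁻¹) / rad p * (flat a b - dr p a * dr p b)) * dr p d := by
    intro d
    rw [pd_metric hM hp, pd_metric hM hp, pd_metric hM hp, flat_comm b a, flat_comm d a,
      flat_comm d b]
    ring
  have hraise : ∀ x y, ∑ d, invMetric M p c d * (x * dt d + y * dr p d)
      = x * ((lapseSq M (rad p))⁻¹ * dt c) + y * (-lapseSq M (rad p) * dr p c) := fun x y => by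
    rw [invMetric_eq hM hp]
    simp only [mul_add, Finset.sum_add_distrib, mul_left_comm _ x, mul_left_comm _ y,
      ← Finset.mul_sum, sum_sphericalForm_mul_dt, sum_sphericalForm_mul_dr hr]
  simp only [christoffel, hlower, hraise]
  field_simp
  ring

end Metric

/-- The two-form with the electric part `P` and the magnetic part `Q`. -/
def twoForm (P Q : Fin 3 → ℝ) : Matrix (Fin 4) (Fin 4) ℝ :=
  !![0, P 0, P 1, P 2; -P 0, 0, Q 2, -Q 1; -P 1, -Q 2, 0, Q 0; -P 2, Q 1, -Q 0, 0]

/-- The electric part of a two-form. -/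
def elecPart (T : Fin 4 → Fin 4 → ℝ) : Fin 3 → ℝ := fun i => T 0 i.succ

/-- The magnetic part of a two-form. -/
def magPart (T : Fin 4 → Fin 4 → ℝ) : Fin 3 → ℝ := ![T 2 3, T 3 1, T 1 2]

section TwoForms

variable {M : ℝ} {p : Spacetime}

theorem eq_twoForm {T : Fin 4 → Fin 4 → ℝ} (hT : ∀ a b, T a b = -T b a) :
    T = twoForm (elecPart T) (magPart T) := by
  have hdiag : ∀ a, T a a = 0 := fun a => by linarith [hT a a]
  ext a b
  fin_cases a <;> fin_cases b <;>
    first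
    | rfl
    | exact hdiag _
    | exact hT _ _

theorem twoForm_mulVec_zero (P Q : Fin 3 → ℝ) (v : Spacetime) :
    (twoForm P Q *ᵥ v) 0 = P ⬝ᵥ spatial v := by
  simp [twoForm, Matrix.mulVec, dotProduct, spatial, Fin.tail, Fin.sum_univ_succ]

theorem spatial_twoForm_mulVec (P Q : Fin 3 → ℝ) (v : Spacetime) :
    spatial (twoForm P Q *ᵥ v) = spatial v ⨯₃ Q - v 0 • P := by
  ext i
  fin_cases i <;>
    simp [twoForm, Matrix.mulVec, dotProduct, spatial, Fin.tail, Fin.sum_univ_succ,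
      cross_apply] <;>
    ring

theorem sphericalForm_mul_twoForm_mul (hr : 0 < rad p) (α β γ : ℝ) (P Q : Fin 3 → ℝ) :
    sphericalForm p α β γ * twoForm P Q * sphericalForm p α β γ =
      twoForm (α • (γ • P + ((β - γ) * (radialUnit p ⬝ᵥ P)) • radialUnit p))
        (γ • (β • Q + ((γ - β) * (radialUnit p ⬝ᵥ Q)) • radialUnit p)) := by
  have hn := radialUnit_dot_self hr
  set n := radialUnit p with hn_def
  have hform : sphericalForm p α β γ =
      !![α, 0, 0, 0;
        0, γ + (β - γ) * n 0 ^ 2, (β - γ) * (n 0 * n 1), (β - γ) * (n 0 * n 2);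
        0, (β - γ) * (n 0 * n 1), γ + (β - γ) * n 1 ^ 2, (β - γ) * (n 1 * n 2);
        0, (β - γ) * (n 0 * n 2), (β - γ) * (n 1 * n 2), γ + (β - γ) * n 2 ^ 2] := by
    have h1 := dr_succ p 0
    have h2 := dr_succ p 1
    have h3 := dr_succ p 2
    simp only [Fin.succ_zero_eq_one, Fin.succ_one_eq_two, ← hn_def] at h1 h2
    replace h3 : dr p 3 = n 2 := h3
    ext a b
    fin_cases a <;> fin_cases b <;>
      simp [sphericalForm, dt, flat, dr_zero, h1, h2, h3] <;>
      ring
  rw [Matrix.vec3_dotProduct] at hn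
  ext a b
  rw [hform]
  linear_combination (norm := skip) γ * (β - γ) * twoForm 0 Q a b * hn
  fin_cases a <;> fin_cases b <;> simp [twoForm, Matrix.vec3_dotProduct] <;> ring

theorem leviCivita_eq (a b c d : Fin 4) : leviCivita a b c d =
    ((b - a : ℝ) * (c - a) * (d - a) * (c - b) * (d - b) * (d - c)) / 12 := by
  have hvandermonde : (Matrix.of fun i j : Fin 4 => if ![a, b, c, d] i = j then (1 : ℝ) else 0) *
      Matrix.vandermonde (fun i : Fin 4 => (i : ℝ)) =
      Matrix.vandermonde (fun i : Fin 4 => (![a, b, c, d] i : ℝ)) := by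
    ext i j
    simp [Matrix.mul_apply, Matrix.vandermonde]
  have hdet := congrArg Matrix.det hvandermonde
  rw [Matrix.det_mul, Matrix.det_vandermonde, Matrix.det_vandermonde] at hdet
  have hI0 : Finset.Ioi (0 : Fin 4) = {1, 2, 3} := by decide
  have hI1 : Finset.Ioi (1 : Fin 4) = {2, 3} := by decide
  have hI2 : Finset.Ioi (2 : Fin 4) = {3} := by decide
  have hI3 : Finset.Ioi (3 : Fin 4) = ∅ := by decide
  simp [Fin.prod_univ_four, hI0, hI1, hI2, hI3] at hdet
  norm_num at hdet
  rw [leviCivita, eq_div_iff (by norm_num)]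
  linarith

theorem twoForm_transpose (P Q : Fin 3 → ℝ) : (twoForm P Q)ᵀ = -twoForm P Q := by
  ext a b
  fin_cases a <;> fin_cases b <;> simp [twoForm]

theorem twoForm_apply_comm (P Q : Fin 3 → ℝ) (a b : Fin 4) :
    twoForm P Q a b = -twoForm P Q b a := by
  rw [← Matrix.transpose_apply (twoForm P Q), twoForm_transpose, Matrix.neg_apply]

theorem smul_twoForm (c : ℝ) (P Q : Fin 3 → ℝ) (a b : Fin 4) :
    c * twoForm P Q a b = twoForm (c • P) (c • Q) a b := by
  fin_cases a <;> fin_cases b <;> simp [twoForm]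

theorem half_sum_leviCivita_mul_twoForm (P Q : Fin 3 → ℝ) (a b : Fin 4) :
    1 / 2 * ∑ c, ∑ d, leviCivita a b c d * twoForm P Q c d = twoForm Q P a b := by
  simp only [leviCivita_eq]
  fin_cases a <;> fin_cases b <;> simp [Fin.sum_univ_four, twoForm] <;> ring

theorem hodge_eq_of_twoForm (hM : 0 ≤ M) (hp : p ∈ exterior M) (o : ℤˣ) {T : Tensor2}
    {P Q : Fin 3 → ℝ} (hT : T p = twoForm P Q) :
    hodge M o T p = twoForm
      (((o : ℤ) : ℝ) • (lapseSq M (rad p) • Q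
        + ((1 - lapseSq M (rad p)) * (radialUnit p ⬝ᵥ Q)) • radialUnit p))
      (-(((o : ℤ) : ℝ) * (lapseSq M (rad p))⁻¹) • (P
        - ((1 - lapseSq M (rad p)) * (radialUnit p ⬝ᵥ P)) • radialUnit p)) := by
  have hr := rad_pos hM hp
  have hsum : ∀ a b c d, ∑ c', ∑ d',
      volForm M o p a b c d * invMetric M p c c' * invMetric M p d d' * T p c' d'
        = ((o : ℤ) : ℝ) *
          (leviCivita a b c d * (invMetric M p * twoForm P Q * invMetric M p) c d) := by
    intro a b c d
    have hcomm : ∀ d', invMetric M p d d' = invMetric M p d' d := by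
      simp only [invMetric_eq hM hp, sphericalForm_comm _ _ _ d, implies_true]
    rw [Finset.sum_comm]
    simp only [hT, Matrix.mul_apply, volForm, det_metric hM hp, abs_neg, abs_one, Real.sqrt_one,
      mul_one, Finset.mul_sum, Finset.sum_mul, hcomm]
    exact Finset.sum_congr rfl fun d' _ => Finset.sum_congr rfl fun c' _ => by ring
  ext a b
  simp only [hodge, hsum, ← Finset.mul_sum]
  rw [mul_left_comm, invMetric_eq hM hp, sphericalForm_mul_twoForm_mul hr,
    half_sum_leviCivita_mul_twoForm, smul_twoForm]
  refine congrFun₂ (congrArg₂ twoForm ?_ ?_) a b <;> module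

end TwoForms

section TangentialForms

variable {M : ℝ} {p : Spacetime} {o : ℤˣ}

/-- The two-form whose contraction with the null vector `∂_t ± (1 - 2M/r) ∂_r` is `P ± R` up to
sign, for `P` and `R` tangential to the spheres. -/
def tangentialForm (M : ℝ) (p : Spacetime) (P R : Fin 3 → ℝ) : Matrix (Fin 4) (Fin 4) ℝ :=
  twoForm P ((lapseSq M (rad p))⁻¹ • (radialUnit p ⨯₃ R))

theorem radialUnit_cross_cross (hr : 0 < rad p) {P : Fin 3 → ℝ} (hP : radialUnit p ⬝ᵥ P = 0) :
    radialUnit p ⨯₃ (radialUnit p ⨯₃ P) = -P := by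
  rw [cross_cross_eq_smul_sub_smul', hP, radialUnit_dot_self hr]
  module

theorem hodge_eq_of_tangentialForm (hM : 0 ≤ M) (hp : p ∈ exterior M) (o : ℤˣ) {T : Tensor2}
    {P R : Fin 3 → ℝ} (hP : radialUnit p ⬝ᵥ P = 0) (hT : T p = tangentialForm M p P R) :
    hodge M o T p = tangentialForm M p (((o : ℤ) : ℝ) • (radialUnit p ⨯₃ R))
      (((o : ℤ) : ℝ) • (radialUnit p ⨯₃ P)) := by
  have hf := (lapseSq_pos hM hp).ne'
  rw [hodge_eq_of_twoForm hM hp o hT, tangentialForm, map_smul,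
    radialUnit_cross_cross (rad_pos hM hp) hP, hP, dotProduct_smul, dot_self_cross]
  congr 1
  · rw [smul_inv_smul₀ hf]
    module
  · module

theorem killingYano_eq (p : Spacetime) : killingYano p = twoForm 0 (-spatial p) := by
  ext a b
  simp only [killingYano, leviCivita_eq]
  fin_cases a <;> fin_cases b <;>
    simp [Fin.sum_univ_four, twoForm, spatial, Fin.tail] <;> ring

theorem twoForm_mul_sub_mul (P Q w : Fin 3 → ℝ) :
    twoForm P Q * twoForm 0 w - twoForm 0 w * twoForm P Q = twoForm (w ⨯₃ P) (w ⨯₃ Q) := by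
  ext a b
  fin_cases a <;> fin_cases b <;> simp [twoForm, cross_apply] <;> ring

/-- The electric tangential part of `Z`. -/
def fieldS (M : ℝ) (o : ℤˣ) (F : Tensor2) (p : Spacetime) : Fin 3 → ℝ :=
  (2 / 3 * ((o : ℤ) : ℝ) * lapseSq M (rad p)) • (spatial p ⨯₃ magPart (F p))

/-- The magnetic tangential part of `Z`, turned by a right angle. -/
def fieldD (o : ℤˣ) (F : Tensor2) (p : Spacetime) : Fin 3 → ℝ :=
  (2 / 3 * ((o : ℤ) : ℝ)) • (spatial p ⨯₃ (radialUnit p ⨯₃ elecPart (F p)))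

theorem sum_invMetric_mul_killingYano (hM : 0 ≤ M) (hp : p ∈ exterior M) (b d : Fin 4) :
    ∑ c, invMetric M p c d * killingYano p b c = killingYano p d b := by
  have hskew : killingYano p d b = -killingYano p b d := by
    rw [killingYano_eq, twoForm_apply_comm]
  have hradial : killingYano p b 0 = 0 ∧ radialUnit p ⬝ᵥ spatial (killingYano p b) = 0 := by
    have hx : spatial p ⬝ᵥ spatial (killingYano p b) = 0 := by
      rw [killingYano_eq, Matrix.vec3_dotProduct]
      fin_cases b <;> simp [twoForm, spatial, Fin.tail] <;> ring
    refine ⟨?_, by rw [radialUnit, smul_dotProduct, hx, smul_zero]⟩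
    rw [killingYano_eq]
    fin_cases b <;> simp [twoForm]
  simp only [invMetric_eq hM hp, sphericalForm_comm _ _ _ _ d, sum_sphericalForm_mul, hradial,
    hskew]
  ring

theorem killingYano_contraction (hM : 0 ≤ M) (hp : p ∈ exterior M) (P Q : Fin 3 → ℝ)
    (a b : Fin 4) :
    -(4 / 3) * (1 / 2 * ∑ c, ∑ d, invMetric M p c d *
        (twoForm P Q a d * killingYano p b c - twoForm P Q b d * killingYano p a c))
      = 2 / 3 * twoForm (spatial p ⨯₃ P) (spatial p ⨯₃ Q) a b := by
  have hraise : ∀ a b, ∑ c, ∑ d, invMetric M p c d * (twoForm P Q a d * killingYano p b c)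
      = (twoForm P Q * twoForm 0 (-spatial p)) a b := by
    intro a b
    rw [Finset.sum_comm, Matrix.mul_apply, ← killingYano_eq]
    refine Finset.sum_congr rfl fun d _ => ?_
    rw [← sum_invMetric_mul_killingYano hM hp, Finset.mul_sum]
    exact Finset.sum_congr rfl fun c _ => mul_left_comm _ _ _
  have htranspose : (twoForm P Q * twoForm 0 (-spatial p)) b a
      = (twoForm 0 (-spatial p) * twoForm P Q) a b := by
    rw [← Matrix.transpose_apply (_ * _), Matrix.transpose_mul, twoForm_transpose,
      twoForm_transpose, neg_mul_neg]
  have hcommutator : (twoForm P Q * twoForm 0 (-spatial p)) a b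
      - (twoForm 0 (-spatial p) * twoForm P Q) a b
        = -1 * twoForm (spatial p ⨯₃ P) (spatial p ⨯₃ Q) a b := by
    refine (congrFun₂ (twoForm_mul_sub_mul P Q (-spatial p)) a b).trans ?_
    rw [smul_twoForm, map_neg, LinearMap.neg_apply, LinearMap.neg_apply, neg_one_smul,
      neg_one_smul]
  simp only [mul_sub (invMetric M p _ _), Finset.sum_sub_distrib, hraise, htranspose, hcommutator]
  ring

theorem fieldZ_eq (hM : 0 ≤ M) (hp : p ∈ exterior M) {F : Tensor2}
    (hF : ∀ a b, F p a b = -F p b a) :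
    fieldZ M o F p = tangentialForm M p (fieldS M o F p) (fieldD o F p) := by
  have hr := rad_pos hM hp
  have hn : radialUnit p ⨯₃ (spatial p ⨯₃ (radialUnit p ⨯₃ elecPart (F p)))
      = -(spatial p ⨯₃ elecPart (F p)) := by
    simp only [← rad_smul_radialUnit hr, map_smul, LinearMap.smul_apply,
      radialUnit_cross_cross hr (dot_self_cross _ _), smul_neg]
  have hx : spatial p ⨯₃ radialUnit p = 0 := by
    rw [radialUnit, map_smul, cross_self, smul_zero]
  ext a b
  rw [fieldZ]
  simp only [hodge_eq_of_twoForm hM hp o (eq_twoForm hF)]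
  rw [killingYano_contraction hM hp, tangentialForm, smul_twoForm, fieldS, fieldD]
  refine congrFun₂ (congrArg₂ twoForm ?_ ?_) a b
  · rw [map_smul, map_add, map_smul, map_smul, hx]
    module
  · rw [map_smul, map_sub, map_smul, map_smul, hx, hn]
    module

end TangentialForms

/-- The coordinate partial derivative `∂_a V` of a vector field, componentwise. -/
def vecPd (a : Fin 4) (V : Spacetime → Fin 3 → ℝ) (p : Spacetime) : Fin 3 → ℝ :=
  fun j => pd a (fun y => V y j) p

/-- The spatial Jacobian matrix `∂_i V_j`. -/
def jac (V : Spacetime → Fin 3 → ℝ) (p : Spacetime) : Matrix (Fin 3) (Fin 3) ℝ :=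
  Matrix.of fun i => vecPd i.succ V p

/-- The flat spatial divergence. -/
def div3 (V : Spacetime → Fin 3 → ℝ) (p : Spacetime) : ℝ := (jac V p).trace

/-- The flat spatial curl. -/
def curl3 (V : Spacetime → Fin 3 → ℝ) (p : Spacetime) : Fin 3 → ℝ :=
  ![jac V p 1 2 - jac V p 2 1, jac V p 2 0 - jac V p 0 2, jac V p 0 1 - jac V p 1 0]

section VectorCalculus

variable {p : Spacetime} {V W : Spacetime → Fin 3 → ℝ}

theorem differentiableAt_spatial : DifferentiableAt ℝ spatial p :=
  differentiableAt_pi.2 fun i => differentiableAt_apply i.succ p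

theorem vecPd_smul {φ : Spacetime → ℝ} (hφ : DifferentiableAt ℝ φ p)
    (hV : DifferentiableAt ℝ V p) (a : Fin 4) :
    vecPd a (fun y => φ y • V y) p = pd a φ p • V p + φ p • vecPd a V p :=
  funext fun j => pd_mul hφ (differentiableAt_pi.1 hV j) a

theorem vecPd_add (hV : DifferentiableAt ℝ V p) (hW : DifferentiableAt ℝ W p) (a : Fin 4) :
    vecPd a (fun y => V y + W y) p = vecPd a V p + vecPd a W p :=
  funext fun j => pd_add (differentiableAt_pi.1 hV j) (differentiableAt_pi.1 hW j) a

theorem vecPd_const_smul (c : ℝ) (hV : DifferentiableAt ℝ V p) (a : Fin 4) :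
    vecPd a (fun y => c • V y) p = c • vecPd a V p := by
  funext j
  refine (pd_mul (differentiableAt_const c) (differentiableAt_pi.1 hV j) a).trans ?_
  rw [pd_const, zero_mul, zero_add]
  rfl

theorem differentiableAt_cross (hV : DifferentiableAt ℝ V p) (hW : DifferentiableAt ℝ W p) :
    DifferentiableAt ℝ (fun y => V y ⨯₃ W y) p :=
  have hcross := (LinearMap.toContinuousBilinearMap (crossProduct (R := ℝ))).differentiableAt
  (hcross.comp p hV).clm_apply hW

theorem contDiffAt_cross {n : WithTop ℕ∞} (hV : ContDiffAt ℝ n V p) (hW : ContDiffAt ℝ n W p) :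
    ContDiffAt ℝ n (fun y => V y ⨯₃ W y) p :=
  have hcross := (LinearMap.toContinuousBilinearMap (crossProduct (R := ℝ))).contDiff
  (hcross.contDiffAt.comp p hV).clm_apply hW

theorem vecPd_cross (hV : DifferentiableAt ℝ V p) (hW : DifferentiableAt ℝ W p) (a : Fin 4) :
    vecPd a (fun y => V y ⨯₃ W y) p = vecPd a V p ⨯₃ W p + V p ⨯₃ vecPd a W p := by
  have hv := differentiableAt_pi.1 hV
  have hw := differentiableAt_pi.1 hW
  have hcomp : ∀ i j, pd a (fun y => V y i * W y j - V y j * W y i) p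
      = vecPd a V p i * W p j - vecPd a V p j * W p i
        + (V p i * vecPd a W p j - V p j * vecPd a W p i) := fun i j => by
    rw [pd_sub ((hv i).fun_mul (hw j)) ((hv j).fun_mul (hw i)), pd_mul (hv i) (hw j),
      pd_mul (hv j) (hw i)]
    simp only [vecPd]
    ring
  simp only [cross_apply]
  ext j
  fin_cases j
  · exact hcomp 1 2
  · exact hcomp 2 0
  · exact hcomp 0 1

theorem pd_dotProduct (hV : DifferentiableAt ℝ V p) (hW : DifferentiableAt ℝ W p) (a : Fin 4) :
    pd a (fun y => V y ⬝ᵥ W y) p = vecPd a V p ⬝ᵥ W p + V p ⬝ᵥ vecPd a W p := by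
  have hv := differentiableAt_pi.1 hV
  have hw := differentiableAt_pi.1 hW
  simp only [Matrix.vec3_dotProduct]
  rw [pd_add, pd_add, pd_mul, pd_mul, pd_mul]
  · simp only [vecPd]
    ring
  all_goals fun_prop

theorem vecPd_spatial_zero : vecPd 0 spatial p = 0 :=
  funext fun j => (pd_coord 0 j.succ).trans (Pi.single_eq_of_ne j.succ_ne_zero 1)

theorem vecPd_spatial_succ (i : Fin 3) : vecPd i.succ spatial p = Pi.single i 1 := by
  funext j
  refine (pd_coord i.succ j.succ).trans ?_
  simp [Pi.single_apply]

theorem div3_eq (V : Spacetime → Fin 3 → ℝ) (p : Spacetime) :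
    div3 V p = ∑ i : Fin 3, vecPd i.succ V p i := rfl

theorem div3_add (hV : DifferentiableAt ℝ V p) (hW : DifferentiableAt ℝ W p) :
    div3 (fun y => V y + W y) p = div3 V p + div3 W p := by
  simp only [div3_eq, vecPd_add hV hW, Pi.add_apply, Finset.sum_add_distrib]

theorem div3_const_smul (c : ℝ) (hV : DifferentiableAt ℝ V p) :
    div3 (fun y => c • V y) p = c * div3 V p := by
  simp only [div3_eq, vecPd_const_smul c hV, Pi.smul_apply, smul_eq_mul, Finset.mul_sum]

theorem vecPd_radial_smul {φ : ℝ → ℝ} {φ' : ℝ} (hr : 0 < rad p) (hφ : HasDerivAt φ φ' (rad p))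
    (hV : DifferentiableAt ℝ V p) (i : Fin 3) :
    vecPd i.succ (fun y => φ (rad y) • V y) p =
      (φ' * radialUnit p i) • V p + φ (rad p) • vecPd i.succ V p := by
  rw [vecPd_smul (differentiableAt_comp_rad hr hφ) hV, pd_comp_rad hr hφ, pd_rad hr, dr_succ]

theorem div3_radial_smul {φ : ℝ → ℝ} {φ' : ℝ} (hr : 0 < rad p) (hφ : HasDerivAt φ φ' (rad p))
    (hV : DifferentiableAt ℝ V p) :
    div3 (fun y => φ (rad y) • V y) p = φ' * (radialUnit p ⬝ᵥ V p) + φ (rad p) * div3 V p := by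
  simp only [div3_eq, vecPd_radial_smul hr hφ hV, Pi.add_apply, Pi.smul_apply, smul_eq_mul,
    Finset.sum_add_distrib, mul_assoc, ← Finset.mul_sum]
  rfl

theorem dot_curl3_radial_smul {φ : ℝ → ℝ} {φ' : ℝ} (hr : 0 < rad p)
    (hφ : HasDerivAt φ φ' (rad p)) (hV : DifferentiableAt ℝ V p) :
    radialUnit p ⬝ᵥ curl3 (fun y => φ (rad y) • V y) p
      = φ (rad p) * (radialUnit p ⬝ᵥ curl3 V p) := by
  simp only [curl3, jac, Matrix.of_apply, vecPd_radial_smul hr hφ hV, Matrix.vec3_dotProduct,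
    Pi.add_apply, Pi.smul_apply, smul_eq_mul, Matrix.cons_val]
  ring

theorem jac_spatial_cross (hV : DifferentiableAt ℝ V p) (i : Fin 3) :
    jac (fun y => spatial y ⨯₃ V y) p i = Pi.single i 1 ⨯₃ V p + spatial p ⨯₃ jac V p i := by
  refine (vecPd_cross differentiableAt_spatial hV i.succ).trans ?_
  rw [vecPd_spatial_succ]
  rfl

theorem div3_spatial_cross (hV : DifferentiableAt ℝ V p) :
    div3 (fun y => spatial y ⨯₃ V y) p = -(spatial p ⬝ᵥ curl3 V p) := by
  simp only [div3, Matrix.trace_fin_three, curl3, Matrix.vec3_dotProduct, jac_spatial_cross hV]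
  simp [cross_apply]
  ring

theorem div3_radialUnit_cross (hr : 0 < rad p) (hV : DifferentiableAt ℝ V p) :
    div3 (fun y => radialUnit y ⨯₃ V y) p = -(radialUnit p ⬝ᵥ curl3 V p) := by
  have hsmul : (fun y => radialUnit y ⨯₃ V y) = fun y => (rad y)⁻¹ • (spatial y ⨯₃ V y) := by
    funext y
    rw [radialUnit, map_smul, LinearMap.smul_apply]
  rw [hsmul, div3_radial_smul hr (hasDerivAt_inv hr.ne')
      (differentiableAt_cross differentiableAt_spatial hV),
    div3_spatial_cross hV, radialUnit, smul_dotProduct, smul_dotProduct, dot_self_cross]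
  simp only [smul_eq_mul]
  ring

theorem spatial_dot_vecPd_of_tangential (hV : DifferentiableAt ℝ V p)
    (ht : ∀ᶠ y in 𝓝 p, spatial y ⬝ᵥ V y = 0) :
    spatial p ⬝ᵥ vecPd 0 V p = 0 ∧ ∀ i : Fin 3, spatial p ⬝ᵥ vecPd i.succ V p = -V p i := by
  have hdot : ∀ a, vecPd a spatial p ⬝ᵥ V p + spatial p ⬝ᵥ vecPd a V p = 0 := fun a => by
    rw [← pd_dotProduct differentiableAt_spatial hV, pd_congr ht, pd_const]
  refine ⟨by simpa [vecPd_spatial_zero] using hdot 0, fun i => ?_⟩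
  have hi := hdot i.succ
  rw [vecPd_spatial_succ, single_one_dotProduct] at hi
  linarith

theorem spatial_dot_curl3_spatial_cross (hV : DifferentiableAt ℝ V p)
    (ht : ∀ᶠ y in 𝓝 p, spatial y ⬝ᵥ V y = 0) :
    spatial p ⬝ᵥ curl3 (fun y => spatial y ⨯₃ V y) p = rad p ^ 2 * div3 V p := by
  have hV0 := ht.self_of_nhds
  have hdot : ∀ i, spatial p ⬝ᵥ jac V p i = -V p i := (spatial_dot_vecPd_of_tangential hV ht).2
  have hx := rad_sq p
  simp only [Matrix.vec3_dotProduct] at hV0 hdot hx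
  simp only [div3, Matrix.trace_fin_three, curl3, Matrix.vec3_dotProduct, jac_spatial_cross hV, hx]
  simp [cross_apply]
  linear_combination -hV0 - spatial p 0 * hdot 0 - spatial p 1 * hdot 1 - spatial p 2 * hdot 2

end VectorCalculus

/-- The null vector `∂_t + σ (1 - 2M/r) ∂_r`, outgoing for `σ = 1` and ingoing for `σ = -1`. -/
def nullVec (M σ : ℝ) (p : Spacetime) : Spacetime :=
  Fin.cons 1 ((σ * lapseSq M (rad p)) • radialUnit p)

section Divergence

variable {M σ : ℝ} {p : Spacetime}

theorem nullVec_zero (M σ : ℝ) (p : Spacetime) : nullVec M σ p 0 = 1 := rfl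

theorem spatial_nullVec (M σ : ℝ) (p : Spacetime) :
    spatial (nullVec M σ p) = (σ * lapseSq M (rad p)) • radialUnit p := rfl

theorem trace_sphericalForm (hr : 0 < rad p) (α β γ : ℝ) :
    (sphericalForm p α β γ).trace = α + β + 2 * γ := by
  have hn := radialUnit_dot_self hr
  rw [Matrix.vec3_dotProduct] at hn
  rw [Matrix.trace, Fin.sum_univ_succ, Fin.sum_univ_three]
  simp only [Matrix.diag_apply, sphericalForm, Matrix.of_apply, dt_zero, dr_zero, dt_succ,
    dr_succ, flat_zero_left, flat_succ, Matrix.one_apply_eq]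
  linear_combination (β - γ) * hn

theorem sum_sphericalForm_mul_matrix (α β γ : ℝ) (G : Fin 4 → Spacetime) :
    ∑ b, ∑ c, sphericalForm p α β γ b c * G c b = α * G 0 0 + γ * ∑ i : Fin 3, G i.succ i.succ
      + (β - γ) * ∑ i, radialUnit p i * (radialUnit p ⬝ᵥ spatial (G i.succ)) := by
  simp only [Fin.sum_univ_succ (n := 3), sphericalForm, Matrix.of_apply, dt_zero, dr_zero, dt_succ,
    dr_succ, flat_zero_left, flat_zero_right, flat_succ, Fin.sum_univ_three, Matrix.one_apply,
    Matrix.vec3_dotProduct, spatial, Fin.tail]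
  simp
  ring

theorem sum_invMetric_mul_of_tangential (hM : 0 ≤ M) (hp : p ∈ exterior M) {u : Spacetime}
    (hu : u 0 = 0) (hn : radialUnit p ⬝ᵥ spatial u = 0) (c : Fin 4) :
    ∑ b, invMetric M p b c * u b = -u c := by
  simp only [invMetric_eq hM hp, sphericalForm_comm _ _ _ _ c, sum_sphericalForm_mul, hu, hn]
  ring

theorem sum_invMetric_mul_christoffel (hM : 0 ≤ M) (hp : p ∈ exterior M) (d : Fin 4) :
    ∑ b, ∑ c, invMetric M p b c * christoffel M p d c b
      = -((1 - lapseSq M (rad p)) / rad p) * dr p d := by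
  have hr := rad_pos hM hp
  have hf := (lapseSq_pos hM hp).ne'
  set f := lapseSq M (rad p)
  have hsplit : ∀ b c, invMetric M p b c * christoffel M p d c b
      = M / rad p ^ 2 * f⁻¹ * dt d * (dt b * (invMetric M p b c * dr p c)
          + dr p b * (invMetric M p b c * dt c))
        + dr p d * (invMetric M p b c *
          sphericalForm p (M / rad p ^ 2 * f) (-(M / rad p ^ 2) * f⁻¹) ((1 - f) / rad p) c b) := by
    intro b c
    rw [christoffel_eq hM hp, sphericalForm, Matrix.of_apply]
    ring
  have htrace := trace_sphericalForm hr (f⁻¹ * (M / rad p ^ 2 * f))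
    (-f * (-(M / rad p ^ 2) * f⁻¹)) (-1 * ((1 - f) / rad p))
  rw [← sphericalForm_mul hr, ← invMetric_eq hM hp] at htrace
  simp only [Matrix.trace, Matrix.diag_apply, Matrix.mul_apply] at htrace
  have hdt : ∀ b, ∑ c, invMetric M p b c * dt c = f⁻¹ * dt b := fun b => by
    rw [invMetric_eq hM hp, sum_sphericalForm_mul_dt]
  have hdr : ∀ b, ∑ c, invMetric M p b c * dr p c = -f * dr p b := fun b => by
    rw [invMetric_eq hM hp, sum_sphericalForm_mul_dr hr]
  have horth : ∑ b, dt b * dr p b = 0 := (sum_dt_mul _).trans (dr_zero p)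
  simp only [hsplit, Finset.sum_add_distrib, ← Finset.mul_sum, htrace, hdt, hdr]
  simp only [mul_left_comm (dt _), mul_left_comm (dr p _) f⁻¹, mul_comm (dr p _) (dt _),
    ← Finset.mul_sum, horth]
  have hmass : 1 - f = 2 * M / rad p := sub_sub_cancel 1 _
  rw [hmass]
  field_simp
  ring

theorem sum_invMetric_mul_sum_christoffel_mul (hM : 0 ≤ M) (hp : p ∈ exterior M) (v : Spacetime) :
    ∑ b, ∑ c, invMetric M p b c * ∑ d, christoffel M p d c b * v d
      = -((1 - lapseSq M (rad p)) / rad p) * (radialUnit p ⬝ᵥ spatial v) := by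
  calc ∑ b, ∑ c, invMetric M p b c * ∑ d, christoffel M p d c b * v d
      = ∑ b, ∑ d, ∑ c, v d * (invMetric M p b c * christoffel M p d c b) := by
        refine Finset.sum_congr rfl fun b _ => Eq.trans ?_ Finset.sum_comm
        simp only [Finset.mul_sum, mul_comm (v _), mul_assoc]
    _ = ∑ d, -((1 - lapseSq M (rad p)) / rad p) * (dr p d * v d) := by
        rw [Finset.sum_comm]
        simp only [← Finset.mul_sum, sum_invMetric_mul_christoffel hM hp]
        simp only [mul_left_comm (v _), mul_comm (v _), ← Finset.mul_sum]
    _ = _ := by rw [← Finset.mul_sum, sum_dr_mul]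

theorem sum_invMetric_mul_sum_christoffel_mul_of_tangential (hM : 0 ≤ M) (hp : p ∈ exterior M)
    {T : Matrix (Fin 4) (Fin 4) ℝ} {w : Spacetime} (hu : T 0 0 = 0)
    (hnu : radialUnit p ⬝ᵥ spatial (T 0) = 0) (hTw : ∀ b, ∑ d, dr p d * T d b = w b)
    (hw : w 0 = 0) (hnw : radialUnit p ⬝ᵥ spatial w = 0) (a : Fin 4) :
    ∑ b, ∑ c, invMetric M p b c * ∑ d, christoffel M p d c a * T d b
      = -((1 - lapseSq M (rad p)) / rad p * w a) := by
  have hexpand : ∀ b c, ∑ d, christoffel M p d c a * T d b =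
      M / rad p ^ 2 * (lapseSq M (rad p))⁻¹ * (dr p c * dt a + dr p a * dt c) * T 0 b
      + (M / rad p ^ 2 * (lapseSq M (rad p) * (dt c * dt a)
          - (lapseSq M (rad p))⁻¹ * (dr p c * dr p a))
        + (1 - lapseSq M (rad p)) / rad p * (flat c a - dr p c * dr p a)) * w b := by
    intro b c
    simp only [christoffel_eq hM hp, add_mul _ _ (T _ b), Finset.sum_add_distrib,
      mul_assoc _ (dt _) (T _ b), mul_assoc _ (dr p _) (T _ b), ← Finset.mul_sum, hTw]
    rw [sum_dt_mul fun d => T d b]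
  have hcontract : ∀ (x y : ℝ) c, ∑ b, invMetric M p b c * (x * T 0 b + y * w b)
      = -(x * T 0 c + y * w c) := fun x y c => by
    simp only [mul_add, mul_left_comm _ x, mul_left_comm _ y, Finset.sum_add_distrib,
      ← Finset.mul_sum, sum_invMetric_mul_of_tangential hM hp hu hnu,
      sum_invMetric_mul_of_tangential hM hp hw hnw]
    ring
  have hsplit : ∀ c, -(M / rad p ^ 2 * (lapseSq M (rad p))⁻¹
        * (dr p c * dt a + dr p a * dt c) * T 0 c
      + (M / rad p ^ 2 * (lapseSq M (rad p) * (dt c * dt a)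
          - (lapseSq M (rad p))⁻¹ * (dr p c * dr p a))
        + (1 - lapseSq M (rad p)) / rad p * (flat c a - dr p c * dr p a)) * w c)
      = -(M / rad p ^ 2 * (lapseSq M (rad p))⁻¹ * dt a) * (dr p c * T 0 c)
        + -(M / rad p ^ 2 * (lapseSq M (rad p))⁻¹ * dr p a) * (dt c * T 0 c)
        + -(M / rad p ^ 2 * lapseSq M (rad p) * dt a) * (dt c * w c)
        + (M / rad p ^ 2 * (lapseSq M (rad p))⁻¹ + (1 - lapseSq M (rad p)) / rad p) * dr p a
          * (dr p c * w c)
        + -((1 - lapseSq M (rad p)) / rad p) * (flat a c * w c) := fun c => by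
    rw [flat_comm c a]
    ring
  rw [Finset.sum_comm]
  simp only [hexpand, hcontract, hsplit]
  simp only [Finset.sum_add_distrib, ← Finset.mul_sum, sum_dr_mul, sum_dt_mul, sum_flat_mul, hu, hw,
    hnu, hnw]
  ring

theorem divSecond_eq_of_tangentialForm (hM : 0 ≤ M) (hp : p ∈ exterior M) {T : Tensor2}
    {P R : Fin 3 → ℝ} (hP : radialUnit p ⬝ᵥ P = 0) (hT : T p = tangentialForm M p P R)
    (a : Fin 4) :
    divSecond M T p a = ∑ b, ∑ c, invMetric M p b c * pd c (fun y => T y a b) p := by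
  have hskew : ∀ a b, T p a b = -T p b a := fun a b => by
    rw [hT, tangentialForm, twoForm_apply_comm]
  set w : Spacetime := -(T p *ᵥ dr p) with hwdef
  have hTw : ∀ b, ∑ d, dr p d * T p d b = w b := fun b => by
    simp only [hskew _ b, mul_neg, Finset.sum_neg_distrib]
    simp only [hwdef, Pi.neg_apply, Matrix.mulVec, dotProduct, mul_comm]
  have hTw' : radialUnit p ⬝ᵥ spatial (T p a) = -w a := by
    rw [← sum_dr_mul, hwdef, Pi.neg_apply, neg_neg]
    simp only [Matrix.mulVec, dotProduct, mul_comm]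
  have hnu : radialUnit p ⬝ᵥ spatial (T p 0) = 0 := by
    rwa [hT, show spatial (tangentialForm M p P R 0) = P by ext i; fin_cases i <;> rfl]
  have hw : w 0 = 0 := by
    rw [hwdef, Pi.neg_apply, hT, tangentialForm, twoForm_mulVec_zero, spatial_dr,
      dotProduct_comm P, hP, neg_zero]
  have hnw : radialUnit p ⬝ᵥ spatial w = 0 := by
    have hneg : spatial w = -spatial (T p *ᵥ dr p) := rfl
    rw [hneg, hT, tangentialForm, spatial_twoForm_mulVec, dr_zero, spatial_dr, zero_smul, sub_zero,
      dotProduct_neg, dot_self_cross, neg_zero]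
  simp only [divSecond, cov, mul_sub, Finset.sum_sub_distrib]
  rw [sum_invMetric_mul_sum_christoffel_mul hM hp,
    sum_invMetric_mul_sum_christoffel_mul_of_tangential hM hp (self_eq_neg.1 (hskew 0 0))
      hnu hTw hw hnw, hTw']
  ring

theorem pd_twoForm (P Q : Spacetime → Fin 3 → ℝ) (c a b : Fin 4) :
    pd c (fun y => twoForm (P y) (Q y) a b) p = twoForm (vecPd c P p) (vecPd c Q p) a b := by
  fin_cases a <;> fin_cases b <;>
    first
    | exact pd_const 0 c
    | rfl
    | exact pd_neg c

theorem sum_cross_jac (v : Fin 3 → ℝ) (V : Spacetime → Fin 3 → ℝ) (p : Spacetime) :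
    ∑ i, (v ⨯₃ jac V p i) i = -(v ⬝ᵥ curl3 V p) := by
  rw [Matrix.vec3_dotProduct, Fin.sum_univ_three]
  simp [cross_apply, curl3]
  ring

theorem nullVec_dot_div_twoForm (hM : 0 ≤ M) (hp : p ∈ exterior M)
    {P Q : Spacetime → Fin 3 → ℝ} (hPt : radialUnit p ⬝ᵥ vecPd 0 P p = 0)
    (hPn : ∑ i, radialUnit p i * (radialUnit p ⬝ᵥ jac P p i) = 0) :
    ∑ a, nullVec M σ p a * ∑ b, ∑ c, invMetric M p b c * twoForm (vecPd c P p) (vecPd c Q p) a b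
      = -div3 P p - σ * lapseSq M (rad p) * (radialUnit p ⬝ᵥ curl3 Q p) := by
  set K := fun c => twoForm (vecPd c P p) (vecPd c Q p) with hK
  have hcontract : ∀ b c, ∑ a, nullVec M σ p a * K c a b = -(K c *ᵥ nullVec M σ p) b := by
    intro b c
    simp only [hK, twoForm_apply_comm _ _ _ b, mul_neg, Finset.sum_neg_distrib]
    simp only [Matrix.mulVec, dotProduct, mul_comm]
  have hswap : ∑ a, nullVec M σ p a * ∑ b, ∑ c, invMetric M p b c * K c a b
      = ∑ b, ∑ c, invMetric M p b c * -(K c *ᵥ nullVec M σ p) b := by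
    simp only [← hcontract, Finset.mul_sum, mul_left_comm _ (invMetric M p _ _)]
    rw [Finset.sum_comm]
    exact Finset.sum_congr rfl fun b _ => Finset.sum_comm
  have hspatial : ∀ i : Fin 3, spatial (K i.succ *ᵥ nullVec M σ p)
      = (σ * lapseSq M (rad p)) • (radialUnit p ⨯₃ jac Q p i) - jac P p i := fun i => by
    rw [hK, spatial_twoForm_mulVec, spatial_nullVec, nullVec_zero, one_smul, map_smul,
      LinearMap.smul_apply]
    rfl
  have htime : (K 0 *ᵥ nullVec M σ p) 0 = 0 := by
    rw [hK, twoForm_mulVec_zero, spatial_nullVec, dotProduct_smul, dotProduct_comm, hPt, smul_zero]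
  have hradial : ∀ i : Fin 3, radialUnit p ⬝ᵥ spatial (K i.succ *ᵥ nullVec M σ p)
      = -(radialUnit p ⬝ᵥ jac P p i) := fun i => by
    rw [hspatial, dotProduct_sub, dotProduct_smul, dot_self_cross, smul_zero, zero_sub]
  have htrace : ∑ i : Fin 3, (K i.succ *ᵥ nullVec M σ p) i.succ
      = -(σ * lapseSq M (rad p)) * (radialUnit p ⬝ᵥ curl3 Q p) - div3 P p := by
    have hi : ∀ i : Fin 3, (K i.succ *ᵥ nullVec M σ p) i.succ
        = σ * lapseSq M (rad p) * (radialUnit p ⨯₃ jac Q p i) i - jac P p i i :=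
      fun i => congrFun (hspatial i) i
    simp only [hi, Finset.sum_sub_distrib, ← Finset.mul_sum, sum_cross_jac, mul_neg, neg_mul]
    rfl
  have hG := sum_sphericalForm_mul_matrix (p := p) (lapseSq M (rad p))⁻¹ (-lapseSq M (rad p)) (-1)
    fun c => K c *ᵥ nullVec M σ p
  simp only [← invMetric_eq hM hp, htime, hradial, htrace, mul_neg,
    Finset.sum_neg_distrib, hPn] at hG
  refine hswap.trans ?_
  simp only [mul_neg, Finset.sum_neg_distrib, hG]
  ring

theorem nullVec_dot_divSecond (hM : 0 ≤ M) (hp : p ∈ exterior M) {T : Tensor2}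
    {P R : Spacetime → Fin 3 → ℝ} (hP : DifferentiableAt ℝ P p) (hR : DifferentiableAt ℝ R p)
    (hPt : ∀ᶠ y in 𝓝 p, spatial y ⬝ᵥ P y = 0) (hRt : ∀ᶠ y in 𝓝 p, spatial y ⬝ᵥ R y = 0)
    (hT : ∀ᶠ y in 𝓝 p, T y = tangentialForm M y (P y) (R y)) :
    ∑ a, nullVec M σ p a * divSecond M T p a = -div3 (fun y => P y + σ • R y) p := by
  have hr := rad_pos hM hp
  set Q : Spacetime → Fin 3 → ℝ := fun y => (rad y - 2 * M)⁻¹ • (spatial y ⨯₃ R y) with hQ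
  have hTQ : ∀ᶠ y in 𝓝 p, T y = twoForm (P y) (Q y) := by
    filter_upwards [hT, exterior_mem_nhds hp] with y hTy hy
    have hy0 := rad_pos hM hy
    rw [hTy, tangentialForm, hQ, radialUnit, map_smul, LinearMap.smul_apply, smul_smul, ← mul_inv,
      lapseSq_mul_rad hy0]
  have hcurl : lapseSq M (rad p) * (radialUnit p ⬝ᵥ curl3 Q p) = div3 R p := by
    have hinv : HasDerivAt (fun s => (s - 2 * M)⁻¹) _ (rad p) :=
      ((hasDerivAt_id (rad p)).sub_const (2 * M)).inv (sub_pos.2 hp).ne'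
    rw [hQ, dot_curl3_radial_smul hr hinv (differentiableAt_cross differentiableAt_spatial hR),
      radialUnit, smul_dotProduct, spatial_dot_curl3_spatial_cross hR hRt, ← lapseSq_mul_rad hr,
      smul_eq_mul]
    have := (lapseSq_pos hM hp).ne'
    field_simp
  obtain ⟨htime, hspace⟩ := spatial_dot_vecPd_of_tangential hP hPt
  have hnP : radialUnit p ⬝ᵥ P p = 0 := by
    rw [radialUnit, smul_dotProduct, hPt.self_of_nhds, smul_zero]
  simp only [divSecond_eq_of_tangentialForm hM hp hnP hT.self_of_nhds]
  have hpd : ∀ a b c, pd c (fun y => T y a b) p = twoForm (vecPd c P p) (vecPd c Q p) a b :=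
    fun a b c => (pd_congr (hTQ.mono fun y hy => congrFun₂ hy a b) c).trans (pd_twoForm P Q c a b)
  simp only [hpd]
  rw [nullVec_dot_div_twoForm hM hp, mul_assoc, hcurl, div3_add hP (hR.fun_const_smul σ),
    div3_const_smul σ hR]
  · ring
  · rw [radialUnit, smul_dotProduct, htime, smul_zero]
  · have hrow : ∀ i, radialUnit p ⬝ᵥ jac P p i = -(rad p)⁻¹ * P p i := fun i => by
      change ((rad p)⁻¹ • spatial p) ⬝ᵥ vecPd i.succ P p = _
      rw [smul_dotProduct, hspace, smul_eq_mul]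
      ring
    simp only [hrow, mul_left_comm _ (-(rad p)⁻¹), ← Finset.mul_sum]
    exact mul_eq_zero_of_right _ hnP

end Divergence

/-- Half the contraction of `Z` with the null vector `∂_t + σ (1 - 2M/r) ∂_r`, a vector field
tangential to the spheres. -/
def nullField (M : ℝ) (o : ℤˣ) (F : Tensor2) (σ : ℝ) (p : Spacetime) : Fin 3 → ℝ :=
  (1 / 2 : ℝ) • (fieldS M o F p + σ • fieldD o F p)

/-- The real part of the covector `β`. -/
def betaRe (M : ℝ) (o : ℤˣ) (F : Tensor2) (p : Spacetime) : Spacetime :=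
  fun a => (beta M o F p a).re

/-- The imaginary part of the covector `β`. -/
def betaIm (M : ℝ) (o : ℤˣ) (F : Tensor2) (p : Spacetime) : Spacetime :=
  fun a => (beta M o F p a).im

section NullComponents

variable {M σ : ℝ} {p : Spacetime} {o : ℤˣ} {F : Tensor2}

theorem spatial_dot_fieldS (M : ℝ) (o : ℤˣ) (F : Tensor2) (p : Spacetime) :
    spatial p ⬝ᵥ fieldS M o F p = 0 := by
  rw [fieldS, dotProduct_smul, dot_self_cross, smul_zero]

theorem spatial_dot_fieldD (o : ℤˣ) (F : Tensor2) (p : Spacetime) :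
    spatial p ⬝ᵥ fieldD o F p = 0 := by
  rw [fieldD, dotProduct_smul, dot_self_cross, smul_zero]

theorem spatial_dot_nullField (M : ℝ) (o : ℤˣ) (F : Tensor2) (σ : ℝ) (p : Spacetime) :
    spatial p ⬝ᵥ nullField M o F σ p = 0 := by
  rw [nullField, dotProduct_smul, dotProduct_add, dotProduct_smul, spatial_dot_fieldS,
    spatial_dot_fieldD, smul_zero, add_zero, smul_zero]

theorem radialUnit_dot_eq_zero {V : Fin 3 → ℝ} (hV : spatial p ⬝ᵥ V = 0) :
    radialUnit p ⬝ᵥ V = 0 := by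
  rw [radialUnit, smul_dotProduct, hV, smul_zero]

theorem contDiffAt_spatial {n : WithTop ℕ∞} : ContDiffAt ℝ n spatial p :=
  contDiffAt_pi.2 fun i => contDiffAt_apply ℝ ℝ i.succ p

theorem contDiffAt_radialUnit (hr : 0 < rad p) {n : WithTop ℕ∞} : ContDiffAt ℝ n radialUnit p :=
  ((contDiffAt_rad hr).inv hr.ne').smul contDiffAt_spatial

theorem contDiffAt_fieldS (hr : 0 < rad p) {n : WithTop ℕ∞} (hF : ContDiffAt ℝ n F p) :
    ContDiffAt ℝ n (fieldS M o F) p := by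
  have hcomp : ∀ a b, ContDiffAt ℝ n (fun y => F y a b) p :=
    fun a b => contDiffAt_pi.1 (contDiffAt_pi.1 hF a) b
  have hmag : ContDiffAt ℝ n (fun y => magPart (F y)) p :=
    contDiffAt_pi.2 fun i => by fin_cases i <;> exact hcomp _ _
  have hlapse : ContDiffAt ℝ n (fun y => lapseSq M (rad y)) p :=
    contDiffAt_const.sub (contDiffAt_const.div (contDiffAt_rad hr) hr.ne')
  exact (contDiffAt_const.mul hlapse).smul (contDiffAt_cross contDiffAt_spatial hmag)

theorem contDiffAt_fieldD (hr : 0 < rad p) {n : WithTop ℕ∞} (hF : ContDiffAt ℝ n F p) :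
    ContDiffAt ℝ n (fieldD o F) p := by
  have helec : ContDiffAt ℝ n (fun y => elecPart (F y)) p :=
    contDiffAt_pi.2 fun i => contDiffAt_pi.1 (contDiffAt_pi.1 hF 0) i.succ
  exact (contDiffAt_cross contDiffAt_spatial
    (contDiffAt_cross (contDiffAt_radialUnit hr) helec)).const_smul (2 / 3 * ((o : ℤ) : ℝ))

theorem contDiffAt_nullField (hr : 0 < rad p) {n : WithTop ℕ∞} (hF : ContDiffAt ℝ n F p) :
    ContDiffAt ℝ n (nullField M o F σ) p :=
  ((contDiffAt_fieldS hr hF).add ((contDiffAt_fieldD hr hF).const_smul σ)).const_smul (1 / 2 : ℝ)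

theorem nullVec_dot_contractU (hM : 0 ≤ M) (hp : p ∈ exterior M) {T : Tensor2} {P R : Fin 3 → ℝ}
    (hP : radialUnit p ⬝ᵥ P = 0) (hT : T p = tangentialForm M p P R) :
    nullVec M σ p ⬝ᵥ contractU M T p = 0 := by
  have hr := rad_pos hM hp
  have hU : ∀ b, ∑ c, invMetric M p b c * covU p c
      = lapseSq M (rad p) * (rad p)⁻¹ * dr p b := fun b => by
    have hterm : ∀ c, invMetric M p b c * covU p c = -(rad p)⁻¹ * (invMetric M p b c * dr p c) :=
      fun c => by rw [covU, pd_rad hr]; ring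
    rw [Finset.sum_congr rfl fun c _ => hterm c, ← Finset.mul_sum, invMetric_eq hM hp,
      sum_sphericalForm_mul_dr hr]
    ring
  have hcontract : contractU M T p = (lapseSq M (rad p) * (rad p)⁻¹) • (T p *ᵥ dr p) := by
    funext a
    simp only [contractU, ← Finset.sum_mul, hU, Pi.smul_apply, smul_eq_mul, Matrix.mulVec,
      dotProduct, Finset.mul_sum]
    exact Finset.sum_congr rfl fun b _ => by ring
  rw [hcontract, dotProduct_smul, dotProduct, sum_mul_eq, nullVec_zero, spatial_nullVec, hT,
    tangentialForm, twoForm_mulVec_zero, spatial_twoForm_mulVec, spatial_dr, dr_zero, zero_smul,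
    sub_zero, smul_dotProduct, dot_self_cross, dotProduct_comm P, hP]
  simp

theorem betaRe_eq (M : ℝ) (o : ℤˣ) (F : Tensor2) (p : Spacetime) :
    betaRe M o F p = (-(1 / 2) : ℝ) •
      (contractU M (fieldZ M o F) p + divSecond M (fieldZ M o F) p) := by
  funext a
  simp [betaRe, beta]
  ring

theorem betaIm_eq (M : ℝ) (o : ℤˣ) (F : Tensor2) (p : Spacetime) :
    betaIm M o F p = (-(1 / 2) : ℝ) • (contractU M (hodge M o (fieldZ M o F)) p
      + divSecond M (hodge M o (fieldZ M o F)) p) := by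
  funext a
  simp [betaIm, beta]
  ring

theorem hodge_fieldZ_eq (hM : 0 ≤ M) (hp : p ∈ exterior M) (hF : ∀ a b, F p a b = -F p b a) :
    hodge M o (fieldZ M o F) p = tangentialForm M p
      (((o : ℤ) : ℝ) • (radialUnit p ⨯₃ fieldD o F p))
      (((o : ℤ) : ℝ) • (radialUnit p ⨯₃ fieldS M o F p)) :=
  hodge_eq_of_tangentialForm hM hp o (radialUnit_dot_eq_zero (spatial_dot_fieldS M o F p))
    (fieldZ_eq hM hp hF)

theorem radialUnit_cross_nullField (hσ : σ * σ = 1) (p : Spacetime) :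
    ((o : ℤ) : ℝ) • (radialUnit p ⨯₃ fieldD o F p)
        + σ • ((o : ℤ) : ℝ) • (radialUnit p ⨯₃ fieldS M o F p)
      = (2 * (σ * ((o : ℤ) : ℝ))) • (radialUnit p ⨯₃ nullField M o F σ p) := by
  have hscale : 2 * (σ * ((o : ℤ) : ℝ)) * (1 / 2 * σ) = (o : ℤ) := by
    linear_combination ((o : ℤ) : ℝ) * hσ
  simp only [nullField, map_smul, map_add, smul_add, smul_smul]
  rw [hscale]
  module

theorem nullVec_dot_betaRe (hM : 0 ≤ M) (hp : p ∈ exterior M) (hsmooth : ContDiffAt ℝ 1 F p)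
    (hF : ∀ y ∈ exterior M, ∀ a b, F y a b = -F y b a) :
    nullVec M σ p ⬝ᵥ betaRe M o F p = div3 (nullField M o F σ) p := by
  have hr := rad_pos hM hp
  have hS := (contDiffAt_fieldS (M := M) (o := o) hr hsmooth).differentiableAt one_ne_zero
  have hD := (contDiffAt_fieldD (o := o) hr hsmooth).differentiableAt one_ne_zero
  have hdiv := nullVec_dot_divSecond (σ := σ) hM hp hS hD
    (.of_forall (spatial_dot_fieldS M o F)) (.of_forall (spatial_dot_fieldD o F))
    (by filter_upwards [exterior_mem_nhds hp] with y hy using fieldZ_eq hM hy (hF y hy))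
  rw [betaRe_eq, dotProduct_smul, dotProduct_add, nullVec_dot_contractU hM hp
    (radialUnit_dot_eq_zero (spatial_dot_fieldS M o F p)) (fieldZ_eq hM hp (hF p hp)), zero_add]
  refine (congrArg _ hdiv).trans ?_
  refine Eq.trans ?_ (div3_const_smul (1 / 2) (hS.add (hD.const_smul σ))).symm
  rw [smul_eq_mul, neg_mul_neg]
  rfl

theorem nullVec_dot_betaIm (hM : 0 ≤ M) (hp : p ∈ exterior M) (hsmooth : ContDiffAt ℝ 1 F p)
    (hF : ∀ y ∈ exterior M, ∀ a b, F y a b = -F y b a) (hσ : σ * σ = 1) :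
    nullVec M σ p ⬝ᵥ betaIm M o F p
      = -(σ * ((o : ℤ) : ℝ)) * (radialUnit p ⬝ᵥ curl3 (nullField M o F σ) p) := by
  have hr := rad_pos hM hp
  have hn := (contDiffAt_radialUnit (n := 1) hr).differentiableAt one_ne_zero
  have hS := (contDiffAt_fieldS (M := M) (o := o) hr hsmooth).differentiableAt one_ne_zero
  have hD := (contDiffAt_fieldD (o := o) hr hsmooth).differentiableAt one_ne_zero
  have hX := (contDiffAt_nullField (M := M) (o := o) (σ := σ) hr hsmooth).differentiableAt
    one_ne_zero
  have htangential : ∀ (V : Spacetime → Fin 3 → ℝ) y,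
      spatial y ⬝ᵥ (((o : ℤ) : ℝ) • (radialUnit y ⨯₃ V y)) = 0 := fun V y => by
    rw [radialUnit, map_smul, LinearMap.smul_apply, dotProduct_smul, dotProduct_smul,
      dot_self_cross, smul_zero, smul_zero]
  have hdiv := nullVec_dot_divSecond (σ := σ) hM hp
    ((differentiableAt_cross hn hD).const_smul ((o : ℤ) : ℝ))
    ((differentiableAt_cross hn hS).const_smul ((o : ℤ) : ℝ))
    (.of_forall (htangential _)) (.of_forall (htangential _))
    (by filter_upwards [exterior_mem_nhds hp] with y hy using hodge_fieldZ_eq hM hy (hF y hy))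
  have hrotated : (fun y => ((o : ℤ) : ℝ) • (radialUnit y ⨯₃ fieldD o F y)
      + σ • ((o : ℤ) : ℝ) • (radialUnit y ⨯₃ fieldS M o F y))
      = fun y => (2 * (σ * ((o : ℤ) : ℝ))) • (radialUnit y ⨯₃ nullField M o F σ y) :=
    funext fun y => radialUnit_cross_nullField hσ y
  rw [betaIm_eq, dotProduct_smul, dotProduct_add, nullVec_dot_contractU hM hp
    (radialUnit_dot_eq_zero (htangential _ p)) (hodge_fieldZ_eq hM hp (hF p hp)), zero_add]
  refine (congrArg _ hdiv).trans ?_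
  simp only [Pi.smul_apply, hrotated]
  rw [div3_const_smul _ (differentiableAt_cross hn hX), div3_radialUnit_cross hr hX]
  simp only [smul_eq_mul]
  ring

end NullComponents

/-- The coefficient `m` in `A = m (1 - 2M/r) ∂_r`, as a function of `s = r`. -/
def morawetz (M s : ℝ) : ℝ := 1 / 2 * (1 - 3 * M / s)

/-- The derivative `dq/dr`, as a function of `s = r`. -/
def scalarQDeriv (M s : ℝ) : ℝ :=
  -(9 * M ^ 2 * (3 * s ^ 2 - 14 * M * s + 15 * M ^ 2)) / (2 * s ^ 6)

/-- The covector `H_{ab} ξ^b + c P_a`, whose component along the normal of a slice is the energy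
density. -/
def energyCovector (M : ℝ) (o : ℤˣ) (F : Tensor2) (c : ℝ) (p : Spacetime) : Spacetime :=
  fun a => (∑ b, superH M o F p a b * xi b) + c * currentP M o F p a

section Energy

variable {M σ : ℝ} {p : Spacetime} {o : ℤˣ} {F : Tensor2}

theorem betaUp_re (a : Fin 4) :
    (betaUp M o F p a).re = (invMetric M p *ᵥ betaRe M o F p) a := by
  simp [betaUp, betaRe, Matrix.mulVec, dotProduct]

theorem betaUp_im (a : Fin 4) :
    (betaUp M o F p a).im = (invMetric M p *ᵥ betaIm M o F p) a := by
  simp [betaUp, betaIm, Matrix.mulVec, dotProduct]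

theorem superH_eq (a b : Fin 4) :
    superH M o F p a b = betaRe M o F p a * betaRe M o F p b + betaIm M o F p a * betaIm M o F p b
      - 1 / 2 * metric M p a b * ((invMetric M p *ᵥ betaRe M o F p) ⬝ᵥ betaRe M o F p
        + (invMetric M p *ᵥ betaIm M o F p) ⬝ᵥ betaIm M o F p) := by
  have hsq : (∑ c, betaUp M o F p c * star (beta M o F p c)).re
      = (invMetric M p *ᵥ betaRe M o F p) ⬝ᵥ betaRe M o F p
        + (invMetric M p *ᵥ betaIm M o F p) ⬝ᵥ betaIm M o F p := by
    rw [Complex.re_sum, dotProduct, dotProduct, ← Finset.sum_add_distrib]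
    refine Finset.sum_congr rfl fun c _ => ?_
    rw [← betaUp_re, ← betaUp_im]
    simp [betaRe, betaIm]
  have hhalf : (1 / 2 : ℂ) = ((1 / 2 : ℝ) : ℂ) := by push_cast; rfl
  rw [superH, Complex.sub_re, mul_assoc (1 / 2 : ℂ) (metric M p a b : ℂ), hhalf,
    Complex.re_ofReal_mul, Complex.re_ofReal_mul, Complex.re_ofReal_mul, hsq]
  simp [betaRe, betaIm]
  ring

theorem sum_mul_sum_superH_mul (v w : Spacetime) :
    ∑ a, v a * ∑ b, superH M o F p a b * w b
      = ((v ⬝ᵥ betaRe M o F p) * (w ⬝ᵥ betaRe M o F p)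
          - 1 / 2 * inner4 M p v w * ((invMetric M p *ᵥ betaRe M o F p) ⬝ᵥ betaRe M o F p))
        + ((v ⬝ᵥ betaIm M o F p) * (w ⬝ᵥ betaIm M o F p)
          - 1 / 2 * inner4 M p v w * ((invMetric M p *ᵥ betaIm M o F p) ⬝ᵥ betaIm M o F p)) := by
  simp only [superH_eq]
  generalize (invMetric M p *ᵥ betaRe M o F p) ⬝ᵥ betaRe M o F p = U
  generalize (invMetric M p *ᵥ betaIm M o F p) ⬝ᵥ betaIm M o F p = V
  simp only [inner4, dotProduct, Finset.sum_mul_sum]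
  simp only [Finset.mul_sum, Finset.sum_mul, ← Finset.sum_sub_distrib, ← Finset.sum_add_distrib]
  exact Finset.sum_congr rfl fun a _ => Finset.sum_congr rfl fun b _ => by ring

theorem nullVec_dot (M σ : ℝ) (p w : Spacetime) :
    nullVec M σ p ⬝ᵥ w = w 0 + σ * (lapseSq M (rad p) * (radialUnit p ⬝ᵥ spatial w)) := by
  rw [dotProduct, sum_mul_eq, nullVec_zero, spatial_nullVec, smul_dotProduct, smul_eq_mul]
  ring

theorem radialUnit_cross_dot_self (hr : 0 < rad p) (v : Fin 3 → ℝ) :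
    (radialUnit p ⨯₃ v) ⬝ᵥ (radialUnit p ⨯₃ v) = v ⬝ᵥ v - (radialUnit p ⬝ᵥ v) ^ 2 := by
  rw [cross_dot_cross, radialUnit_dot_self hr, dotProduct_comm v (radialUnit p)]
  ring

theorem inner4_nullVec (hM : 0 ≤ M) (hp : p ∈ exterior M) (σ k : ℝ) :
    inner4 M p (nullVec M σ p) (nullVec M k p) = lapseSq M (rad p) * (1 - σ * k) := by
  have hf := (lapseSq_pos hM hp).ne'
  simp only [inner4_eq, nullVec_zero, spatial_nullVec, dotProduct_smul, smul_dotProduct,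
    radialUnit_dot_self (rad_pos hM hp), smul_eq_mul]
  field_simp
  ring

theorem nullVec_stress (hM : 0 ≤ M) (hp : p ∈ exterior M) (hσ : σ * σ = 1) (k : ℝ)
    (w : Spacetime) :
    (nullVec M σ p ⬝ᵥ w) * (nullVec M k p ⬝ᵥ w)
        - 1 / 2 * inner4 M p (nullVec M σ p) (nullVec M k p) * ((invMetric M p *ᵥ w) ⬝ᵥ w)
      = 1 / 2 * (1 + σ * k) * (nullVec M σ p ⬝ᵥ w) ^ 2
        + 1 / 2 * (lapseSq M (rad p) * (1 - σ * k))
          * ((radialUnit p ⨯₃ spatial w) ⬝ᵥ (radialUnit p ⨯₃ spatial w)) := by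
  have hf := (lapseSq_pos hM hp).ne'
  have hsq : (invMetric M p *ᵥ w) ⬝ᵥ w = (lapseSq M (rad p))⁻¹ * w 0 ^ 2
      - lapseSq M (rad p) * (radialUnit p ⬝ᵥ spatial w) ^ 2
      - (radialUnit p ⨯₃ spatial w) ⬝ᵥ (radialUnit p ⨯₃ spatial w) := by
    have hsum : (invMetric M p *ᵥ w) ⬝ᵥ w = ∑ a, ∑ b, invMetric M p a b * w a * w b := by
      simp only [Matrix.mulVec, dotProduct, Finset.sum_mul]
      exact Finset.sum_congr rfl fun a _ => Finset.sum_congr rfl fun b _ => by ring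
    rw [hsum, invMetric_eq hM hp, sum_sphericalForm_mul_mul,
      radialUnit_cross_dot_self (rad_pos hM hp)]
    ring
  rw [inner4_nullVec hM hp, hsq, nullVec_dot, nullVec_dot]
  field_simp
  linear_combination (-(lapseSq M (rad p)) ^ 2 * (radialUnit p ⬝ᵥ spatial w) ^ 2
    - 2 * k * lapseSq M (rad p) * w 0 * (radialUnit p ⬝ᵥ spatial w)
    - σ * k * (lapseSq M (rad p)) ^ 2 * (radialUnit p ⬝ᵥ spatial w) ^ 2) * hσ

theorem xi_add_smul_vecA (hM : 0 ≤ M) (hp : p ∈ exterior M) (c : ℝ) :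
    xi + c • vecA M p = nullVec M (c * morawetz M (rad p)) p := by
  have hr := rad_pos hM hp
  have hcoeff : (rad p - 3 * M) * (rad p - 2 * M) / (2 * rad p ^ 2)
      = morawetz M (rad p) * lapseSq M (rad p) := by
    rw [morawetz, lapseSq]
    field_simp
  funext a
  refine Fin.cases ?_ (fun i => ?_) a
  · simp [xi, vecA, nullVec]
  · simp only [Pi.add_apply, Pi.smul_apply, smul_eq_mul, vecA, hcoeff, if_neg i.succ_ne_zero,
      nullVec, Fin.cons_succ, radialUnit, spatial, Fin.tail, xi,
      Pi.single_eq_of_ne i.succ_ne_zero]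
    ring

theorem invMetric_transpose (M : ℝ) (p : Spacetime) : (invMetric M p)ᵀ = invMetric M p := by
  have hsymm : (metric M p)ᵀ = metric M p := by
    ext a b
    rw [metric_eq, Matrix.transpose_apply, sphericalForm_comm]
  rw [invMetric, Matrix.transpose_nonsing_inv, hsymm]

theorem re_sum_betaUp_mul (q : ℝ) (z w : Spacetime) :
    (∑ b, (1 / 4 * (q : ℂ) * betaUp M o F p b * (z b : ℂ)
        + 1 / 4 * (q : ℂ) * star (betaUp M o F p b) * (z b : ℂ)
        - 1 / 4 * Complex.I * (q : ℂ) * betaUp M o F p b * (w b : ℂ)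
        + 1 / 4 * Complex.I * (q : ℂ) * star (betaUp M o F p b) * (w b : ℂ))).re
      = 1 / 2 * q * (z ⬝ᵥ (invMetric M p *ᵥ betaRe M o F p)
        + w ⬝ᵥ (invMetric M p *ᵥ betaIm M o F p)) := by
  rw [dotProduct, dotProduct, ← Finset.sum_add_distrib, Finset.mul_sum, Complex.re_sum]
  refine Finset.sum_congr rfl fun b _ => ?_
  rw [← betaUp_re, ← betaUp_im]
  simp [-one_div]
  norm_num
  ring

theorem currentP_eq {Z W : Matrix (Fin 4) (Fin 4) ℝ} (hZ : fieldZ M o F p = Z)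
    (hW : hodge M o (fieldZ M o F) p = W) (a : Fin 4) :
    currentP M o F p a = (∑ b, superH M o F p a b * vecA M p b)
      + 1 / 2 * scalarQ M p * ((Z *ᵥ (invMetric M p *ᵥ betaRe M o F p)) a
        + (W *ᵥ (invMetric M p *ᵥ betaIm M o F p)) a)
      + 1 / 16 * (∑ b, ∑ c, Z b c * (invMetric M p * Z * invMetric M p) b c)
        * pd a (scalarQ M) p
      - 1 / 4 * (Z *ᵥ (invMetric M p *ᵥ
        ((invMetric M p *ᵥ fun b => pd b (scalarQ M) p) ᵥ* Z))) a := by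
  have hnorm : ∑ b, ∑ c, ∑ b', ∑ c', invMetric M p b b' * invMetric M p c c' * Z b c * Z b' c'
      = ∑ b, ∑ c, Z b c * (invMetric M p * Z * invMetric M p) b c := by
    simp only [Matrix.mul_apply, Finset.mul_sum, Finset.sum_mul]
    refine Finset.sum_congr rfl fun b _ => Finset.sum_congr rfl fun c _ => Finset.sum_comm.trans
      (Finset.sum_congr rfl fun c' _ => Finset.sum_congr rfl fun b' _ => ?_)
    rw [← congrFun₂ (invMetric_transpose M p) c c', Matrix.transpose_apply]
    ring
  have hgrad : ∑ b, ∑ c, ∑ b', ∑ c', invMetric M p c c' * Z a c' * Z b c *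
        (invMetric M p b b' * pd b' (scalarQ M) p)
      = (Z *ᵥ (invMetric M p *ᵥ ((invMetric M p *ᵥ fun b => pd b (scalarQ M) p) ᵥ* Z))) a := by
    simp only [Matrix.mulVec, Matrix.vecMul, dotProduct, Finset.mul_sum, Finset.sum_mul]
    refine Finset.sum_comm.trans (Eq.trans (Finset.sum_congr rfl fun c _ =>
      (Finset.sum_congr rfl fun b _ => Finset.sum_comm).trans Finset.sum_comm) ?_)
    refine Finset.sum_comm.trans (Finset.sum_congr rfl fun c' _ => Finset.sum_congr rfl fun c _ =>
      Finset.sum_congr rfl fun b _ => Finset.sum_congr rfl fun b' _ => ?_)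
    rw [← congrFun₂ (invMetric_transpose M p) c c', Matrix.transpose_apply]
    ring
  rw [← hnorm, ← hgrad]
  simp only [currentP, hZ, hW, re_sum_betaUp_mul]
  rfl

theorem hasDerivAt_scalarQ {s : ℝ} (hs : s ≠ 0) :
    HasDerivAt (fun s : ℝ => 9 * M ^ 2 * (s - 2 * M) * (2 * s - 3 * M) / (4 * s ^ 5))
      (scalarQDeriv M s) s := by
  have h := ((((hasDerivAt_id s).sub_const (2 * M)).const_mul (9 * M ^ 2)).mul
    (((hasDerivAt_id s).const_mul 2).sub_const (3 * M))).div
    (((hasDerivAt_id s).pow 5).const_mul 4) (by simpa using hs)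
  refine h.congr_deriv ?_
  simp [scalarQDeriv]
  field_simp
  ring

theorem pd_scalarQ (hr : 0 < rad p) (a : Fin 4) :
    pd a (scalarQ M) p = scalarQDeriv M (rad p) * dr p a :=
  (pd_comp_rad hr (hasDerivAt_scalarQ hr.ne') a).trans (congrArg _ (pd_rad hr a))

theorem vecMul_twoForm (P Q : Fin 3 → ℝ) (v : Spacetime) :
    v ᵥ* twoForm P Q = Fin.cons (-(P ⬝ᵥ spatial v)) (v 0 • P - spatial v ⨯₃ Q) := by
  rw [← Matrix.mulVec_transpose, twoForm_transpose, Matrix.neg_mulVec]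
  funext a
  refine Fin.cases ?_ (fun i => ?_) a
  · rw [Pi.neg_apply, twoForm_mulVec_zero, Fin.cons_zero]
  · rw [Fin.cons_succ, ← neg_sub, ← spatial_twoForm_mulVec]
    rfl

theorem nullVec_vecMul_tangentialForm (hM : 0 ≤ M) (hp : p ∈ exterior M) {P R : Fin 3 → ℝ}
    (hP : radialUnit p ⬝ᵥ P = 0) (hR : radialUnit p ⬝ᵥ R = 0) :
    nullVec M σ p ᵥ* tangentialForm M p P R = Fin.cons 0 (P + σ • R) := by
  have hf := (lapseSq_pos hM hp).ne'
  rw [tangentialForm, vecMul_twoForm, nullVec_zero, spatial_nullVec, dotProduct_smul,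
    dotProduct_comm P, hP]
  simp only [map_smul, LinearMap.smul_apply, radialUnit_cross_cross (rad_pos hM hp) hR, smul_neg,
    sub_neg_eq_add, smul_zero, neg_zero, one_smul, smul_smul, mul_left_comm _ σ,
    inv_mul_cancel₀ hf, mul_one]

theorem dr_vecMul_tangentialForm (hr : 0 < rad p) {P R : Fin 3 → ℝ}
    (hP : radialUnit p ⬝ᵥ P = 0) (hR : radialUnit p ⬝ᵥ R = 0) :
    dr p ᵥ* tangentialForm M p P R = Fin.cons 0 ((lapseSq M (rad p))⁻¹ • R) := by
  rw [tangentialForm, vecMul_twoForm, spatial_dr, dr_zero, dotProduct_comm, hP, map_smul,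
    radialUnit_cross_cross hr hR, neg_zero, zero_smul, zero_sub, smul_neg, neg_neg]

theorem cons_zero_dot_invMetric_mulVec (hM : 0 ≤ M) (hp : p ∈ exterior M) {Y : Fin 3 → ℝ}
    (hY : radialUnit p ⬝ᵥ Y = 0) (w : Spacetime) :
    (Fin.cons 0 Y : Spacetime) ⬝ᵥ (invMetric M p *ᵥ w) = -(Y ⬝ᵥ spatial w) := by
  have hsum : (Fin.cons 0 Y : Spacetime) ⬝ᵥ (invMetric M p *ᵥ w)
      = ∑ a, ∑ b, invMetric M p a b * (Fin.cons 0 Y : Spacetime) a * w b := by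
    simp only [dotProduct, Matrix.mulVec, Finset.mul_sum]
    exact Finset.sum_congr rfl fun a _ => Finset.sum_congr rfl fun b _ => by ring
  have hspatial : spatial (Fin.cons 0 Y) = Y := Fin.tail_cons _ _
  rw [hsum, invMetric_eq hM hp, sum_sphericalForm_mul_mul, hspatial, hY, Fin.cons_zero]
  ring

theorem sum_twoForm_mul_twoForm (P Q P' Q' : Fin 3 → ℝ) :
    ∑ a, ∑ b, twoForm P Q a b * twoForm P' Q' a b = 2 * (P ⬝ᵥ P' + Q ⬝ᵥ Q') := by
  simp [Fin.sum_univ_four, twoForm, Matrix.vec3_dotProduct]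
  ring

theorem sum_tangentialForm_mul_raise (hM : 0 ≤ M) (hp : p ∈ exterior M) {P R : Fin 3 → ℝ}
    (hP : radialUnit p ⬝ᵥ P = 0) (hR : radialUnit p ⬝ᵥ R = 0) :
    ∑ b, ∑ c, tangentialForm M p P R b c
        * (invMetric M p * tangentialForm M p P R * invMetric M p) b c
      = 2 * (lapseSq M (rad p))⁻¹ * (R ⬝ᵥ R - P ⬝ᵥ P) := by
  have hr := rad_pos hM hp
  have hf := (lapseSq_pos hM hp).ne'
  have hcross := radialUnit_cross_dot_self hr R
  rw [hR] at hcross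
  rw [tangentialForm, invMetric_eq hM hp, sphericalForm_mul_twoForm_mul hr,
    sum_twoForm_mul_twoForm, hP, dotProduct_smul _ (radialUnit p), dot_self_cross]
  simp only [mul_zero, zero_smul, add_zero, smul_dotProduct, dotProduct_smul,
    smul_eq_mul, hcross]
  field_simp
  ring

theorem nullVec_dot_dr (hr : 0 < rad p) : nullVec M σ p ⬝ᵥ dr p = σ * lapseSq M (rad p) := by
  rw [nullVec_dot, dr_zero, spatial_dr, radialUnit_dot_self hr]
  ring

theorem invMetric_mulVec_pd_scalarQ (hM : 0 ≤ M) (hp : p ∈ exterior M) :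
    (invMetric M p *ᵥ fun b => pd b (scalarQ M) p)
      = (-(lapseSq M (rad p) * scalarQDeriv M (rad p))) • dr p := by
  have hr := rad_pos hM hp
  have hdq : (fun b => pd b (scalarQ M) p) = scalarQDeriv M (rad p) • dr p :=
    funext (pd_scalarQ hr)
  have hraise : invMetric M p *ᵥ dr p = -lapseSq M (rad p) • dr p := by
    rw [invMetric_eq hM hp]
    exact funext (sum_sphericalForm_mul_dr hr _ _ _)
  rw [hdq, Matrix.mulVec_smul, hraise, smul_smul]
  ring_nf

theorem nullVec_dot_pd_scalarQ (hr : 0 < rad p) :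
    (nullVec M σ p ⬝ᵥ fun a => pd a (scalarQ M) p)
      = scalarQDeriv M (rad p) * (σ * lapseSq M (rad p)) := by
  rw [funext (pd_scalarQ hr), ← nullVec_dot_dr hr, ← smul_eq_mul, ← dotProduct_smul]
  rfl

theorem nullVec_vecMul_dot_pd_scalarQ_vecMul (hM : 0 ≤ M) (hp : p ∈ exterior M)
    {P R : Fin 3 → ℝ} (hP : radialUnit p ⬝ᵥ P = 0) (hR : radialUnit p ⬝ᵥ R = 0) :
    (nullVec M σ p ᵥ* tangentialForm M p P R) ⬝ᵥ (invMetric M p *ᵥ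
        ((invMetric M p *ᵥ fun b => pd b (scalarQ M) p) ᵥ* tangentialForm M p P R))
      = scalarQDeriv M (rad p) * ((P + σ • R) ⬝ᵥ R) := by
  have hf := (lapseSq_pos hM hp).ne'
  have hsum : radialUnit p ⬝ᵥ (P + σ • R) = 0 := by
    rw [dotProduct_add, dotProduct_smul, hP, hR, smul_zero, add_zero]
  have hspatial : spatial (Fin.cons 0 ((lapseSq M (rad p))⁻¹ • R))
      = (lapseSq M (rad p))⁻¹ • R := Fin.tail_cons _ _
  rw [nullVec_vecMul_tangentialForm hM hp hP hR, invMetric_mulVec_pd_scalarQ hM hp,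
    Matrix.smul_vecMul, dr_vecMul_tangentialForm (rad_pos hM hp) hP hR, Matrix.mulVec_smul,
    dotProduct_smul, cons_zero_dot_invMetric_mulVec hM hp hsum, hspatial, dotProduct_smul,
    smul_eq_mul, smul_eq_mul]
  field_simp

theorem fieldD_dot_self_sub_fieldS_dot_self (hσ : σ * σ = 1) :
    fieldD o F p ⬝ᵥ fieldD o F p - fieldS M o F p ⬝ᵥ fieldS M o F p
      = 4 * σ * (nullField M o F σ p ⬝ᵥ fieldD o F p)
        - 4 * (nullField M o F σ p ⬝ᵥ nullField M o F σ p) := by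
  simp only [nullField, smul_dotProduct, dotProduct_smul, add_dotProduct, dotProduct_add,
    smul_eq_mul, dotProduct_comm (fieldD o F p) (fieldS M o F p)]
  linear_combination (-(fieldD o F p ⬝ᵥ fieldD o F p)) * hσ

theorem dotProduct_energyCovector {Z W : Matrix (Fin 4) (Fin 4) ℝ} (hZ : fieldZ M o F p = Z)
    (hW : hodge M o (fieldZ M o F) p = W) (c : ℝ) (v : Spacetime) :
    v ⬝ᵥ energyCovector M o F c p
      = (∑ a, v a * ∑ b, superH M o F p a b * (xi + c • vecA M p) b)
      + c * (1 / 2 * scalarQ M p * ((v ᵥ* Z) ⬝ᵥ (invMetric M p *ᵥ betaRe M o F p)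
          + (v ᵥ* W) ⬝ᵥ (invMetric M p *ᵥ betaIm M o F p))
        + 1 / 16 * (∑ b, ∑ c, Z b c * (invMetric M p * Z * invMetric M p) b c)
          * (v ⬝ᵥ fun a => pd a (scalarQ M) p)
        - 1 / 4 * ((v ᵥ* Z) ⬝ᵥ (invMetric M p *ᵥ
          ((invMetric M p *ᵥ fun b => pd b (scalarQ M) p) ᵥ* Z)))) := by
  have hterm : ∀ a, v a * energyCovector M o F c p a
      = v a * (∑ b, superH M o F p a b * (xi + c • vecA M p) b)
      + (c * (1 / 2 * scalarQ M p) * (v a * (Z *ᵥ (invMetric M p *ᵥ betaRe M o F p)) a)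
      + c * (1 / 2 * scalarQ M p) * (v a * (W *ᵥ (invMetric M p *ᵥ betaIm M o F p)) a)
      + c * (1 / 16 * ∑ b, ∑ c, Z b c * (invMetric M p * Z * invMetric M p) b c)
        * (v a * pd a (scalarQ M) p)
      - c * (1 / 4) * (v a * (Z *ᵥ (invMetric M p *ᵥ
          ((invMetric M p *ᵥ fun b => pd b (scalarQ M) p) ᵥ* Z))) a)) := fun a => by
    simp only [energyCovector, currentP_eq hZ hW, Pi.add_apply, Pi.smul_apply, smul_eq_mul,
      mul_add, Finset.sum_add_distrib, mul_left_comm _ c, ← Finset.mul_sum]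
    ring
  simp only [← Matrix.dotProduct_mulVec]
  rw [dotProduct, Finset.sum_congr rfl fun a _ => hterm a]
  simp only [Finset.sum_add_distrib, Finset.sum_sub_distrib, ← Finset.mul_sum]
  simp only [← dotProduct.eq_1]
  ring

theorem nullVec_dot_energyCovector (hM : 0 ≤ M) (hp : p ∈ exterior M) (hσ : σ * σ = 1)
    (hF : ∀ a b, F p a b = -F p b a) (c : ℝ) :
    nullVec M σ p ⬝ᵥ energyCovector M o F c p
      = 1 / 2 * (1 + σ * c * morawetz M (rad p))
          * ((nullVec M σ p ⬝ᵥ betaRe M o F p) ^ 2 + (nullVec M σ p ⬝ᵥ betaIm M o F p) ^ 2)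
        + 1 / 2 * (lapseSq M (rad p) * (1 - σ * c * morawetz M (rad p)))
          * ((radialUnit p ⨯₃ spatial (betaRe M o F p)) ⬝ᵥ
              (radialUnit p ⨯₃ spatial (betaRe M o F p))
            + (radialUnit p ⨯₃ spatial (betaIm M o F p)) ⬝ᵥ
              (radialUnit p ⨯₃ spatial (betaIm M o F p)))
        - c * scalarQ M p * (nullField M o F σ p ⬝ᵥ spatial (betaRe M o F p)
          + σ * ((o : ℤ) : ℝ) *
            ((radialUnit p ⨯₃ nullField M o F σ p) ⬝ᵥ spatial (betaIm M o F p)))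
        - 1 / 2 * (σ * c * scalarQDeriv M (rad p))
          * (nullField M o F σ p ⬝ᵥ nullField M o F σ p) := by
  have hr := rad_pos hM hp
  have hf := (lapseSq_pos hM hp).ne'
  have hS := radialUnit_dot_eq_zero (spatial_dot_fieldS M o F p)
  have hD := radialUnit_dot_eq_zero (spatial_dot_fieldD o F p)
  have hX := radialUnit_dot_eq_zero (spatial_dot_nullField M o F σ p)
  have hnull : fieldS M o F p + σ • fieldD o F p = (2 : ℝ) • nullField M o F σ p := by
    rw [nullField, smul_smul]
    norm_num
  have hdot : ∀ (a : ℝ) {V : Fin 3 → ℝ}, radialUnit p ⬝ᵥ V = 0 → radialUnit p ⬝ᵥ (a • V) = 0 :=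
    fun a V hV => by rw [dotProduct_smul, hV, smul_zero]
  have hcross : ∀ (a : ℝ) (V : Fin 3 → ℝ), radialUnit p ⬝ᵥ (a • (radialUnit p ⨯₃ V)) = 0 :=
    fun a V => hdot a (dot_self_cross _ _)
  rw [dotProduct_energyCovector (fieldZ_eq hM hp hF) (hodge_fieldZ_eq hM hp hF),
    xi_add_smul_vecA hM hp, sum_mul_sum_superH_mul, nullVec_stress hM hp hσ,
    nullVec_stress hM hp hσ, nullVec_vecMul_dot_pd_scalarQ_vecMul hM hp hS hD,
    nullVec_dot_pd_scalarQ hr, sum_tangentialForm_mul_raise hM hp hS hD,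
    nullVec_vecMul_tangentialForm hM hp hS hD,
    nullVec_vecMul_tangentialForm hM hp (hcross _ _) (hcross _ _),
    radialUnit_cross_nullField hσ, hnull, cons_zero_dot_invMetric_mulVec hM hp (hdot _ hX),
    cons_zero_dot_invMetric_mulVec hM hp (hcross _ _)]
  simp only [smul_dotProduct, smul_eq_mul]
  field_simp
  linear_combination (16 * c * σ * scalarQDeriv M (rad p))
      * fieldD_dot_self_sub_fieldS_dot_self (M := M) (o := o) (F := F) (p := p) hσ
    + (64 * c * scalarQDeriv M (rad p) * (nullField M o F σ p ⬝ᵥ fieldD o F p)) * hσ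

end Energy

/-- The excess of `(div V)² + (curl V)²`, for a field `V` tangential to the spheres, over
`2 |V|² / r²`; its integral over every sphere is nonnegative. -/
def hodgeExcess (V : Spacetime → Fin 3 → ℝ) (p : Spacetime) : ℝ :=
  div3 V p ^ 2 + (radialUnit p ⬝ᵥ curl3 V p) ^ 2 - 2 * (V p ⬝ᵥ V p) / rad p ^ 2

section ScalarInequalities

theorem abs_morawetz_le {s : ℝ} (h0 : 0 ≤ s) (h1 : s ≤ 1 / 2) :
    |1 / 2 * (1 - 3 * s)| ≤ 1 / 2 :=
  abs_le.2 ⟨by linarith, by linarith⟩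

theorem abs_morawetz_add_le {s : ℝ} (h0 : 0 ≤ s) (h1 : s ≤ 1 / 2) :
    |1 / 2 * (1 - 3 * s) + 9 / 4 * s ^ 2 * (3 - 14 * s + 15 * s ^ 2)| ≤ 1 / 2 := by
  rw [abs_le]
  constructor
  · nlinarith [mul_nonneg h0 h0, sq_nonneg (s - 2 / 5), sq_nonneg (s ^ 2 - 1 / 4),
      sq_nonneg (s * (s - 2 / 5)), mul_nonneg h0 (sub_nonneg.2 h1)]
  · have hcubic : s * (3 - 14 * s + 15 * s ^ 2) ≤ 2 / 3 := by
      nlinarith [mul_nonneg h0 (sub_nonneg.2 h1), sq_nonneg (s - 1 / 7),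
        mul_nonneg h0 (mul_nonneg h0 (sub_nonneg.2 h1))]
    nlinarith [mul_le_mul_of_nonneg_left hcubic h0]

theorem one_sub_mul_ge {a c : ℝ} (ha : |a| ≤ 1 / 2) (hc : |c| ≤ 10 / 9) : 4 / 9 ≤ 1 - c * a := by
  have hmul : |c * a| ≤ 10 / 9 * (1 / 2) := by
    rw [abs_mul]
    exact mul_le_mul hc ha (abs_nonneg _) (by norm_num)
  linarith [(abs_le.1 hmul).2]

theorem sq_mul_scalarQ_sq_le {s : ℝ} (h0 : 0 ≤ s) (h1 : s ≤ 1 / 2) :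
    s ^ 2 * (1 - 2 * s) * (s * (2 - 3 * s)) ^ 2 ≤ 1 / 27 * (1 / 9) := by
  have hcubic : s ^ 2 * (1 - 2 * s) ≤ 1 / 27 := by
    nlinarith [mul_nonneg (sq_nonneg (s - 1 / 3)) (by linarith : 0 ≤ s + 1 / 6)]
  have hquadratic : s * (2 - 3 * s) ≤ 1 / 3 := by nlinarith [sq_nonneg (s - 1 / 3)]
  have hnonneg : 0 ≤ s * (2 - 3 * s) := mul_nonneg h0 (by linarith)
  exact mul_le_mul hcubic (by nlinarith [hnonneg]) (sq_nonneg _) (by norm_num)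

theorem discriminant_le {s c : ℝ} (h0 : 0 ≤ s) (h1 : s ≤ 1 / 2) (hc : |c| ≤ 10 / 9) :
    2 * c ^ 2 * (9 / 4 * s ^ 2 * (1 - 2 * s) * (2 - 3 * s)) ^ 2 ≤
      (1 - 2 * s) * (1 - c * (1 / 2 * (1 - 3 * s))) *
        (2 * (1 + c * (1 / 2 * (1 - 3 * s)))
          + c * (9 / 2 * s ^ 2 * (3 - 14 * s + 15 * s ^ 2))) := by
  have hA := one_sub_mul_ge (abs_morawetz_le h0 h1) hc
  have hB := one_sub_mul_ge (abs_morawetz_add_le h0 h1) ((abs_neg c).trans_le hc)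
  have hAB := mul_le_mul hA hB (by norm_num) (by linarith)
  have hcsq : c ^ 2 ≤ (10 / 9) ^ 2 := sq_le_sq' (by linarith [(abs_le.1 hc).1]) (abs_le.1 hc).2
  have hpoly : 0 ≤ s ^ 2 * (1 - 2 * s) * (s * (2 - 3 * s)) ^ 2 :=
    mul_nonneg (mul_nonneg (sq_nonneg s) (by linarith)) (sq_nonneg _)
  have hprod := mul_le_mul hcsq (sq_mul_scalarQ_sq_le h0 h1) hpoly (by norm_num)
  have hreduced : 81 / 16 * (c ^ 2 * (s ^ 2 * (1 - 2 * s) * (s * (2 - 3 * s)) ^ 2)) ≤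
      (1 - c * (1 / 2 * (1 - 3 * s))) *
        (1 - -c * (1 / 2 * (1 - 3 * s) + 9 / 4 * s ^ 2 * (3 - 14 * s + 15 * s ^ 2))) := by
    norm_num at hprod hAB ⊢
    linarith
  linarith [mul_le_mul_of_nonneg_left hreduced (show 0 ≤ 2 * (1 - 2 * s) by linarith)]

theorem quadratic_nonneg {A B k m t X : ℝ} (hA : 0 ≤ A) (hB : 0 ≤ B) (ht : 0 ≤ t) (hX : 0 ≤ X)
    (hm : m ^ 2 ≤ 2 * t * X) (hk : 2 * k ^ 2 ≤ A * B) : 0 ≤ A * t - 2 * k * m + B * X := by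
  have hsq : (2 * k * m) ^ 2 ≤ (A * t + B * X) ^ 2 := by
    have hmul : 2 * k ^ 2 * m ^ 2 ≤ A * B * (2 * t * X) :=
      mul_le_mul hk hm (sq_nonneg _) (mul_nonneg hA hB)
    nlinarith [sq_nonneg (A * t - B * X)]
  linarith [(abs_le_of_sq_le_sq' hsq (by positivity)).2]

end ScalarInequalities

section Coercivity

variable {M σ : ℝ} {p : Spacetime} {o : ℤˣ} {F : Tensor2}

theorem dotProduct_self_nonneg (V : Fin 3 → ℝ) : 0 ≤ V ⬝ᵥ V :=
  Finset.sum_nonneg fun _ _ => mul_self_nonneg _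

theorem dotProduct_sq_le (V W : Fin 3 → ℝ) : (V ⬝ᵥ W) ^ 2 ≤ (V ⬝ᵥ V) * (W ⬝ᵥ W) := by
  have h := dotProduct_self_nonneg (V ⨯₃ W)
  rw [cross_dot_cross, dotProduct_comm W V] at h
  linarith

theorem sq_dotProduct_add_le (hr : 0 < rad p) {X : Fin 3 → ℝ} (hX : radialUnit p ⬝ᵥ X = 0)
    (hσ : σ * σ = 1) (u v : Fin 3 → ℝ) :
    (X ⬝ᵥ u + σ * ((radialUnit p ⨯₃ X) ⬝ᵥ v)) ^ 2
      ≤ 2 * ((radialUnit p ⨯₃ u) ⬝ᵥ (radialUnit p ⨯₃ u)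
        + (radialUnit p ⨯₃ v) ⬝ᵥ (radialUnit p ⨯₃ v)) * (X ⬝ᵥ X) := by
  have hu : (radialUnit p ⨯₃ X) ⬝ᵥ (radialUnit p ⨯₃ u) = X ⬝ᵥ u := by
    rw [cross_dot_cross, radialUnit_dot_self hr, dotProduct_comm X (radialUnit p), hX]
    ring
  have hv : X ⬝ᵥ (radialUnit p ⨯₃ v) = -((radialUnit p ⨯₃ X) ⬝ᵥ v) := by
    rw [triple_product_permutation, triple_product_permutation, ← cross_anticomm, dotProduct_neg,
      dotProduct_comm]
  have hXX := radialUnit_cross_dot_self hr X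
  have hsqu := dotProduct_sq_le (radialUnit p ⨯₃ X) (radialUnit p ⨯₃ u)
  have hsqv := dotProduct_sq_le X (radialUnit p ⨯₃ v)
  rw [hX] at hXX
  rw [hu, hXX] at hsqu
  rw [hv] at hsqv
  nlinarith [sq_nonneg (X ⬝ᵥ u - σ * ((radialUnit p ⨯₃ X) ⬝ᵥ v)),
    congrArg (· * ((radialUnit p ⨯₃ X) ⬝ᵥ v) ^ 2) hσ]

theorem div_rad_le (hM : 0 ≤ M) (hp : p ∈ exterior M) : M / rad p ≤ 1 / 2 := by
  rw [div_le_div_iff₀ (rad_pos hM hp) two_pos]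
  linarith [show 2 * M < rad p from hp]

theorem tangential_energy_nonneg (hM : 0 ≤ M) (hp : p ∈ exterior M) {X : Fin 3 → ℝ}
    (hX : radialUnit p ⬝ᵥ X = 0) {c η : ℝ} (hσ : σ * σ = 1) (hη : η * η = 1) (hc : |c| ≤ 10 / 9)
    (u v : Fin 3 → ℝ) :
    0 ≤ lapseSq M (rad p) * (1 - σ * c * morawetz M (rad p))
          * ((radialUnit p ⨯₃ u) ⬝ᵥ (radialUnit p ⨯₃ u)
            + (radialUnit p ⨯₃ v) ⬝ᵥ (radialUnit p ⨯₃ v))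
        - 2 * (c * scalarQ M p) * (X ⬝ᵥ u + η * ((radialUnit p ⨯₃ X) ⬝ᵥ v))
        + (2 * (1 + σ * c * morawetz M (rad p)) / rad p ^ 2 - σ * c * scalarQDeriv M (rad p))
          * (X ⬝ᵥ X) := by
  have hr := rad_pos hM hp
  have hσc : |σ * c| ≤ 10 / 9 := by
    rwa [abs_mul, show |σ| = 1 from (mul_self_eq_one_iff.1 hσ).elim (by simp +contextual)
      (by simp +contextual), one_mul]
  have h0 := div_nonneg hM hr.le
  have h1 := div_rad_le hM hp
  have hlapse : lapseSq M (rad p) = 1 - 2 * (M / rad p) := by rw [lapseSq, mul_div_assoc]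
  have hmorawetz : morawetz M (rad p) = 1 / 2 * (1 - 3 * (M / rad p)) := by
    rw [morawetz, mul_div_assoc]
  have hq : c * scalarQ M p
      = c * (9 / 4 * (M / rad p) ^ 2 * (1 - 2 * (M / rad p)) * (2 - 3 * (M / rad p))) / rad p := by
    rw [scalarQ]
    field_simp
  have hB : 2 * (1 + σ * c * morawetz M (rad p)) / rad p ^ 2 - σ * c * scalarQDeriv M (rad p)
      = (2 * (1 + σ * c * (1 / 2 * (1 - 3 * (M / rad p))))
        + σ * c * (9 / 2 * (M / rad p) ^ 2 * (3 - 14 * (M / rad p) + 15 * (M / rad p) ^ 2)))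
        / rad p ^ 2 := by
    rw [hmorawetz, scalarQDeriv]
    field_simp
    ring
  have hA := one_sub_mul_ge (abs_morawetz_le h0 h1) hσc
  have hB_pos := one_sub_mul_ge (abs_morawetz_add_le h0 h1) ((abs_neg _).trans_le hσc)
  have hdisc := discriminant_le h0 h1 hσc
  rw [hB, hq, hlapse, hmorawetz]
  refine quadratic_nonneg (mul_nonneg (by linarith) (by linarith))
    (div_nonneg (by linarith) (sq_nonneg _))
    (add_nonneg (dotProduct_self_nonneg _) (dotProduct_self_nonneg _)) (dotProduct_self_nonneg _)
    (sq_dotProduct_add_le hr hX hη u v) ?_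
  refine (Eq.le ?_).trans
    ((div_le_div_of_nonneg_right hdisc (sq_nonneg (rad p))).trans_eq (mul_div_assoc _ _ _))
  rw [mul_pow σ c, sq σ, hσ]
  ring

theorem half_mul_hodgeExcess_le (hM : 0 ≤ M) (hp : p ∈ exterior M) (hsmooth : ContDiffAt ℝ 1 F p)
    (hF : ∀ y ∈ exterior M, ∀ a b, F y a b = -F y b a) (hσ : σ * σ = 1) {c : ℝ}
    (hc : |c| ≤ 10 / 9) :
    1 / 2 * (1 + σ * c * morawetz M (rad p)) * hodgeExcess (nullField M o F σ) p
      ≤ nullVec M σ p ⬝ᵥ energyCovector M o F c p := by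
  have ho : ((o : ℤ) : ℝ) * ((o : ℤ) : ℝ) = 1 := by
    rcases Int.units_eq_one_or o with rfl | rfl <;> norm_num
  have hη : σ * ((o : ℤ) : ℝ) * (σ * ((o : ℤ) : ℝ)) = 1 := by
    rw [mul_mul_mul_comm, hσ, ho, one_mul]
  have hnonneg := tangential_energy_nonneg hM hp
    (radialUnit_dot_eq_zero (spatial_dot_nullField M o F σ p)) hσ hη hc
    (spatial (betaRe M o F p)) (spatial (betaIm M o F p))
  rw [nullVec_dot_energyCovector hM hp hσ (hF p hp), nullVec_dot_betaRe hM hp hsmooth hF,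
    nullVec_dot_betaIm hM hp hsmooth hF hσ, hodgeExcess]
  linear_combination (1 / 2) * hnonneg
    - 1 / 2 * (1 + σ * c * morawetz M (rad p))
      * (radialUnit p ⬝ᵥ curl3 (nullField M o F σ) p) ^ 2 * hη

end Coercivity

/-- The vector field `V div V - (V · ∇) V`, whose flux realises the second order terms of the
Bochner identity as a divergence. -/
def bochnerField (V : Spacetime → Fin 3 → ℝ) (p : Spacetime) : Fin 3 → ℝ :=
  div3 V p • V p - V p ᵥ* jac V p

/-- The generator of the rotations about the `i`-th axis. -/
def rotGen (i : Fin 3) (p : Spacetime) : Spacetime := Fin.cons 0 (Pi.single i 1 ⨯₃ spatial p)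

/-- The sum of the derivatives of `W i` along the rotations about the `i`-th axis; it integrates
to zero over every sphere. -/
def rotDiv (W : Spacetime → Fin 3 → ℝ) (p : Spacetime) : ℝ :=
  ∑ i, fderiv ℝ (fun y => W y i) p (rotGen i p)

section Bochner

variable {p : Spacetime} {V W : Spacetime → Fin 3 → ℝ}

/- In an orthonormal frame with first vector along `x`, the right hand side is `|x|²` times
`(J₂₂ - J₃₃)² + (J₂₃ + J₃₂)²`; up to a factor `A` is the symmetric traceless part of the tangential
block of `J`, rotated by a right angle. -/
theorem tangential_traceless_nonneg {x : Fin 3 → ℝ} (hx : 0 < x ⬝ᵥ x)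
    {J : Matrix (Fin 3) (Fin 3) ℝ} (hJ : x ⬝ᵥ J *ᵥ x = 0) :
    0 ≤ (x ⬝ᵥ ![J 1 2 - J 2 1, J 2 0 - J 0 2, J 0 1 - J 1 0]) ^ 2
      - (x ⬝ᵥ x) * J.trace ^ 2 + 2 * (x ⬝ᵥ x) * (J * J).trace
      - 4 * ((J *ᵥ x) ⬝ᵥ (x ᵥ* J)) := by
  let K : Matrix (Fin 3) (Fin 3) ℝ := Matrix.of fun i j => (x ⨯₃ Jᵀ j) i
  let A : Matrix (Fin 3) (Fin 3) ℝ := (x ⬝ᵥ x) • (K + Kᵀ)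
    - Matrix.vecMulVec (K *ᵥ x) x - Matrix.vecMulVec x (K *ᵥ x)
    - K.trace • ((x ⬝ᵥ x) • 1 - Matrix.vecMulVec x x)
  have hsquares : 2 * (x ⬝ᵥ x) ^ 2 *
      ((x ⬝ᵥ ![J 1 2 - J 2 1, J 2 0 - J 0 2, J 0 1 - J 1 0]) ^ 2
      - (x ⬝ᵥ x) * J.trace ^ 2 + 2 * (x ⬝ᵥ x) * (J * J).trace
      - 4 * ((J *ᵥ x) ⬝ᵥ (x ᵥ* J))) = ∑ i, ∑ j, A i j ^ 2
      - (x ⬝ᵥ J *ᵥ x) * (2 * (x ⬝ᵥ x) ^ 2 * (2 * J.trace) + 2 * (x ⬝ᵥ x) * (x ⬝ᵥ J *ᵥ x)) := by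
    simp only [A, K, Matrix.sub_apply, Matrix.add_apply, Matrix.smul_apply, smul_eq_mul,
      Matrix.transpose_apply, Matrix.vecMulVec_apply, Matrix.of_apply, Matrix.trace_fin_three,
      Matrix.mul_apply, Matrix.mulVec, Matrix.vecMul, dotProduct,
      Fin.sum_univ_three, cross_apply, Matrix.cons_val, Matrix.one_apply, Fin.isValue]
    simp only [Fin.reduceEq, if_true, if_false]
    ring
  rw [hJ, zero_mul, sub_zero] at hsquares
  have hnonneg : 0 ≤ ∑ i, ∑ j, A i j ^ 2 :=
    Finset.sum_nonneg fun i _ => Finset.sum_nonneg fun j _ => sq_nonneg _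
  rw [← hsquares] at hnonneg
  exact nonneg_of_mul_nonneg_right hnonneg (by positivity)

theorem contDiffAt_pd {f : Spacetime → ℝ} {m n : WithTop ℕ∞} (hf : ContDiffAt ℝ n f p)
    (hmn : m + 1 ≤ n) (a : Fin 4) : ContDiffAt ℝ m (pd a f) p :=
  (hf.fderiv_right hmn).clm_apply contDiffAt_const

theorem pd_comm {f : Spacetime → ℝ} (hf : ContDiffAt ℝ 2 f p) (a b : Fin 4) :
    pd a (pd b f) p = pd b (pd a f) p := by
  have hd : DifferentiableAt ℝ (fderiv ℝ f) p :=
    (hf.fderiv_right (m := 1) (by norm_num)).differentiableAt one_ne_zero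
  have hsecond : ∀ a b, pd a (pd b f) p =
      fderiv ℝ (fderiv ℝ f) p (Pi.single a 1) (Pi.single b 1) := fun a b => by
    rw [pd, show pd b f = fun y => fderiv ℝ f y (Pi.single b 1) from rfl,
      fderiv_clm_apply hd (differentiableAt_const _)]
    simp
  rw [hsecond, hsecond]
  exact hf.isSymmSndFDerivAt (by simp) _ _

theorem pd_sum {f : Fin 3 → Spacetime → ℝ} (hf : ∀ i, DifferentiableAt ℝ (f i) p) (a : Fin 4) :
    pd a (fun y => ∑ i, f i y) p = ∑ i, pd a (f i) p := by
  simp only [pd, fderiv_fun_sum fun i _ => hf i, sum_apply]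

theorem contDiffAt_jac {m n : WithTop ℕ∞} (hV : ContDiffAt ℝ n V p) (hmn : m + 1 ≤ n)
    (i j : Fin 3) : ContDiffAt ℝ m (fun y => jac V y i j) p :=
  contDiffAt_pd (contDiffAt_pi.1 hV j) hmn i.succ

theorem differentiableAt_jac (hV : ContDiffAt ℝ 2 V p) (i j : Fin 3) :
    DifferentiableAt ℝ (fun y => jac V y i j) p :=
  (contDiffAt_jac (m := 1) hV (by norm_num) i j).differentiableAt one_ne_zero

theorem pd_div3 (hV : ContDiffAt ℝ 2 V p) (i : Fin 3) :
    pd i.succ (div3 V) p = ∑ j, pd j.succ (fun y => jac V y i j) p :=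
  (pd_sum (fun j => differentiableAt_jac hV j j) i.succ).trans
    (Finset.sum_congr rfl fun j _ => pd_comm (contDiffAt_pi.1 hV j) i.succ j.succ)

theorem contDiffAt_div3 {m n : WithTop ℕ∞} (hV : ContDiffAt ℝ n V p) (hmn : m + 1 ≤ n) :
    ContDiffAt ℝ m (div3 V) p :=
  ContDiffAt.sum (s := Finset.univ) fun j _ => contDiffAt_jac hV hmn j j

theorem div3_smul {φ : Spacetime → ℝ} (hφ : DifferentiableAt ℝ φ p)
    (hV : DifferentiableAt ℝ V p) :
    div3 (fun y => φ y • V y) p = ∑ i : Fin 3, pd i.succ φ p * V p i + φ p * div3 V p := by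
  simp only [div3_eq, vecPd_smul hφ hV, Pi.add_apply, Pi.smul_apply, smul_eq_mul,
    Finset.sum_add_distrib, Finset.mul_sum]

theorem div3_vecMul_jac (hV : ContDiffAt ℝ 2 V p) :
    div3 (fun y => V y ᵥ* jac V y) p
      = (jac V p * jac V p).trace + ∑ i : Fin 3, pd i.succ (div3 V) p * V p i := by
  have hV1 := hV.differentiableAt two_ne_zero
  have hterm : ∀ i : Fin 3, vecPd i.succ (fun y => V y ᵥ* jac V y) p i
      = jac V p i ⬝ᵥ (jac V p)ᵀ i + V p ⬝ᵥ vecPd i.succ (fun y => (jac V y)ᵀ i) p := fun i =>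
    pd_dotProduct hV1 (differentiableAt_pi.2 fun j => differentiableAt_jac hV j i) i.succ
  simp only [div3_eq (fun y => V y ᵥ* jac V y), hterm, Finset.sum_add_distrib, pd_div3 hV,
    Finset.sum_mul]
  refine congrArg₂ (· + ·) rfl (Finset.sum_comm.trans ?_)
  exact Finset.sum_congr rfl fun i _ => Finset.sum_congr rfl fun j _ => mul_comm _ _

theorem contDiffAt_vecMul_jac {m n : WithTop ℕ∞} (hV : ContDiffAt ℝ n V p) (hmn : m + 1 ≤ n) :
    ContDiffAt ℝ m (fun y => V y ᵥ* jac V y) p :=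
  contDiffAt_pi.2 fun j => ContDiffAt.sum (s := Finset.univ) fun i _ =>
    (contDiffAt_pi.1 (hV.of_le (le_self_add.trans hmn)) i).mul (contDiffAt_jac hV hmn i j)

theorem div3_sub (hV : DifferentiableAt ℝ V p) (hW : DifferentiableAt ℝ W p) :
    div3 (fun y => V y - W y) p = div3 V p - div3 W p := by
  have hcomp : ∀ i : Fin 3, pd i.succ (fun y => V y i - W y i) p
      = vecPd i.succ V p i - vecPd i.succ W p i := fun i =>
    pd_sub (differentiableAt_pi.1 hV i) (differentiableAt_pi.1 hW i) i.succ
  simp only [div3_eq, ← Finset.sum_sub_distrib, ← hcomp]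
  rfl

theorem contDiffAt_bochnerField {m n : WithTop ℕ∞} (hV : ContDiffAt ℝ n V p)
    (hmn : m + 1 ≤ n) : ContDiffAt ℝ m (bochnerField V) p :=
  ((contDiffAt_div3 hV hmn).smul (hV.of_le (le_self_add.trans hmn))).sub
    (contDiffAt_vecMul_jac hV hmn)

theorem differentiableAt_bochnerField (hV : ContDiffAt ℝ 2 V p) :
    DifferentiableAt ℝ (bochnerField V) p :=
  (contDiffAt_bochnerField (m := 1) hV (by norm_num)).differentiableAt one_ne_zero

theorem div3_bochnerField (hV : ContDiffAt ℝ 2 V p) :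
    div3 (bochnerField V) p = (jac V p).trace ^ 2 - (jac V p * jac V p).trace := by
  have hV1 := hV.differentiableAt two_ne_zero
  have hd := (contDiffAt_div3 (m := 1) hV (by norm_num)).differentiableAt one_ne_zero
  have hJ := (contDiffAt_vecMul_jac (m := 1) hV (by norm_num)).differentiableAt one_ne_zero
  refine (div3_sub (hd.fun_smul hV1) hJ).trans ?_
  rw [div3_smul hd hV1, div3_vecMul_jac hV, div3]
  ring

theorem spatial_dot_bochnerField (hV : DifferentiableAt ℝ V p)
    (ht : ∀ᶠ y in 𝓝 p, spatial y ⬝ᵥ V y = 0) :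
    spatial p ⬝ᵥ bochnerField V p = V p ⬝ᵥ V p := by
  have hJ : jac V p *ᵥ spatial p = -V p := funext fun i =>
    (dotProduct_comm _ _).trans ((spatial_dot_vecPd_of_tangential hV ht).2 i)
  rw [bochnerField, dotProduct_sub, dotProduct_smul, ht.self_of_nhds, dotProduct_comm,
    ← Matrix.dotProduct_mulVec, hJ]
  simp

theorem fderiv_rotGen (f : Spacetime → ℝ) (i : Fin 3) (p : Spacetime) :
    fderiv ℝ f p (rotGen i p)
      = (Pi.single i 1 ⨯₃ spatial p) ⬝ᵥ fun a => pd a.succ f p := by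
  have hbasis : rotGen i p
      = ∑ a : Fin 3, (Pi.single i 1 ⨯₃ spatial p) a • Pi.single a.succ (1 : ℝ) := by
    rw [pi_eq_sum_univ' (rotGen i p), Fin.sum_univ_succ]
    simp [rotGen]
  simp only [hbasis, map_sum, map_smul, smul_eq_mul]
  rfl

theorem rotDiv_spatial_cross (hW : DifferentiableAt ℝ W p) :
    rotDiv (fun y => spatial y ⨯₃ W y) p
      = rad p ^ 2 * div3 W p - 2 * (spatial p ⬝ᵥ W p) - spatial p ⬝ᵥ jac W p *ᵥ spatial p := by
  have hterm : ∀ i, fderiv ℝ (fun y => (spatial y ⨯₃ W y) i) p (rotGen i p)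
      = (Pi.single i 1 ⨯₃ spatial p) ⬝ᵥ
        fun a => (Pi.single a 1 ⨯₃ W p + spatial p ⨯₃ jac W p a) i := fun i => by
    simp only [fderiv_rotGen, ← jac_spatial_cross hW]
    rfl
  refine (Finset.sum_congr rfl fun i _ => hterm i).trans ?_
  simp only [rad_sq, div3, Matrix.trace_fin_three, Fin.sum_univ_three,
    Matrix.vec3_dotProduct, Matrix.mulVec, cross_apply]
  simp
  ring

theorem spatial_dot_jac_bochnerField (hV : ContDiffAt ℝ 2 V p)
    (ht : ∀ᶠ y in 𝓝 p, spatial y ⬝ᵥ V y = 0) :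
    spatial p ⬝ᵥ jac (bochnerField V) p *ᵥ spatial p
      = 2 * (spatial p ⬝ᵥ jac V p *ᵥ V p) - V p ⬝ᵥ V p := by
  have hV1 := hV.differentiableAt two_ne_zero
  have hdot : (fun y => spatial y ⬝ᵥ bochnerField V y) =ᶠ[𝓝 p] fun y => V y ⬝ᵥ V y := by
    filter_upwards [ht.eventually_nhds, hV.eventually (by simp)] with y hty hVy
      using spatial_dot_bochnerField (hVy.differentiableAt two_ne_zero) hty
  have hrow : jac (bochnerField V) p *ᵥ spatial p
      = (2 : ℝ) • (jac V p *ᵥ V p) - bochnerField V p := by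
    funext i
    have hi := pd_congr hdot i.succ
    rw [pd_dotProduct differentiableAt_spatial (differentiableAt_bochnerField hV),
      pd_dotProduct hV1 hV1, vecPd_spatial_succ, single_one_dotProduct,
      dotProduct_comm (V p), dotProduct_comm (spatial p), ← two_mul] at hi
    exact eq_sub_of_add_eq' hi
  rw [hrow, dotProduct_sub, dotProduct_smul, smul_eq_mul,
    spatial_dot_bochnerField hV1 ht]

theorem rotDiv_le_hodgeExcess (hr : 0 < rad p) (hV : ContDiffAt ℝ 2 V p)
    (ht : ∀ᶠ y in 𝓝 p, spatial y ⬝ᵥ V y = 0) :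
    2 / rad p ^ 2 * rotDiv (fun y => spatial y ⨯₃ bochnerField V y) p ≤ hodgeExcess V p := by
  have hV1 := hV.differentiableAt two_ne_zero
  have hJ : jac V p *ᵥ spatial p = -V p := funext fun i =>
    (dotProduct_comm _ _).trans ((spatial_dot_vecPd_of_tangential hV1 ht).2 i)
  have hquad : spatial p ⬝ᵥ jac V p *ᵥ spatial p = 0 := by
    rw [hJ, dotProduct_neg, ht.self_of_nhds, neg_zero]
  have hnonneg := tangential_traceless_nonneg (by rw [← rad_sq]; positivity) hquad
  rw [hJ, neg_dotProduct, dotProduct_comm (V p), ← Matrix.dotProduct_mulVec, ← rad_sq]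
    at hnonneg
  rw [rotDiv_spatial_cross (differentiableAt_bochnerField hV), div3_bochnerField hV,
    spatial_dot_bochnerField hV1 ht, spatial_dot_jac_bochnerField hV ht, ← sub_nonneg]
  refine (div_nonneg hnonneg (sq_nonneg (rad p))).trans_eq ?_
  rw [hodgeExcess, radialUnit, smul_dotProduct, smul_eq_mul, curl3, div3]
  field_simp
  ring

end Bochner

/-- The rotation by the angle `s` about the axis spanned by the unit vector `n`, by the formula of
Rodrigues. -/
def rotMat (n : Fin 3 → ℝ) (s : ℝ) : Matrix (Fin 3) (Fin 3) ℝ :=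
  Real.cos s • 1 + (1 - Real.cos s) • Matrix.vecMulVec n n
    + Real.sin s • LinearMap.toMatrix' (crossProduct n)

/-- Invariance of a set under all rotations about the origin. -/
def IsRotInvariant (K : Set E3) : Prop :=
  ∀ R ∈ Matrix.specialOrthogonalGroup (Fin 3) ℝ, ∀ x ∈ K, rot3 R x ∈ K

section Rotations

variable {R : Matrix (Fin 3) (Fin 3) ℝ} {n : Fin 3 → ℝ}

theorem rotMat_mulVec (n : Fin 3 → ℝ) (s : ℝ) (v : Fin 3 → ℝ) :
    rotMat n s *ᵥ v = Real.cos s • v + ((1 - Real.cos s) * (n ⬝ᵥ v)) • n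
      + Real.sin s • (n ⨯₃ v) := by
  simp only [rotMat, Matrix.add_mulVec, Matrix.smul_mulVec, Matrix.one_mulVec,
    Matrix.vecMulVec_mulVec, LinearMap.toMatrix'_mulVec, op_smul_eq_smul, smul_smul]

theorem rotMat_zero_mulVec (n v : Fin 3 → ℝ) : rotMat n 0 *ᵥ v = v := by
  simp [rotMat_mulVec]

theorem rotMat_two_pi_mulVec (n v : Fin 3 → ℝ) : rotMat n (2 * Real.pi) *ᵥ v = v := by
  simp [rotMat_mulVec]

theorem rotMat_pi_mulVec (n v : Fin 3 → ℝ) : rotMat n Real.pi *ᵥ v = (2 * (n ⬝ᵥ v)) • n - v := by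
  rw [rotMat_mulVec, Real.cos_pi, Real.sin_pi]
  module

theorem eq_smul_of_rotMat_pi_mulVec {v : Fin 3 → ℝ} (h : rotMat n Real.pi *ᵥ v = v) :
    v = (n ⬝ᵥ v) • n := by
  rw [rotMat_pi_mulVec, sub_eq_iff_eq_add, ← two_smul ℝ v, mul_smul] at h
  exact (smul_right_injective _ two_ne_zero h).symm

theorem rotMat_mem (hn : n ⬝ᵥ n = 1) (s : ℝ) :
    rotMat n s ∈ Matrix.specialOrthogonalGroup (Fin 3) ℝ := by
  have hs := Real.sin_sq_add_cos_sq s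
  rw [Matrix.mem_specialOrthogonalGroup_iff, Matrix.mem_orthogonalGroup_iff]
  simp only [Matrix.vec3_dotProduct] at hn
  constructor
  · ext a b
    simp only [Matrix.mul_apply, Fin.sum_univ_three]
    fin_cases a <;> fin_cases b <;>
      simp [rotMat, cross_apply, LinearMap.toMatrix'_apply, Matrix.vecMulVec_apply] <;> grind
  · rw [Matrix.det_fin_three]
    simp [rotMat, cross_apply, LinearMap.toMatrix'_apply, Matrix.vecMulVec_apply]
    grind

theorem hasDerivAt_rotMat_mulVec (hn : n ⬝ᵥ n = 1) (v : Fin 3 → ℝ) (s : ℝ) :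
    HasDerivAt (fun s => rotMat n s *ᵥ v) (n ⨯₃ (rotMat n s *ᵥ v)) s := by
  have hc := Real.hasDerivAt_cos s
  have h := ((hc.smul_const v).add (((hc.const_sub 1).mul_const (n ⬝ᵥ v)).smul_const n)).add
    ((Real.hasDerivAt_sin s).smul_const (n ⨯₃ v))
  refine (h.congr_of_eventuallyEq (.of_forall fun s => rotMat_mulVec n s v)).congr_deriv ?_
  have hcross : n ⨯₃ (n ⨯₃ v) = (n ⬝ᵥ v) • n - v := by
    rw [cross_cross_eq_smul_sub_smul', hn, one_smul, dotProduct_comm]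
  rw [rotMat_mulVec]
  simp only [map_add, map_smul, cross_self, hcross]
  module

theorem single_dotProduct_single_self (i : Fin 3) :
    (Pi.single i 1 : Fin 3 → ℝ) ⬝ᵥ Pi.single i 1 = 1 := by
  simp

theorem mulVec_dotProduct_mulVec (hR : R ∈ Matrix.specialOrthogonalGroup (Fin 3) ℝ)
    (v w : Fin 3 → ℝ) : (R *ᵥ v) ⬝ᵥ (R *ᵥ w) = v ⬝ᵥ w := by
  have hR' := (Matrix.mem_orthogonalGroup_iff' _ _).1
    (Matrix.mem_specialOrthogonalGroup_iff.1 hR).1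
  rw [Matrix.dotProduct_mulVec, ← Matrix.mulVec_transpose, Matrix.mulVec_mulVec, hR',
    Matrix.one_mulVec]

theorem transpose_mem (hR : R ∈ Matrix.specialOrthogonalGroup (Fin 3) ℝ) :
    Rᵀ ∈ Matrix.specialOrthogonalGroup (Fin 3) ℝ :=
  (star ⟨R, hR⟩ : Matrix.specialOrthogonalGroup (Fin 3) ℝ).2

end Rotations

section RotationsOfSpacetime

variable {M : ℝ} {R : Matrix (Fin 3) (Fin 3) ℝ} {p : Spacetime}

theorem rot4_zero (R : Matrix (Fin 3) (Fin 3) ℝ) (p : Spacetime) : rot4 R p 0 = p 0 := rfl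

theorem spatial_rot4 (R : Matrix (Fin 3) (Fin 3) ℝ) (p : Spacetime) :
    spatial (rot4 R p) = R *ᵥ spatial p := rfl

theorem spacetime_ext {v w : Spacetime} (h₀ : v 0 = w 0) (h : spatial v = spatial w) : v = w :=
  funext (Fin.cases h₀ (congrFun h))

theorem rot4_eq_self (hR : R *ᵥ spatial p = spatial p) : rot4 R p = p := spacetime_ext rfl hR

theorem rad_rot4 (hR : R ∈ Matrix.specialOrthogonalGroup (Fin 3) ℝ) (p : Spacetime) :
    rad (rot4 R p) = rad p := by
  have h : rad (rot4 R p) ^ 2 = rad p ^ 2 := by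
    rw [rad_sq, rad_sq, spatial_rot4, mulVec_dotProduct_mulVec hR]
  exact (sq_eq_sq₀ (Real.sqrt_nonneg _) (Real.sqrt_nonneg _)).1 h

theorem radialUnit_rot4_dot (hR : R ∈ Matrix.specialOrthogonalGroup (Fin 3) ℝ) (p v : Spacetime) :
    radialUnit (rot4 R p) ⬝ᵥ spatial (rot4 R v) = radialUnit p ⬝ᵥ spatial v := by
  rw [radialUnit, radialUnit, smul_dotProduct, smul_dotProduct, rad_rot4 hR, spatial_rot4,
    spatial_rot4, mulVec_dotProduct_mulVec hR]

theorem inner4_rot4 (hR : R ∈ Matrix.specialOrthogonalGroup (Fin 3) ℝ) (p v w : Spacetime) :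
    inner4 M (rot4 R p) (rot4 R v) (rot4 R w) = inner4 M p v w := by
  simp only [inner4_eq, radialUnit_rot4_dot hR, rad_rot4 hR]
  rw [spatial_rot4, spatial_rot4, mulVec_dotProduct_mulVec hR, rot4_zero, rot4_zero]

/-- `rot4 R` as a continuous linear map. -/
def rot4L (R : Matrix (Fin 3) (Fin 3) ℝ) : Spacetime →L[ℝ] Spacetime :=
  LinearMap.toContinuousLinearMap
    { toFun := rot4 R
      map_add' := fun v w => spacetime_ext rfl (R.mulVec_add (spatial v) (spatial w))
      map_smul' := fun c v => spacetime_ext rfl (R.mulVec_smul c (spatial v)) }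

theorem hasDerivAt_rot4 (i : Fin 3) (p : Spacetime) (s : ℝ) :
    HasDerivAt (fun s => rot4 (rotMat (Pi.single i 1) s) p)
      (rotGen i (rot4 (rotMat (Pi.single i 1) s) p)) s :=
  hasDerivAt_pi.2 <| Fin.cases (hasDerivAt_const s (p 0)) <| hasDerivAt_pi.1 <|
    hasDerivAt_rotMat_mulVec (single_dotProduct_single_self i) (spatial p) s

end RotationsOfSpacetime

section RotationsOfSpace

variable {R : Matrix (Fin 3) (Fin 3) ℝ} {x : E3}

theorem rot3_eq_self (hR : R *ᵥ x.ofLp = x.ofLp) : rot3 R x = x := congrArg (WithLp.toLp 2) hR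

theorem rot3_rot3_transpose (hR : R ∈ Matrix.specialOrthogonalGroup (Fin 3) ℝ) (x : E3) :
    rot3 R (rot3 Rᵀ x) = x := by
  have h : R * Rᵀ = 1 :=
    (Matrix.mem_orthogonalGroup_iff _ _).1 (Matrix.mem_specialOrthogonalGroup_iff.1 hR).1
  simp [rot3, Matrix.mulVec_mulVec, h]

theorem norm_rot3 (hR : R ∈ Matrix.specialOrthogonalGroup (Fin 3) ℝ) (x : E3) :
    ‖rot3 R x‖ = ‖x‖ := by
  have h : ∀ y : E3, ‖y‖ ^ 2 = y.ofLp ⬝ᵥ y.ofLp := fun y => by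
    rw [← real_inner_self_eq_norm_sq, EuclideanSpace.inner_eq_star_dotProduct, star_trivial]
  have hsq : ‖rot3 R x‖ ^ 2 = ‖x‖ ^ 2 := by
    rw [h, h]
    exact mulVec_dotProduct_mulVec hR _ _
  exact (sq_eq_sq₀ (norm_nonneg _) (norm_nonneg _)).1 hsq

/-- `rot3 R` as a linear isometry, for a rotation `R`. -/
def rot3Iso (hR : R ∈ Matrix.specialOrthogonalGroup (Fin 3) ℝ) : E3 ≃ₗᵢ[ℝ] E3 :=
  LinearIsometry.toLinearIsometryEquiv
    { toFun := rot3 R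
      map_add' := fun x y => congrArg (WithLp.toLp 2) (R.mulVec_add x.ofLp y.ofLp)
      map_smul' := fun c x => congrArg (WithLp.toLp 2) (R.mulVec_smul c x.ofLp)
      norm_map' := norm_rot3 hR } rfl

theorem rot3Iso_apply (hR : R ∈ Matrix.specialOrthogonalGroup (Fin 3) ℝ) (x : E3) :
    rot3Iso hR x = rot3 R x := rfl

theorem IsRotInvariant.preimage_rot3 {K : Set E3} (hK : IsRotInvariant K)
    (hR : R ∈ Matrix.specialOrthogonalGroup (Fin 3) ℝ) : rot3Iso hR ⁻¹' K = K := by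
  refine Subset.antisymm (fun x hx => ?_) (hK R hR)
  have h := hK _ (transpose_mem hR) _ hx
  rwa [rot3Iso_apply, ← Matrix.transpose_transpose R, Matrix.transpose_transpose Rᵀ,
    rot3_rot3_transpose (transpose_mem hR)] at h

theorem setIntegral_comp_rot3 {K : Set E3} (hK : IsRotInvariant K)
    (hR : R ∈ Matrix.specialOrthogonalGroup (Fin 3) ℝ) (G : E3 → ℝ) :
    ∫ x in K, G (rot3 R x) = ∫ x in K, G x := by
  have h := (rot3Iso hR).measurePreserving.setIntegral_preimage_emb
    (rot3Iso hR).toHomeomorph.measurableEmbedding G K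
  rwa [hK.preimage_rot3 hR] at h

theorem hasDerivAt_rot3 (i : Fin 3) (x : E3) :
    HasDerivAt (fun s => rot3 (rotMat (Pi.single i 1) s) x)
      (WithLp.toLp 2 (Pi.single i 1 ⨯₃ x.ofLp)) 0 := by
  have h := hasDerivAt_rotMat_mulVec (single_dotProduct_single_self i) x.ofLp 0
  rw [rotMat_zero_mulVec] at h
  exact (PiLp.continuousLinearEquiv 2 ℝ
    (fun _ : Fin 3 => ℝ)).symm.toContinuousLinearMap.hasFDerivAt.comp_hasDerivAt 0 h

theorem continuous_rot3_rotMat (n : Fin 3 → ℝ) :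
    Continuous fun q : E3 × ℝ => rot3 (rotMat n q.2) q.1 := by
  have hof : Continuous fun q : E3 × ℝ => q.1.ofLp :=
    (PiLp.continuous_ofLp 2 (fun _ : Fin 3 => ℝ)).comp continuous_fst
  have hcross : Continuous fun q : E3 × ℝ => n ⨯₃ q.1.ofLp :=
    (crossProduct n).continuous_of_finiteDimensional.comp hof
  simp only [rot3, rotMat_mulVec]
  refine (PiLp.continuous_toLp 2 (fun _ : Fin 3 => ℝ)).comp ?_
  fun_prop

end RotationsOfSpace

/-- The component of `v` along the null vector `nullVec M σ p`, up to a factor `1 / 2`, for `v`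
without tangential part. -/
def nullCoord (M σ : ℝ) (p v : Spacetime) : ℝ :=
  v 0 + σ * ((radialUnit p ⬝ᵥ spatial v) / lapseSq M (rad p))

section RadialVectors

variable {M σ : ℝ} {p v w : Spacetime} {R : Matrix (Fin 3) (Fin 3) ℝ}

theorem nullCoord_rot4 (hR : R ∈ Matrix.specialOrthogonalGroup (Fin 3) ℝ) (p v : Spacetime) :
    nullCoord M σ (rot4 R p) (rot4 R v) = nullCoord M σ p v := by
  rw [nullCoord, nullCoord, radialUnit_rot4_dot hR, rad_rot4 hR, rot4_zero]

theorem nullCoord_xi (M σ : ℝ) (p : Spacetime) : nullCoord M σ p xi = 1 := by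
  have hxi : spatial xi = 0 := funext fun i => Pi.single_eq_of_ne i.succ_ne_zero 1
  rw [nullCoord, hxi, dotProduct_zero, zero_div, mul_zero, add_zero]
  exact Pi.single_eq_same 0 1

theorem inner4_eq_nullCoord (hf : lapseSq M (rad p) ≠ 0) (hσ : σ * σ = 1)
    (hv : spatial v = (radialUnit p ⬝ᵥ spatial v) • radialUnit p) (w : Spacetime) :
    inner4 M p v w = lapseSq M (rad p) / 2 *
      (nullCoord M σ p v * nullCoord M (-σ) p w + nullCoord M (-σ) p v * nullCoord M σ p w) := by
  have hdot : spatial v ⬝ᵥ spatial w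
      = (radialUnit p ⬝ᵥ spatial v) * (radialUnit p ⬝ᵥ spatial w) := by
    conv_lhs => rw [hv, smul_dotProduct, smul_eq_mul]
  rw [inner4_eq, hdot, nullCoord, nullCoord, nullCoord, nullCoord]
  field_simp
  linear_combination (2 * (radialUnit p ⬝ᵥ spatial v) * (radialUnit p ⬝ᵥ spatial w)) * hσ

theorem eq_add_nullVec (hf : lapseSq M (rad p) ≠ 0)
    (hv : spatial v = (radialUnit p ⬝ᵥ spatial v) • radialUnit p) :
    v = (nullCoord M 1 p v / 2) • nullVec M 1 p
      + (nullCoord M (-1) p v / 2) • nullVec M (-1) p := by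
  refine spacetime_ext ?_ ?_
  · simp only [Pi.add_apply, Pi.smul_apply, nullVec_zero, nullCoord, smul_eq_mul]
    ring
  · change spatial v = (nullCoord M 1 p v / 2) • spatial (nullVec M 1 p)
      + (nullCoord M (-1) p v / 2) • spatial (nullVec M (-1) p)
    rw [spatial_nullVec, spatial_nullVec, smul_smul, smul_smul, ← add_smul]
    refine hv.trans (congrArg (· • radialUnit p) ?_)
    rw [nullCoord, nullCoord]
    field_simp
    ring

theorem spatial_eq_smul_radialUnit_of_rotMat_pi {n : Fin 3 → ℝ} (hr : 0 < rad p)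
    (hp : rot4 (rotMat n Real.pi) p = p) (hv : rot4 (rotMat n Real.pi) v = v) :
    spatial v = (radialUnit p ⬝ᵥ spatial v) • radialUnit p := by
  have hp' : spatial p = (n ⬝ᵥ spatial p) • n :=
    eq_smul_of_rotMat_pi_mulVec (congrArg spatial hp)
  have hv' : spatial v = (n ⬝ᵥ spatial v) • n :=
    eq_smul_of_rotMat_pi_mulVec (congrArg spatial hv)
  have hn : n ⬝ᵥ spatial p ≠ 0 := fun h => by
    rw [h, zero_smul] at hp'
    exact (pow_pos hr 2).ne' ((rad_sq p).trans (by rw [hp', zero_dotProduct]))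
  have hpar : spatial v = ((n ⬝ᵥ spatial v) * (n ⬝ᵥ spatial p)⁻¹ * rad p) • radialUnit p := by
    rw [mul_smul, rad_smul_radialUnit hr, mul_smul, ← (eq_inv_smul_iff₀ hn).2 hp'.symm]
    exact hv'
  conv_rhs => rw [hpar, dotProduct_smul, radialUnit_dot_self hr, smul_eq_mul, mul_one]
  exact hpar

theorem spatial_eq_smul_radialUnit_of_inner4_rotGen (hr : 0 < rad p)
    (h : ∀ i, inner4 M p v (rotGen i p) = 0) :
    spatial v = (radialUnit p ⬝ᵥ spatial v) • radialUnit p := by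
  have hcross : spatial p ⨯₃ spatial v = 0 := by
    funext i
    have hi := h i
    have hrad : radialUnit p ⬝ᵥ Pi.single i 1 ⨯₃ spatial p = 0 := by
      rw [radialUnit, smul_dotProduct, dot_cross_self, smul_zero]
    rw [inner4_eq, show spatial (rotGen i p) = Pi.single i 1 ⨯₃ spatial p from rfl, hrad,
      show rotGen i p 0 = 0 from rfl, triple_product_permutation, single_one_dotProduct] at hi
    simpa using hi
  have hself : radialUnit p ⨯₃ (radialUnit p ⨯₃ spatial v) = 0 := by
    simp [radialUnit, hcross]
  rw [cross_cross_eq_smul_sub_smul', radialUnit_dot_self hr, one_smul, sub_eq_zero] at hself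
  exact hself.symm

end RadialVectors

namespace SphericalSlice

section Geometry

variable {M σ : ℝ} (S : SphericalSlice M) {R : Matrix (Fin 3) (Fin 3) ℝ} {x : E3}

theorem differentiableAt_emb (hx : x ∈ S.dom) : DifferentiableAt ℝ S.emb x :=
  (S.smooth.contDiffAt (S.isOpen_dom.mem_nhds hx)).differentiableAt (by simp)

theorem rad_emb_pos (hM : 0 ≤ M) (hx : x ∈ S.dom) : 0 < rad (S.emb x) :=
  rad_pos hM (S.mapsTo hx)

theorem lapseSq_emb_pos (hM : 0 ≤ M) (hx : x ∈ S.dom) : 0 < lapseSq M (rad (S.emb x)) :=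
  lapseSq_pos hM (S.mapsTo hx)

theorem fderiv_emb_rot3 (hR : R ∈ Matrix.specialOrthogonalGroup (Fin 3) ℝ) (hx : x ∈ S.dom)
    (v : E3) : fderiv ℝ S.emb (rot3 R x) (rot3 R v) = rot4 R (fderiv ℝ S.emb x v) := by
  have hequivariant : (fun y => rot4L R (S.emb y)) =ᶠ[𝓝 x] fun y => S.emb (rot3Iso hR y) := by
    filter_upwards [S.isOpen_dom.mem_nhds hx] with y hy using (S.equivariant R hR y hy).symm
  have hleft := (S.differentiableAt_emb (S.rot_mem R hR x hx)).hasFDerivAt.comp x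
    (rot3Iso hR).toContinuousLinearEquiv.hasFDerivAt
  have hright := (rot4L R).hasFDerivAt.comp x (S.differentiableAt_emb hx).hasFDerivAt
  exact DFunLike.congr_fun ((hleft.congr_of_eventuallyEq hequivariant).unique hright) v

theorem fderiv_emb_rotGen (hx : x ∈ S.dom) (i : Fin 3) :
    fderiv ℝ S.emb x (WithLp.toLp 2 (Pi.single i 1 ⨯₃ x.ofLp)) = rotGen i (S.emb x) := by
  have hzero : rot3 (rotMat (Pi.single i 1) 0) x = x := rot3_eq_self (rotMat_zero_mulVec _ _)
  have hcurve : (fun s => rot4 (rotMat (Pi.single i 1) s) (S.emb x))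
      = fun s => S.emb (rot3 (rotMat (Pi.single i 1) s) x) := funext fun s =>
    (S.equivariant _ (rotMat_mem (single_dotProduct_single_self i) s) x hx).symm
  have hright := hasDerivAt_rot4 i (S.emb x) 0
  rw [hcurve, rot4_eq_self (rotMat_zero_mulVec _ _)] at hright
  refine (HasFDerivAt.comp_hasDerivAt 0 ?_ (hasDerivAt_rot3 i x)).unique hright
  rw [hzero]
  exact (S.differentiableAt_emb hx).hasFDerivAt

theorem zero_notMem (hM : 0 ≤ M) : (0 : E3) ∉ S.dom := by
  intro h
  have hfix : ∀ i, spatial (S.emb 0)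
      = (Pi.single i 1 ⬝ᵥ spatial (S.emb 0)) • Pi.single i 1 := fun i => by
    have hR := rotMat_mem (single_dotProduct_single_self i) Real.pi
    have hemb := S.equivariant _ hR 0 h
    rw [rot3_eq_self (x := 0) (Matrix.mulVec_zero _)] at hemb
    exact eq_smul_of_rotMat_pi_mulVec (congrArg spatial hemb).symm
  have hzero : spatial (S.emb 0) = 0 := by
    funext a
    rw [hfix (a + 1)]
    simp
  have hr := pow_pos (S.rad_emb_pos hM h) 2
  rw [rad_sq, hzero, zero_dotProduct] at hr
  exact hr.false

theorem exists_rot3_rotMat_pi_eq (hx : x ≠ 0) :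
    ∃ n : Fin 3 → ℝ, n ⬝ᵥ n = 1 ∧ rot3 (rotMat n Real.pi) x = x := by
  have hnorm : x.ofLp ⬝ᵥ x.ofLp = ‖x‖ * ‖x‖ := by
    rw [← real_inner_self_eq_norm_mul_norm, EuclideanSpace.inner_eq_star_dotProduct, star_trivial]
  have hx' := norm_ne_zero_iff.2 hx
  refine ⟨‖x‖⁻¹ • x.ofLp, ?_, rot3_eq_self ?_⟩
  · rw [smul_dotProduct, dotProduct_smul, hnorm, smul_eq_mul, smul_eq_mul]
    field_simp
  · rw [rotMat_pi_mulVec, smul_dotProduct, hnorm, smul_eq_mul, inv_mul_cancel_left₀ hx',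
      smul_smul, mul_assoc, mul_inv_cancel₀ hx']
    module

/-- The radial tangent vector of the slice. -/
def radialTangent (x : E3) : Spacetime := fderiv ℝ S.emb x x

theorem radialTangent_rot3 (hR : R ∈ Matrix.specialOrthogonalGroup (Fin 3) ℝ) (hx : x ∈ S.dom) :
    S.radialTangent (rot3 R x) = rot4 R (S.radialTangent x) :=
  S.fderiv_emb_rot3 hR hx x

theorem spatial_radialTangent (hM : 0 ≤ M) (hx : x ∈ S.dom) :
    spatial (S.radialTangent x)
      = (radialUnit (S.emb x) ⬝ᵥ spatial (S.radialTangent x)) • radialUnit (S.emb x) := by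
  obtain ⟨n, hn, hfix⟩ := exists_rot3_rotMat_pi_eq fun h => S.zero_notMem hM (h ▸ hx)
  have hR := rotMat_mem hn Real.pi
  refine spatial_eq_smul_radialUnit_of_rotMat_pi (n := n) (S.rad_emb_pos hM hx) ?_ ?_
  · rw [← S.equivariant _ hR x hx, hfix]
  · rw [← S.radialTangent_rot3 hR hx, hfix]

theorem nullCoord_radialTangent_mul_neg (hM : 0 ≤ M) (hσ : σ * σ = 1) (hx : x ∈ S.dom) :
    nullCoord M σ (S.emb x) (S.radialTangent x)
      * nullCoord M (-σ) (S.emb x) (S.radialTangent x) < 0 := by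
  have hf := S.lapseSq_emb_pos hM hx
  have h : inner4 M (S.emb x) (S.radialTangent x) (S.radialTangent x) < 0 :=
    S.spacelike x hx x fun h => S.zero_notMem hM (h ▸ hx)
  rw [inner4_eq_nullCoord hf.ne' hσ (S.spatial_radialTangent hM hx)] at h
  have := neg_of_mul_neg_right h (half_pos hf).le
  linarith

section Normal

variable {S} {N : E3 → Spacetime}

theorem IsUnitNormal.spatial_eq (hN : S.IsUnitNormal N) (hM : 0 ≤ M) (hx : x ∈ S.dom) :
    spatial (N x) = (radialUnit (S.emb x) ⬝ᵥ spatial (N x)) • radialUnit (S.emb x) :=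
  spatial_eq_smul_radialUnit_of_inner4_rotGen (S.rad_emb_pos hM hx) fun i =>
    S.fderiv_emb_rotGen hx i ▸ hN.orthogonal x hx _

theorem IsUnitNormal.lapseSq_mul_nullCoord_mul (hN : S.IsUnitNormal N) (hM : 0 ≤ M)
    (hσ : σ * σ = 1) (hx : x ∈ S.dom) :
    lapseSq M (rad (S.emb x)) * (nullCoord M σ (S.emb x) (N x) * nullCoord M (-σ) (S.emb x) (N x))
      = 1 := by
  have h := hN.unit x hx
  rw [inner4_eq_nullCoord (S.lapseSq_emb_pos hM hx).ne' hσ (hN.spatial_eq hM hx)] at h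
  linarith

theorem IsUnitNormal.nullCoord_pos (hN : S.IsUnitNormal N) (hM : 0 ≤ M) (hσ : σ * σ = 1)
    (hx : x ∈ S.dom) : 0 < nullCoord M σ (S.emb x) (N x) := by
  have hf := S.lapseSq_emb_pos hM hx
  have hprod : 0 < nullCoord M σ (S.emb x) (N x) * nullCoord M (-σ) (S.emb x) (N x) := by
    refine pos_of_mul_pos_right ?_ hf.le
    rw [hN.lapseSq_mul_nullCoord_mul hM hσ hx]
    exact one_pos
  have hsum := hN.future x hx
  rw [inner4_eq_nullCoord hf.ne' hσ (hN.spatial_eq hM hx), nullCoord_xi, nullCoord_xi, mul_one,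
    mul_one] at hsum
  have hsum' := pos_of_mul_pos_right hsum (half_pos hf).le
  rcases mul_pos_iff.1 hprod with h | h
  · exact h.1
  · linarith [h.1, h.2]

theorem IsUnitNormal.nullCoord_eq (hN : S.IsUnitNormal N) (hM : 0 ≤ M) (hσ : σ * σ = 1)
    (hx : x ∈ S.dom) :
    nullCoord M σ (S.emb x) (N x)
      = √(-nullCoord M σ (S.emb x) (S.radialTangent x)
        / (lapseSq M (rad (S.emb x)) * nullCoord M (-σ) (S.emb x) (S.radialTangent x))) := by
  have hf := S.lapseSq_emb_pos hM hx
  have hτ := right_ne_zero_of_mul (S.nullCoord_radialTangent_mul_neg hM hσ hx).ne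
  have horth : inner4 M (S.emb x) (N x) (S.radialTangent x) = 0 := hN.orthogonal x hx x
  rw [inner4_eq_nullCoord hf.ne' hσ (hN.spatial_eq hM hx)] at horth
  have horth' := (mul_eq_zero.1 horth).resolve_left (half_pos hf).ne'
  have hunit := hN.lapseSq_mul_nullCoord_mul hM hσ hx
  rw [eq_comm, Real.sqrt_eq_iff_mul_self_eq_of_pos (hN.nullCoord_pos hM hσ hx),
    eq_div_iff (mul_ne_zero hf.ne' hτ)]
  linear_combination lapseSq M (rad (S.emb x)) * nullCoord M σ (S.emb x) (N x) * horth'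
    - nullCoord M σ (S.emb x) (S.radialTangent x) * hunit

end Normal

end Geometry

end SphericalSlice

section Positivity

variable {α : Type*} {m : MeasurableSpace α} {μ : Measure α} {f g : α → ℝ}

theorem lintegral_ofReal_neg_le_of_integral_nonneg (hf : Integrable f μ) (h0 : 0 ≤ ∫ x, f x ∂μ) :
    ∫⁻ x, ENNReal.ofReal (-f x) ∂μ ≤ ∫⁻ x, ENNReal.ofReal (f x) ∂μ := by
  rw [integral_eq_lintegral_pos_part_sub_lintegral_neg_part hf, sub_nonneg] at h0
  exact (ENNReal.toReal_le_toReal hf.neg.lintegral_lt_top.ne hf.lintegral_lt_top.ne).1 h0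

theorem lintegral_ofReal_neg_le_of_ae_le (hf : Integrable f μ) (h0 : 0 ≤ ∫ x, f x ∂μ)
    (hfg : f ≤ᵐ[μ] g) : ∫⁻ x, ENNReal.ofReal (-g x) ∂μ ≤ ∫⁻ x, ENNReal.ofReal (g x) ∂μ :=
  calc ∫⁻ x, ENNReal.ofReal (-g x) ∂μ
      ≤ ∫⁻ x, ENNReal.ofReal (-f x) ∂μ :=
        lintegral_mono_ae (hfg.mono fun _ hx => ENNReal.ofReal_le_ofReal (neg_le_neg hx))
    _ ≤ ∫⁻ x, ENNReal.ofReal (f x) ∂μ := lintegral_ofReal_neg_le_of_integral_nonneg hf h0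
    _ ≤ ∫⁻ x, ENNReal.ofReal (g x) ∂μ :=
        lintegral_mono_ae (hfg.mono fun _ hx => ENNReal.ofReal_le_ofReal hx)

theorem integral_nonneg_of_lintegral_ofReal_neg_le
    (h : ∫⁻ x, ENNReal.ofReal (-f x) ∂μ ≤ ∫⁻ x, ENNReal.ofReal (f x) ∂μ) :
    0 ≤ ∫ x, f x ∂μ := by
  by_cases hf : Integrable f μ
  · rw [integral_eq_lintegral_pos_part_sub_lintegral_neg_part hf, sub_nonneg]
    exact ENNReal.toReal_mono hf.lintegral_lt_top.ne h
  · exact (integral_undef hf).ge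

end Positivity

section RotationInvariance

variable {D K : Set E3} {g g' : E3 → ℝ}

/-- The members of an exhaustion of an open rotation invariant set `D` by compact rotation
invariant sets: the points of the ball of radius `n` at distance at least `1 / (n + 1)` from the
complement of `D`. -/
def compactShell (D : Set E3) (n : ℕ) : Set E3 :=
  Metric.closedBall 0 n \ Metric.thickening (1 / ((n : ℝ) + 1)) Dᶜ

theorem compactShell_subset (D : Set E3) (n : ℕ) : compactShell D n ⊆ D :=
  (sdiff_subset_compl _ _).trans <| compl_subset_comm.1 <|
    Metric.self_subset_thickening Nat.one_div_pos_of_nat _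

theorem isCompact_compactShell (D : Set E3) (n : ℕ) : IsCompact (compactShell D n) :=
  (isCompact_closedBall 0 _).diff Metric.isOpen_thickening

theorem IsRotInvariant.compactShell (hD : IsRotInvariant D) (n : ℕ) :
    IsRotInvariant (compactShell D n) := by
  intro R hR x hx
  refine ⟨?_, fun h => ?_⟩
  · rw [mem_closedBall_zero_iff, norm_rot3 hR]
    exact mem_closedBall_zero_iff.1 hx.1
  · obtain ⟨y, hy, hdist⟩ := Metric.mem_thickening_iff.1 h
    refine hx.2 (Metric.mem_thickening_iff.2 ⟨rot3 Rᵀ y, fun hmem => hy ?_, ?_⟩)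
    · exact rot3_rot3_transpose hR y ▸ hD R hR _ hmem
    · rwa [← (rot3Iso hR).dist_map, rot3Iso_apply, rot3Iso_apply, rot3_rot3_transpose hR]

theorem monotone_compactShell (D : Set E3) : Monotone (compactShell D) := fun _ _ hmn =>
  sdiff_subset_sdiff (Metric.closedBall_subset_closedBall (Nat.cast_le.2 hmn))
    (Metric.thickening_mono (Nat.one_div_le_one_div hmn) _)

theorem iUnion_compactShell (hD : IsOpen D) : ⋃ n, compactShell D n = D := by
  refine Subset.antisymm (iUnion_subset (compactShell_subset D)) fun x hx => ?_
  obtain ⟨δ, hδ, hball⟩ := Metric.isOpen_iff.1 hD x hx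
  obtain ⟨m, hm⟩ := exists_nat_ge ‖x‖
  obtain ⟨k, hk⟩ := exists_nat_one_div_lt hδ
  refine mem_iUnion.2 ⟨max m k,
    mem_closedBall_zero_iff.2 (hm.trans (Nat.cast_le.2 ?_)), fun h => ?_⟩
  · exact le_max_left m k
  · obtain ⟨y, hy, hdist⟩ := Metric.mem_thickening_iff.1 h
    refine hy (hball ?_)
    rw [Metric.mem_ball, dist_comm]
    exact hdist.trans_le ((Nat.one_div_le_one_div (le_max_right m k)).trans hk.le)

/-- A continuous function on `D` which is constant on the orbits of the rotation group. -/
structure IsRadialOn (g : E3 → ℝ) (D : Set E3) : Prop where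
  continuousOn : ContinuousOn g D
  rot3_eq : ∀ R ∈ Matrix.specialOrthogonalGroup (Fin 3) ℝ, ∀ x ∈ D, g (rot3 R x) = g x

theorem IsRadialOn.mul (hg : IsRadialOn g D) (hg' : IsRadialOn g' D) :
    IsRadialOn (fun x => g x * g' x) D :=
  ⟨hg.continuousOn.mul hg'.continuousOn, fun R hR x hx =>
    congrArg₂ (· * ·) (hg.rot3_eq R hR x hx) (hg'.rot3_eq R hR x hx)⟩

theorem IsRadialOn.sqrt (hg : IsRadialOn g D) : IsRadialOn (fun x => √(g x)) D :=
  ⟨hg.continuousOn.sqrt, fun R hR x hx => congrArg Real.sqrt (hg.rot3_eq R hR x hx)⟩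

theorem IsRadialOn.comp {φ : ℝ → ℝ} {s : Set ℝ} (hg : IsRadialOn g D) (hφ : ContinuousOn φ s)
    (h : MapsTo g D s) : IsRadialOn (fun x => φ (g x)) D :=
  ⟨hφ.comp hg.continuousOn h, fun R hR x hx => congrArg φ (hg.rot3_eq R hR x hx)⟩

/- By Fubini, the average of the integrals of `G ∘ rot3 (rotMat n s)` over `s` vanishes, and all of
them are equal to the integral of `G`. -/
theorem setIntegral_eq_zero_of_forall_integral_rotMat {n : Fin 3 → ℝ} {G : E3 → ℝ}
    (hn : n ⬝ᵥ n = 1) (hKc : IsCompact K) (hK : IsRotInvariant K) (hG : ContinuousOn G K)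
    (h : ∀ x ∈ K, ∫ s in (0)..(2 * Real.pi), G (rot3 (rotMat n s) x) = 0) :
    ∫ x in K, G x = 0 := by
  have hcont : ContinuousOn (fun q : E3 × ℝ => G (rot3 (rotMat n q.2) q.1))
      (K ×ˢ Icc 0 (2 * Real.pi)) :=
    hG.comp (continuous_rot3_rotMat n).continuousOn fun q hq => hK _ (rotMat_mem hn q.2) _ hq.1
  have hint : Integrable (Function.uncurry fun x s => G (rot3 (rotMat n s) x))
      ((volume.restrict K).prod (volume.restrict (Ioc 0 (2 * Real.pi)))) := by
    rw [Measure.prod_restrict]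
    exact (hcont.integrableOn_compact (hKc.prod isCompact_Icc)).mono_set
      (prod_mono_right Ioc_subset_Icc_self)
  have hcircle : ∫ x in K, ∫ s in Ioc 0 (2 * Real.pi), G (rot3 (rotMat n s) x) = 0 := by
    refine setIntegral_eq_zero_of_forall_eq_zero fun x hx => ?_
    rw [← intervalIntegral.integral_of_le Real.two_pi_pos.le, h x hx]
  have hswap := (integral_integral_swap hint).symm.trans hcircle
  simp only [setIntegral_comp_rot3 hK (rotMat_mem hn _), setIntegral_const, smul_eq_mul] at hswap
  refine (mul_eq_zero.1 hswap).resolve_left ?_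
  rw [Real.volume_real_Ioc_of_le Real.two_pi_pos.le, sub_zero]
  exact Real.two_pi_pos.ne'

end RotationInvariance

section Continuity

variable {X : Type*} [TopologicalSpace X] {s : Set X} {M σ : ℝ} {φ v w : X → Spacetime}

theorem continuous_rad : Continuous rad := by
  unfold rad
  fun_prop

theorem continuous_spatial : Continuous spatial :=
  continuous_pi fun i => continuous_apply i.succ

theorem continuous_rotGen (i : Fin 3) : Continuous (rotGen i) :=
  continuous_pi <| Fin.cases continuous_const fun j => (continuous_apply j).comp <|
    ((crossProduct (Pi.single i (1 : ℝ))).continuous_of_finiteDimensional).comp continuous_spatial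

theorem continuousOn_lapseSq (M : ℝ) : ContinuousOn (lapseSq M) (Ioi 0) :=
  continuousOn_const.sub (continuousOn_const.div continuousOn_id fun _ hs => ne_of_gt hs)

theorem continuousOn_radialUnit_dot (hφ : ContinuousOn φ s)
    (hv : ContinuousOn v s) (hr : ∀ x ∈ s, 0 < rad (φ x)) :
    ContinuousOn (fun x => radialUnit (φ x) ⬝ᵥ spatial (v x)) s := by
  have hdot : ContinuousOn (fun x => spatial (φ x) ⬝ᵥ spatial (v x)) s :=
    (continuous_spatial.comp continuous_fst |>.dotProduct
      (continuous_spatial.comp continuous_snd)).comp_continuousOn (hφ.prodMk hv)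
  simp only [radialUnit, smul_dotProduct]
  exact ((continuous_rad.comp_continuousOn hφ).inv₀ fun x hx => (hr x hx).ne').smul hdot

theorem continuousOn_nullCoord (hM : 0 ≤ M) (hφ : ContinuousOn φ s) (hv : ContinuousOn v s)
    (hext : MapsTo φ s (exterior M)) : ContinuousOn (fun x => nullCoord M σ (φ x) (v x)) s :=
  ((continuous_apply 0).comp_continuousOn hv).add <| continuousOn_const.mul <|
    (continuousOn_radialUnit_dot hφ hv fun _ hx => rad_pos hM (hext hx)).div
      ((continuousOn_lapseSq M).comp (continuous_rad.comp_continuousOn hφ) fun _ hx =>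
        rad_pos hM (hext hx)) fun _ hx => (lapseSq_pos hM (hext hx)).ne'

theorem continuousOn_inner4 (hM : 0 ≤ M) (hφ : ContinuousOn φ s) (hv : ContinuousOn v s)
    (hw : ContinuousOn w s) (hext : MapsTo φ s (exterior M)) :
    ContinuousOn (fun x => inner4 M (φ x) (v x) (w x)) s := by
  have hr : ∀ x ∈ s, 0 < rad (φ x) := fun x hx => rad_pos hM (hext hx)
  have hlapse : ContinuousOn (fun x => lapseSq M (rad (φ x))) s :=
    (continuousOn_lapseSq M).comp (continuous_rad.comp_continuousOn hφ) hr
  have hdot : ContinuousOn (fun x => spatial (v x) ⬝ᵥ spatial (w x)) s :=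
    (continuous_spatial.comp continuous_fst |>.dotProduct
      (continuous_spatial.comp continuous_snd)).comp_continuousOn (hv.prodMk hw)
  simp only [inner4_eq]
  exact ((hlapse.mul (((continuous_apply 0).comp_continuousOn hv).mul
    ((continuous_apply 0).comp_continuousOn hw))).sub hdot).add
    ((continuousOn_const.sub (hlapse.inv₀ fun x hx => (lapseSq_pos hM (hext hx)).ne')).mul
      ((continuousOn_radialUnit_dot hφ hv hr).mul (continuousOn_radialUnit_dot hφ hw hr)))

end Continuity

theorem rot4_mem_exterior {M : ℝ} {R : Matrix (Fin 3) (Fin 3) ℝ} {p : Spacetime}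
    (hR : R ∈ Matrix.specialOrthogonalGroup (Fin 3) ℝ) (hp : p ∈ exterior M) :
    rot4 R p ∈ exterior M :=
  (show 2 * M < rad p from hp).trans_eq (rad_rot4 hR p).symm

namespace SphericalSlice

section RadialFunctions

variable {M σ : ℝ} (S : SphericalSlice M) {R : Matrix (Fin 3) (Fin 3) ℝ} {x : E3}

theorem continuousOn_fderiv_emb : ContinuousOn (fderiv ℝ S.emb) S.dom :=
  S.smooth.continuousOn_fderiv_of_isOpen S.isOpen_dom (by simp)

theorem isRadialOn_rad : IsRadialOn (fun x => rad (S.emb x)) S.dom :=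
  ⟨continuous_rad.comp_continuousOn S.smooth.continuousOn, fun R hR x hx =>
    (congrArg rad (S.equivariant R hR x hx)).trans (rad_rot4 hR _)⟩

theorem isRadialOn_nullCoord_radialTangent (hM : 0 ≤ M) (σ : ℝ) :
    IsRadialOn (fun x => nullCoord M σ (S.emb x) (S.radialTangent x)) S.dom where
  continuousOn := continuousOn_nullCoord hM S.smooth.continuousOn
    (S.continuousOn_fderiv_emb.clm_apply continuousOn_id) S.mapsTo
  rot3_eq R hR x hx := by
    rw [S.equivariant R hR x hx, S.radialTangent_rot3 hR hx, nullCoord_rot4 hR]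

theorem isRadialOn_nullCoord_normal (hM : 0 ≤ M) (hσ : σ * σ = 1) {N : E3 → Spacetime}
    (hN : S.IsUnitNormal N) : IsRadialOn (fun x => nullCoord M σ (S.emb x) (N x)) S.dom := by
  have hlapse : IsRadialOn (fun x => lapseSq M (rad (S.emb x))) S.dom :=
    S.isRadialOn_rad.comp (continuousOn_lapseSq M) fun _ hx => S.rad_emb_pos hM hx
  have hτ := S.isRadialOn_nullCoord_radialTangent hM σ
  have hτ' := S.isRadialOn_nullCoord_radialTangent hM (-σ)
  have hne : ∀ x ∈ S.dom, lapseSq M (rad (S.emb x))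
      * nullCoord M (-σ) (S.emb x) (S.radialTangent x) ≠ 0 := fun x hx =>
    mul_ne_zero (S.lapseSq_emb_pos hM hx).ne'
      (right_ne_zero_of_mul (S.nullCoord_radialTangent_mul_neg hM hσ hx).ne)
  refine ⟨(hτ.continuousOn.neg.div (hlapse.mul hτ').continuousOn hne).sqrt.congr fun x hx =>
    hN.nullCoord_eq hM hσ hx, fun R hR x hx => ?_⟩
  rw [hN.nullCoord_eq hM hσ hx, hN.nullCoord_eq hM hσ (S.rot_mem R hR x hx),
    hτ.rot3_eq R hR x hx, hτ'.rot3_eq R hR x hx, hlapse.rot3_eq R hR x hx]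

theorem neg_inner4_fderiv_emb (x v w : E3) :
    -inner4 M (S.emb x) (fderiv ℝ S.emb x v) (fderiv ℝ S.emb x w)
      = v.ofLp ⬝ᵥ S.induced x *ᵥ w.ofLp := by
  have hbasis : ∀ v : E3, fderiv ℝ S.emb x v
      = ∑ i, v i • fderiv ℝ S.emb x (EuclideanSpace.single i 1) := fun v => by
    conv_lhs => rw [← (EuclideanSpace.basisFun (Fin 3) ℝ).sum_repr v]
    simp only [map_sum, map_smul, EuclideanSpace.basisFun_repr, EuclideanSpace.basisFun_apply]
  rw [hbasis v, hbasis w]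
  simp only [inner4, induced, Matrix.mulVec, dotProduct, Fin.sum_univ_three, Fin.sum_univ_four,
    Matrix.of_apply, Pi.add_apply, Pi.smul_apply, smul_eq_mul]
  ring

theorem induced_rot3 (hR : R ∈ Matrix.specialOrthogonalGroup (Fin 3) ℝ) (hx : x ∈ S.dom) :
    Rᵀ * S.induced (rot3 R x) * R = S.induced x := by
  have h : ∀ v w : E3, v.ofLp ⬝ᵥ (Rᵀ * S.induced (rot3 R x) * R) *ᵥ w.ofLp
      = v.ofLp ⬝ᵥ S.induced x *ᵥ w.ofLp := fun v w => by
    rw [← S.neg_inner4_fderiv_emb, ← inner4_rot4 hR, ← S.fderiv_emb_rot3 hR hx,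
      ← S.fderiv_emb_rot3 hR hx, ← S.equivariant R hR x hx, S.neg_inner4_fderiv_emb,
      ← Matrix.mulVec_mulVec, ← Matrix.mulVec_mulVec, Matrix.dotProduct_mulVec,
      Matrix.vecMul_transpose]
    rfl
  ext i j
  simpa using h (EuclideanSpace.single i 1) (EuclideanSpace.single j 1)

theorem isRadialOn_det_induced (hM : 0 ≤ M) :
    IsRadialOn (fun x => (S.induced x).det) S.dom where
  continuousOn := by
    refine (continuous_id.matrix_det).comp_continuousOn <| continuousOn_pi.2 fun i =>
      continuousOn_pi.2 fun j => (continuousOn_inner4 hM S.smooth.continuousOn ?_ ?_ S.mapsTo).neg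
    all_goals exact S.continuousOn_fderiv_emb.clm_apply continuousOn_const
  rot3_eq R hR x hx := by
    rw [← S.induced_rot3 hR hx, Matrix.det_mul, Matrix.det_mul, Matrix.det_transpose,
      (Matrix.mem_specialOrthogonalGroup_iff.1 hR).2, one_mul, mul_one]

end RadialFunctions

section RotationIntegral

variable {M : ℝ} (S : SphericalSlice M) {g : E3 → ℝ} {K : Set E3}

theorem integral_circle_mul_fderiv_rotGen {h : Spacetime → ℝ} (hh : ContDiffOn ℝ 1 h (exterior M))
    (hg : IsRadialOn g S.dom) (i : Fin 3) {x : E3} (hx : x ∈ S.dom) :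
    ∫ s in (0)..(2 * Real.pi), g (rot3 (rotMat (Pi.single i 1) s) x)
      * fderiv ℝ h (S.emb (rot3 (rotMat (Pi.single i 1) s) x))
          (rotGen i (S.emb (rot3 (rotMat (Pi.single i 1) s) x))) = 0 := by
  have hR : ∀ s, rotMat (Pi.single i 1) s ∈ Matrix.specialOrthogonalGroup (Fin 3) ℝ :=
    rotMat_mem (single_dotProduct_single_self i)
  have hmem : ∀ s, rot4 (rotMat (Pi.single i 1) s) (S.emb x) ∈ exterior M := fun s =>
    rot4_mem_exterior (hR s) (S.mapsTo hx)
  have hderiv : ∀ s, HasDerivAt (fun s => h (rot4 (rotMat (Pi.single i 1) s) (S.emb x)))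
      (fderiv ℝ h (rot4 (rotMat (Pi.single i 1) s) (S.emb x))
        (rotGen i (rot4 (rotMat (Pi.single i 1) s) (S.emb x)))) s := fun s =>
    ((hh.contDiffAt (exterior_mem_nhds (hmem s))).differentiableAt
      one_ne_zero).hasFDerivAt.comp_hasDerivAt s (hasDerivAt_rot4 i (S.emb x) s)
  have hcircle : Continuous fun s => rot4 (rotMat (Pi.single i 1) s) (S.emb x) :=
    continuous_iff_continuousAt.2 fun s => (hasDerivAt_rot4 i (S.emb x) s).continuousAt
  have hcont : Continuous fun s => fderiv ℝ h (rot4 (rotMat (Pi.single i 1) s) (S.emb x))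
      (rotGen i (rot4 (rotMat (Pi.single i 1) s) (S.emb x))) :=
    ((hh.continuousOn_fderiv_of_isOpen (isOpen_exterior M) le_rfl).comp_continuous hcircle
      hmem).clm_apply ((continuous_rotGen i).comp hcircle)
  simp only [hg.rot3_eq _ (hR _) x hx, S.equivariant _ (hR _) x hx]
  rw [intervalIntegral.integral_const_mul, intervalIntegral.integral_eq_sub_of_hasDerivAt
    (fun s _ => hderiv s) (hcont.intervalIntegrable _ _), rot4_eq_self (rotMat_zero_mulVec _ _),
    rot4_eq_self (rotMat_two_pi_mulVec _ _), sub_self, mul_zero]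

theorem integrableOn_mul_rotDiv_and_integral_eq_zero {W : Spacetime → Fin 3 → ℝ}
    (hW : ContDiffOn ℝ 1 W (exterior M)) (hg : IsRadialOn g S.dom) (hKc : IsCompact K)
    (hKd : K ⊆ S.dom) (hK : IsRotInvariant K) :
    IntegrableOn (fun x => g x * rotDiv W (S.emb x)) K
      ∧ ∫ x in K, g x * rotDiv W (S.emb x) = 0 := by
  have hW' := contDiffOn_pi.1 hW
  have hcont : ∀ i, ContinuousOn (fun x =>
      g x * fderiv ℝ (fun y => W y i) (S.emb x) (rotGen i (S.emb x))) K := fun i =>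
    (hg.continuousOn.mul ((((hW' i).continuousOn_fderiv_of_isOpen (isOpen_exterior M)
      le_rfl).clm_apply (continuous_rotGen i).continuousOn).comp S.smooth.continuousOn
        S.mapsTo)).mono hKd
  have hint := fun i => (hcont i).integrableOn_compact (μ := volume) hKc
  simp only [rotDiv, Finset.mul_sum]
  refine ⟨integrable_finsetSum _ fun i _ => hint i, ?_⟩
  rw [integral_finsetSum _ fun i _ => hint i]
  exact Finset.sum_eq_zero fun i _ =>
    setIntegral_eq_zero_of_forall_integral_rotMat (single_dotProduct_single_self i) hKc hK
      (hcont i) fun x hx => S.integral_circle_mul_fderiv_rotGen (hW' i) hg i (hKd hx)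

end RotationIntegral

theorem setLIntegral_vol {M : ℝ} (S : SphericalSlice M) (hM : 0 ≤ M) {K : Set E3}
    (hK : MeasurableSet K) (hKd : K ⊆ S.dom) (f : E3 → ℝ) :
    ∫⁻ x in K, ENNReal.ofReal (f x) ∂S.vol
      = ∫⁻ x in K, ENNReal.ofReal (√(S.induced x).det * f x) := by
  rw [vol, restrict_withDensity hK, Measure.restrict_restrict_of_subset hKd,
    lintegral_withDensity_eq_lintegral_mul_non_measurable₀]
  · exact lintegral_congr fun x => (ENNReal.ofReal_mul (Real.sqrt_nonneg _)).symm
  · exact (((S.isRadialOn_det_induced hM).sqrt.continuousOn.mono hKd).aemeasurable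
      hK).ennreal_ofReal
  · exact Filter.Eventually.of_forall fun _ => ENNReal.ofReal_lt_top

end SphericalSlice

section RotPotential

variable {M σ c : ℝ} {o : ℤˣ} {F : Tensor2} {p : Spacetime}

/-- The field whose rotational divergence bounds the energy carried by `nullField M o F σ` from
below. -/
def rotPotential (M : ℝ) (o : ℤˣ) (F : Tensor2) (σ : ℝ) (p : Spacetime) : Fin 3 → ℝ :=
  spatial p ⨯₃ bochnerField (nullField M o F σ) p

theorem contDiffOn_rotPotential (hM : 0 ≤ M) (hF : ContDiffOn ℝ 2 F (exterior M)) :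
    ContDiffOn ℝ 1 (rotPotential M o F σ) (exterior M) := fun _ hp =>
  (contDiffAt_cross contDiffAt_spatial (contDiffAt_bochnerField (contDiffAt_nullField
    (rad_pos hM hp) (hF.contDiffAt (exterior_mem_nhds hp))) one_add_one_eq_two.le)).contDiffWithinAt

theorem mul_rotDiv_rotPotential_le (hM : 0 ≤ M) (hF : ContDiffOn ℝ 2 F (exterior M))
    (hA : ∀ y ∈ exterior M, ∀ a b, F y a b = -F y b a) (hσ : σ * σ = 1) (hc : |c| ≤ 10 / 9)
    (hp : p ∈ exterior M) :
    1 / 2 * (1 + σ * c * morawetz M (rad p)) * (2 / rad p ^ 2) * rotDiv (rotPotential M o F σ) p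
      ≤ nullVec M σ p ⬝ᵥ energyCovector M o F c p := by
  have hr := rad_pos hM hp
  have hFp := hF.contDiffAt (exterior_mem_nhds hp)
  have hσc : |σ * c| ≤ 10 / 9 := by
    rcases mul_self_eq_one_iff.1 hσ with rfl | rfl <;> simpa using hc
  have hm := one_sub_mul_ge (abs_morawetz_le (div_nonneg hM hr.le) (div_rad_le hM hp))
    ((abs_neg (σ * c)).trans_le hσc)
  have hweight : 0 ≤ 1 / 2 * (1 + σ * c * morawetz M (rad p)) := by
    rw [morawetz, mul_div_assoc]
    linarith
  have hexcess := rotDiv_le_hodgeExcess hr (contDiffAt_nullField (M := M) (o := o) (σ := σ) hr hFp)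
    (Filter.Eventually.of_forall (spatial_dot_nullField M o F σ))
  rw [mul_assoc]
  exact (mul_le_mul_of_nonneg_left hexcess hweight).trans
    (half_mul_hodgeExcess_le hM hp (hFp.of_le one_le_two) hA hσ hc)

end RotPotential

namespace SphericalSlice

section EnergyBound

variable {M σ : ℝ} (S : SphericalSlice M) {o : ℤˣ} {F : Tensor2} {N : E3 → Spacetime} {c : ℝ}

/-- The weight of the rotational divergence of `rotPotential M o F σ` in the lower bound for the
energy density, volume factor included. -/
def rotWeight (N : E3 → Spacetime) (c σ : ℝ) (x : E3) : ℝ :=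
  √(S.induced x).det * (nullCoord M σ (S.emb x) (N x)
    * (1 / 4 * (1 + σ * c * morawetz M (rad (S.emb x))) * (2 / rad (S.emb x) ^ 2)))

theorem isRadialOn_rotWeight (hM : 0 ≤ M) (hN : S.IsUnitNormal N) (hσ : σ * σ = 1) (c : ℝ) :
    IsRadialOn (S.rotWeight N c σ) S.dom := by
  have hφ : ContinuousOn (fun s => 1 / 4 * (1 + σ * c * morawetz M s) * (2 / s ^ 2)) (Ioi 0) := by
    have hdiv : ∀ (k : ℝ) (n : ℕ), ContinuousOn (fun s => k / s ^ n) (Ioi 0) := fun k n =>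
      continuousOn_const.div (continuousOn_pow n) fun _ hs => pow_ne_zero n (mem_Ioi.1 hs).ne'
    have hmorawetz : ContinuousOn (morawetz M) (Ioi 0) :=
      continuousOn_const.mul (continuousOn_const.sub (by simpa only [pow_one] using hdiv (3 * M) 1))
    exact (continuousOn_const.mul (continuousOn_const.add
      (continuousOn_const.mul hmorawetz))).mul (hdiv 2 2)
  exact (S.isRadialOn_det_induced hM).sqrt.mul ((S.isRadialOn_nullCoord_normal hM hσ hN).mul
    (S.isRadialOn_rad.comp hφ fun _ hx => S.rad_emb_pos hM hx))

theorem density_eq_dotProduct (x : E3) :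
    S.density o F N c x = N x ⬝ᵥ energyCovector M o F c (S.emb x) := rfl

theorem rotWeight_mul_rotDiv_add_le_density (hM : 0 ≤ M) (hF : ContDiffOn ℝ 2 F (exterior M))
    (hA : ∀ p ∈ exterior M, ∀ a b, F p a b = -F p b a) (hN : S.IsUnitNormal N)
    (hc : |c| ≤ 10 / 9) {x : E3} (hx : x ∈ S.dom) :
    S.rotWeight N c 1 x * rotDiv (rotPotential M o F 1) (S.emb x)
        + S.rotWeight N c (-1) x * rotDiv (rotPotential M o F (-1)) (S.emb x)
      ≤ √(S.induced x).det * S.density o F N c x := by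
  have hnull : ∀ σ : ℝ, σ * σ = 1 → nullCoord M σ (S.emb x) (N x) / 2
        * (1 / 2 * (1 + σ * c * morawetz M (rad (S.emb x))) * (2 / rad (S.emb x) ^ 2)
          * rotDiv (rotPotential M o F σ) (S.emb x))
      ≤ nullCoord M σ (S.emb x) (N x) / 2
        * (nullVec M σ (S.emb x) ⬝ᵥ energyCovector M o F c (S.emb x)) := fun σ hσ =>
    mul_le_mul_of_nonneg_left (mul_rotDiv_rotPotential_le hM hF hA hσ hc (S.mapsTo hx))
      (half_pos (hN.nullCoord_pos hM hσ hx)).le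
  have hdensity : S.density o F N c x
      = nullCoord M 1 (S.emb x) (N x) / 2
          * (nullVec M 1 (S.emb x) ⬝ᵥ energyCovector M o F c (S.emb x))
        + nullCoord M (-1) (S.emb x) (N x) / 2
          * (nullVec M (-1) (S.emb x) ⬝ᵥ energyCovector M o F c (S.emb x)) := by
    rw [density_eq_dotProduct]
    conv_lhs => rw [eq_add_nullVec (S.lapseSq_emb_pos hM hx).ne' (hN.spatial_eq hM hx)]
    rw [add_dotProduct, smul_dotProduct, smul_dotProduct, smul_eq_mul, smul_eq_mul]
  rw [hdensity]
  refine le_of_eq_of_le ?_ (mul_le_mul_of_nonneg_left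
    (add_le_add (hnull 1 (by norm_num)) (hnull (-1) (by norm_num))) (Real.sqrt_nonneg _))
  rw [rotWeight, rotWeight]
  ring

theorem setLIntegral_ofReal_neg_density_le (hM : 0 ≤ M) (hF : ContDiffOn ℝ 2 F (exterior M))
    (hA : ∀ p ∈ exterior M, ∀ a b, F p a b = -F p b a) (hN : S.IsUnitNormal N)
    (hc : |c| ≤ 10 / 9) {K : Set E3} (hKc : IsCompact K) (hKd : K ⊆ S.dom)
    (hK : IsRotInvariant K) :
    ∫⁻ x in K, ENNReal.ofReal (-S.density o F N c x) ∂S.vol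
      ≤ ∫⁻ x in K, ENNReal.ofReal (S.density o F N c x) ∂S.vol := by
  have hrot : ∀ σ : ℝ, σ * σ = 1 → _ := fun σ hσ =>
    S.integrableOn_mul_rotDiv_and_integral_eq_zero
      (contDiffOn_rotPotential (o := o) (σ := σ) hM hF) (S.isRadialOn_rotWeight hM hN hσ c)
      hKc hKd hK
  obtain ⟨hint₁, hzero₁⟩ := hrot 1 (by norm_num)
  obtain ⟨hint₂, hzero₂⟩ := hrot (-1) (by norm_num)
  rw [S.setLIntegral_vol hM hKc.measurableSet hKd, S.setLIntegral_vol hM hKc.measurableSet hKd]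
  simp only [mul_neg]
  refine lintegral_ofReal_neg_le_of_ae_le (hint₁.add hint₂) ?_ <|
    (ae_restrict_iff' hKc.measurableSet).2 <| Filter.Eventually.of_forall fun x hx =>
      S.rotWeight_mul_rotDiv_add_le_density hM hF hA hN hc (hKd hx)
  exact ((integral_add hint₁ hint₂).trans (by rw [hzero₁, hzero₂, add_zero])).ge

theorem lintegral_ofReal_neg_density_le (hM : 0 ≤ M) (hF : ContDiffOn ℝ 2 F (exterior M))
    (hA : ∀ p ∈ exterior M, ∀ a b, F p a b = -F p b a) (hN : S.IsUnitNormal N)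
    (hc : |c| ≤ 10 / 9) :
    ∫⁻ x, ENNReal.ofReal (-S.density o F N c x) ∂S.vol
      ≤ ∫⁻ x, ENNReal.ofReal (S.density o F N c x) ∂S.vol := by
  have hvol : S.vol = S.vol.restrict (⋃ n, compactShell S.dom n) := by
    rw [iUnion_compactShell S.isOpen_dom, vol, restrict_withDensity S.isOpen_dom.measurableSet,
      Measure.restrict_restrict_of_subset Subset.rfl]
  have hdir : Directed (· ⊆ ·) (compactShell S.dom) := (monotone_compactShell S.dom).directed_le
  rw [hvol, setLIntegral_iUnion_of_directed _ hdir, setLIntegral_iUnion_of_directed _ hdir]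
  exact iSup_mono fun n => S.setLIntegral_ofReal_neg_density_le hM hF hA hN hc
    (isCompact_compactShell S.dom n) (compactShell_subset S.dom n)
    (IsRotInvariant.compactShell S.rot_mem n)

end EnergyBound

end SphericalSlice

end Schwarzschild

end

theorem mainTheorem3_general {M : ℝ} (hM : 0 ≤ M) (o : ℤˣ) {F : Schwarzschild.Tensor2}
    (hF : ContDiffOn ℝ 2 F (Schwarzschild.exterior M))
    (hA : ∀ p ∈ Schwarzschild.exterior M, ∀ a b, F p a b = -F p b a)
    (S : Schwarzschild.SphericalSlice M) {N : Schwarzschild.E3 → Schwarzschild.Spacetime}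
    (hN : S.IsUnitNormal N) {c₁ : ℝ} (hc : |c₁| ≤ 10 / 9) :
    (∫⁻ x, ENNReal.ofReal (-(S.density o F N c₁ x)) ∂S.vol
        ≤ ∫⁻ x, ENNReal.ofReal (S.density o F N c₁ x) ∂S.vol) ∧
      0 ≤ ∫ x, S.density o F N c₁ x ∂S.vol := by
  have h := S.lintegral_ofReal_neg_density_le (o := o) hM hF hA hN hc
  exact ⟨h, Schwarzschild.integral_nonneg_of_lintegral_ofReal_neg_le h⟩

theorem mainTheorem3 (M : ℝ) (hM : 0 < M) (o : ℤˣ)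
    (F : Schwarzschild.Tensor2) (hF : Schwarzschild.IsMaxwellField M F)
    (S : Schwarzschild.SphericalSlice M)
    (N : Schwarzschild.E3 → Schwarzschild.Spacetime) (hN : S.IsUnitNormal N)
    (c₁ : ℝ) (hc : |c₁| ≤ 10 / 9) :
    (∫⁻ x, ENNReal.ofReal (-(S.density o F N c₁ x)) ∂S.vol
        ≤ ∫⁻ x, ENNReal.ofReal (S.density o F N c₁ x) ∂S.vol) ∧
      0 ≤ ∫ x, S.density o F N c₁ x ∂S.vol :=
  mainTheorem3_general hM.le o (hF.smooth.of_le ENat.LEInfty.out) hF.antisymm S hN hc
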